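/- **Definitions.** For $n\ge 0$ let $C_n$ be the poset of nonempty subintervals of $[n]=\{0,\dots,n\}$, ordered by reverse inclusion. A functor $F$ on $C_n$ has the *pullback property* if $F(I\cup J)=F(I)\times_{F(I\cap J)}F(J)$ for all intervals $I,J$ that meet. $\mathrm{Span}$ is the simplicial set whose $n$-simplices are the functors $C_n\to\mathrm{FinSet}$ with the pullback property. A commutative diagram of finite sets $$\begin{array}{ccccc}A&\leftarrow&B&\to&B'\\ \downarrow&&\downarrow&&\downarrow\\ X&\leftarrow&Y&\to&Z\end{array}$$ is *precromulent* if its right-hand square is a pullback, and *cromulent* if it is terminal among the precromulent diagrams with the same edge $A\to X\leftarrow Y\to Z$. $D^\times_+$ is the bisimplicial set whose $(m,n)$-simplices are the functors $F:C_m\times[n]\to\mathrm{FinSet}$ such that each $F|_{C_m\times\{k\}}$ has the pullback property, and the restriction of $F$ to $\{[i],[i,j],[j]\}\times\{k,l\}$ is cromulent for all $i\le j$ and $k\le l$. The $n$-th distributahedron $\Xi^n$ is the bisimplicial set whose $(p,q)$-simplices $a_0\cdots a_q|b_0\cdots b_p$ are the sequences $a_0\le\dots\le a_q\le b_0\le\dots\le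 b_p$ in $[n]$ (the $b$'s in the first simplicial direction, the $a$'s in the second). $\mathrm{RSpan}=\mathrm{Span}\circ_{D^\times_+}\mathrm{FinSet}$ is the simplicial set whose $n$-simplices are the maps $\Xi^n\to D^\times_+$. Its vertices are finite sets, and its edges are diagrams $X\leftarrow U\to V\to Y$ of finite sets. A *$(2,1)$-category* is a quasicategory in which every inner horn of dimension $>2$ has a unique filler. An *acyclic Kan fibration* is a map with the right lifting property against all $\partial\Delta^n\to\Delta^n$, $n\geq 0$ (in particular, between quasicategories it is an equivalence). A product of a family of vertices of a quasicategory is a terminal vertex of the overcategory of that family. An *algebraic theory* is a quasicategory $T$ together with an essentially surjective functor $\mathrm{Fin}^{\mathrm{op}}\to T$ that sends finite product diagrams to finite product diagrams, where $\mathrm{Fin}$ is the category of finite sets. Let $\mathrm{Fin}_*$ be the category of pointed finite sets and let $R:\mathrm{Fin}_*^{\mathrm{op}}\to\mathrm{Span}$ be the functor given on objects by $P\mapsto P\setminus\{*\}$, which sends a pointed map $f:Q\to P$ to the span $P\setminus\{*\}\leftarrow f^{-1}(P\setminus\{*\})\to Q\setminus\{*\}$. Let $I_\Pi,I_\Sigma:\mathrm{Span}\to\mathrm{RSpan}$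 be the inclusions of the multiplicative and of the additive structure, given on edges by $(X\leftarrow U\to Y)\mapsto(X\leftarrow U\to Y=Y)$ and $(X\leftarrow U\to Y)\mapsto(X\leftarrow U=U\to Y)$. **Theorem.** 1. $\mathrm{RSpan}$ is a quasicategory, and it is equivalent to a $(2,1)$-category: there are a $(2,1)$-category $\mathcal C$ and an acyclic Kan fibration $\mathrm{RSpan}\to\mathcal C$. 2. $\mathrm{RSpan}$ has all finite products, and they are given by disjoint unions: for every finite family $(X_i)_{i\in\iota}$ of finite sets (possibly empty), the edges $\bigsqcup_i X_i\leftarrow X_i= X_i= X_i$ given by the inclusions form a product cone. 3. For $I=I_\Pi$ and for $I=I_\Sigma$, the map $I\circ R:\mathrm{Fin}_*^{\mathrm{op}}\to\mathrm{RSpan}$ preserves finite products and is essentially surjective, and it makes $\mathrm{RSpan}$ into an algebraic theory: the composite $\mathrm{Fin}^{\mathrm{op}}\xrightarrow{(-)_+}\mathrm{Fin}_*^{\mathrm{op}}\xrightarrow{I\circ R}\mathrm{RSpan}$ is an algebraic theory. (It is called the theory of $E_\infty$-semirings.) -/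

import Mathlib

open CategoryTheory Opposite Simplicial

universe u v w

namespace RingSpans

/-! ## Notions about quasicategories -/

/-- A `(2,1)`-category: a quasicategory in which every inner horn of dimension greater
than `2` has exactly one filler. -/
def IsTwoOneCategory (X : SSet.{u}) : Prop :=
  SSet.Quasicategory X ∧
    ∀ (n : ℕ) (i : Fin (n + 1)), 2 < n → 0 < i → i < Fin.last n →
      ∀ s : (Λ[n, i] : SSet.{u}) ⟶ X, ∃! t : Δ[n] ⟶ X, Λ[n, i].ι ≫ t = s

/-- An acyclic Kan fibration: a map with the right lifting property against all the
boundary inclusions `∂Δ[n] ⟶ Δ[n]`, for `n ≥ 0`. -/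
def IsAcyclicKan {X Y : SSet.{u}} (p : X ⟶ Y) : Prop :=
  ∀ n : ℕ, HasLiftingProperty (∂Δ[n] : (Δ[n] : SSet.{u}).Subcomplex).ι p

/-- The `i`-th vertex of an `n`-simplex. -/
def vertex {X : SSet.{u}} {n : SimplexCategory} (x : X.obj (op n)) (i : Fin (n.len + 1)) :
    X _⦋0⦌ :=
  X.map (SimplexCategory.const ⦋0⦌ n i).op x

/-- A vertex `P` is (strongly) terminal if every map `∂Δ[n] ⟶ X`, `n ≥ 1`, which sends the
last vertex to `P` extends to `Δ[n]`. -/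
def IsTerminalVertex (X : SSet.{u}) (P : X _⦋0⦌) : Prop :=
  ∀ (n : ℕ) (f : (∂Δ[n + 1] : SSet.{u}) ⟶ X),
    (∀ z : (∂Δ[n + 1] : SSet.{u}) _⦋0⦌,
      SSet.stdSimplex.asOrderHom z.1 0 = Fin.last (n + 1) → f.app (op ⦋0⦌) z = P) →
    ∃ g : Δ[n + 1] ⟶ X, (∂Δ[n + 1] : (Δ[n + 1] : SSet.{u}).Subcomplex).ι ≫ g = f

/-- The map `[m] ⋆ [0] → [n] ⋆ [0]` induced by `f : [m] → [n]`. -/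
def joinPointMap {m n : ℕ} (f : Fin (m + 1) →o Fin (n + 1)) :
    Fin (m + 1 + 1) →o Fin (n + 1 + 1) where
  toFun := Fin.lastCases (Fin.last _) (fun i => (f i).castSucc)
  monotone' := by
    intro i j h
    induction j using Fin.lastCases with
    | last => simp [Fin.le_last]
    | cast j =>
      induction i using Fin.lastCases with
      | last => exact absurd h (by simp)
      | cast i =>
        simp only [Fin.lastCases_castSucc, Fin.castSucc_le_castSucc_iff]
        exact f.monotone (by simpa using h)

lemma joinPointMap_last {m n : ℕ} (f : Fin (m + 1) →o Fin (n + 1)) :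
    joinPointMap f (Fin.last (m + 1)) = Fin.last (n + 1) := by
  change Fin.lastCases (motive := fun _ => Fin (n + 1 + 1)) _ _ _ = _
  exact Fin.lastCases_last

lemma joinPointMap_castSucc {m n : ℕ} (f : Fin (m + 1) →o Fin (n + 1)) (i : Fin (m + 1)) :
    joinPointMap f i.castSucc = (f i).castSucc := by
  change Fin.lastCases (motive := fun _ => Fin (n + 1 + 1)) _ _ _ = _
  exact Fin.lastCases_castSucc i

/-- The functor `[n] ↦ [n] ⋆ [0] = [n + 1]`. -/
def joinPoint : SimplexCategory ⥤ SimplexCategory where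
  obj n := ⦋n.len + 1⦌
  map f := SimplexCategory.Hom.mk (joinPointMap f.toOrderHom)
  map_id _ := by
    refine congrArg SimplexCategory.Hom.mk (OrderHom.ext _ _ (funext fun i => ?_))
    induction i using Fin.lastCases with
    | last => exact joinPointMap_last _
    | cast i => exact joinPointMap_castSucc _ i
  map_comp f g := by
    refine congrArg SimplexCategory.Hom.mk (OrderHom.ext _ _ (funext fun i => ?_))
    induction i using Fin.lastCases with
    | last =>
      exact (joinPointMap_last _).trans
        ((congrArg (joinPointMap g.toOrderHom) (joinPointMap_last f.toOrderHom)).trans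
          (joinPointMap_last _)).symm
    | cast i =>
      exact (joinPointMap_castSucc _ i).trans
        ((congrArg (joinPointMap g.toOrderHom) (joinPointMap_castSucc f.toOrderHom i)).trans
          (joinPointMap_castSucc _ _)).symm

/-- The inclusion `[n] → [n] ⋆ [0]` of the first `n + 1` vertices. -/
def toJoinPoint : 𝟭 SimplexCategory ⟶ joinPoint where
  app _ := SimplexCategory.Hom.mk (Fin.castSuccOrderEmb.toOrderHom)
  naturality _ _ f :=
    congrArg SimplexCategory.Hom.mk (OrderHom.ext _ _ (funext fun i =>
      (joinPointMap_castSucc f.toOrderHom i).symm))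

lemma const_last_comp_joinPoint {m n : SimplexCategory} (f : m ⟶ n) :
    SimplexCategory.const ⦋0⦌ (joinPoint.obj m) (Fin.last _) ≫ joinPoint.map f =
      SimplexCategory.const ⦋0⦌ (joinPoint.obj n) (Fin.last _) := by
  refine congrArg SimplexCategory.Hom.mk (OrderHom.ext _ _ (funext fun i => ?_))
  exact joinPointMap_last _

/-- The `n`-simplices of the overcategory `X_{/A}`, where `A` is a family of vertices of `X`
indexed by a set `ι`, seen as a discrete diagram. By definition, they are the maps
`Δ[n] ⋆ ι ⟶ X` extending `A`. Such a map amounts to an `n`-simplex of `X` together with, for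
each `i : ι`, a simplex `Δ[n] ⋆ Δ[0] ⟶ X` which restricts to it on `Δ[n]` and whose last vertex
is `A i`. -/
@[ext]
structure OverSimplex {X : SSet.{u}} {ι : Type} (A : ι → X _⦋0⦌) (n : SimplexCategory) :
    Type u where
  base : X.obj (op n)
  leg : ι → X.obj (op (joinPoint.obj n))
  restrict : ∀ i, X.map (toJoinPoint.app n).op (leg i) = base
  last : ∀ i, vertex (leg i) (Fin.last _) = A i

/-- The overcategory `X_{/A}` of a family of vertices. -/
def overFamily {X : SSet.{u}} {ι : Type} (A : ι → X _⦋0⦌) : SSet.{u} where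
  obj n := OverSimplex A n.unop
  map f := ↾fun x =>
    { base := X.map f x.base
      leg := fun i => X.map (joinPoint.map f.unop).op (x.leg i)
      restrict := fun i => by
        rw [← x.restrict i, ← Functor.map_comp_apply, ← Functor.map_comp_apply]
        have := congrArg Quiver.Hom.op (toJoinPoint.naturality f.unop)
        exact congrArg (fun g => X.map g (x.leg i)) this.symm
      last := fun i => by
        rw [← x.last i, vertex, vertex, ← Functor.map_comp_apply, ← op_comp,
          const_last_comp_joinPoint] }
  map_id _ := by
    refine ConcreteCategory.hom_ext _ _ fun x => ?_
    apply OverSimplex.ext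
    · exact Functor.map_id_apply X _ x.base
    funext i
    change X.map (joinPoint.map (𝟙 _)).op (x.leg i) = x.leg i
    rw [joinPoint.map_id]
    exact Functor.map_id_apply X _ (x.leg i)
  map_comp f g := by
    refine ConcreteCategory.hom_ext _ _ fun x => ?_
    apply OverSimplex.ext
    · exact Functor.map_comp_apply X _ _ _
    funext i
    change X.map (joinPoint.map (g.unop ≫ f.unop)).op _ = _
    rw [joinPoint.map_comp]
    exact Functor.map_comp_apply X _ _ _

/-- A cone over a family of vertices is a product cone (a limit cone) if it is a terminal
vertex of the overcategory. -/
def IsProductCone {X : SSet.{u}} {ι : Type} (A : ι → X _⦋0⦌) (c : (overFamily A) _⦋0⦌) : Prop :=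
  IsTerminalVertex (overFamily A) c

/-- Every finite family of vertices, including the empty one, has a product. -/
def HasFiniteProducts (X : SSet.{u}) : Prop :=
  ∀ (ι : Type) [Finite ι] (A : ι → X _⦋0⦌), ∃ c, IsProductCone A c

/-- The map of overcategories induced by a map of simplicial sets. -/
def overFamilyMap {X Y : SSet.{u}} (F : X ⟶ Y) {ι : Type} (A : ι → X _⦋0⦌) :
    overFamily A ⟶ overFamily (fun i => F.app (op ⦋0⦌) (A i)) where
  app n := ↾fun x =>
    { base := F.app n x.base
      leg := fun i => F.app _ (x.leg i)
      restrict := fun i => by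
        rw [← x.restrict i]
        exact (NatTrans.naturality_apply F _ _).symm
      last := fun i => by
        rw [← x.last i]
        exact (NatTrans.naturality_apply F _ _).symm }
  naturality _ _ f := by
    ext x
    exact OverSimplex.ext (NatTrans.naturality_apply F _ _)
      (funext fun i => NatTrans.naturality_apply F _ _)

/-- Finite product cones are sent to finite product cones. -/
def PreservesFiniteProducts {X Y : SSet.{u}} (F : X ⟶ Y) : Prop :=
  ∀ (ι : Type) [Finite ι] (A : ι → X _⦋0⦌) (c : (overFamily A) _⦋0⦌),
    IsProductCone A c → IsProductCone _ ((overFamilyMap F A).app (op ⦋0⦌) c)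

/-- Every vertex of the target is joined by an equivalence to a vertex in the image. -/
def IsEssentiallySurjective {X Y : SSet.{u}} (F : X ⟶ Y) : Prop :=
  ∀ y : Y _⦋0⦌, ∃ (x : X _⦋0⦌) (e : SSet.Edge (F.app (op ⦋0⦌) x) y), Nonempty e.InvStruct

/-- The category of finite sets. -/
abbrev FinSet : Type 1 := FintypeCat.{0}

/-- An algebraic theory: a quasicategory `T` with a product-preserving, essentially surjective
functor from (the nerve of) the opposite of the category of finite sets. -/
def IsAlgebraicTheory {T : SSet.{1}} (F : nerve FinSetᵒᵖ ⟶ T) : Prop :=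
  SSet.Quasicategory T ∧ PreservesFiniteProducts F ∧ IsEssentiallySurjective F

/-! ## Bisimplicial sets and the composite of a distributive law -/

/-- Bisimplicial sets. The value at `([p], [q])` is the set of `(p, q)`-simplices. -/
abbrev BiSSet : Type (u + 1) := (SimplexCategory × SimplexCategory)ᵒᵖ ⥤ Type u

/-- A `(p, q)`-simplex `a₀ ⋯ a_q | b₀ ⋯ b_p` of the `n`-th distributahedron: an ordered map from
the concatenation of `[q]` and `[p]` to `[n]`. The entries to the right of the bar belong to the
first simplicial direction, those to the left to the second one. -/
@[ext]
structure DistCell (n p q : ℕ) : Type u where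
  a : Fin (q + 1) →o Fin (n + 1)
  b : Fin (p + 1) →o Fin (n + 1)
  le : a (Fin.last q) ≤ b 0

lemma DistCell.le' {n p q : ℕ} (c : DistCell.{u} n p q) (i : Fin (q + 1)) (j : Fin (p + 1)) :
    c.a i ≤ c.b j :=
  (c.a.monotone (Fin.le_last i)).trans (c.le.trans (c.b.monotone (Fin.zero_le j)))

/-- The distributahedra, a cosimplicial bisimplicial set. -/
def distributahedron : SimplexCategory ⥤ BiSSet.{u} where
  obj n :=
    { obj := fun x => DistCell.{u} n.len x.unop.1.len x.unop.2.len
      map := fun f => ↾fun c =>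
        ⟨c.a.comp f.unop.2.toOrderHom, c.b.comp f.unop.1.toOrderHom, c.le' _ _⟩
      map_id := fun _ => rfl
      map_comp := fun _ _ => rfl }
  map g :=
    { app := fun _ => ↾fun c =>
        ⟨g.toOrderHom.comp c.a, g.toOrderHom.comp c.b, g.toOrderHom.monotone c.le⟩
      naturality := fun _ _ _ => rfl }
  map_id _ := rfl
  map_comp _ _ := rfl

/-- The composite `S ∘_D T` attached to a bisimplicial set `D` with `S = D_{*,0}` and
`T = D_{0,*}`: an `n`-simplex is a map of bisimplicial sets from the `n`-th distributahedron
to `D`. -/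
def composite (D : BiSSet.{u}) : SSet.{u} := distributahedron.{u}.op ⋙ yoneda.obj D

/-! ## Spans -/

/-- The nonempty subintervals `[lo, hi]` of `[n] = {0, …, n}`. -/
@[ext]
structure Subinterval (n : ℕ) : Type where
  lo : Fin (n + 1)
  hi : Fin (n + 1)
  le : lo ≤ hi

/-- Subintervals are ordered by reverse inclusion. -/
instance (n : ℕ) : PartialOrder (Subinterval n) where
  le I J := I.lo ≤ J.lo ∧ J.hi ≤ I.hi
  le_refl _ := ⟨le_rfl, le_rfl⟩
  le_trans _ _ _ h h' := ⟨h.1.trans h'.1, h'.2.trans h.2⟩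
  le_antisymm _ _ h h' := Subinterval.ext (le_antisymm h.1 h'.1) (le_antisymm h'.2 h.2)

/-- The image of a subinterval: `[i, j] ↦ [f i, f j]`. -/
def Subinterval.map {m n : ℕ} (f : Fin (m + 1) →o Fin (n + 1)) :
    Subinterval m →o Subinterval n where
  toFun I := ⟨f I.lo, f I.hi, f.monotone I.le⟩
  monotone' _ _ h := ⟨f.monotone h.1, f.monotone h.2⟩

/-- The pullback property of a diagram `F` indexed by subintervals: if two intervals `I`, `J`
intersect, then `F (I ∪ J)` is the pullback of `F I` and `F J` over `F (I ∩ J)`. The condition is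
automatic if one interval contains the other, so that it is enough to consider `I = [i, j]` and
`J = [k, l]` with `i ≤ k ≤ j ≤ l`, where `I ∪ J = [i, l]` and `I ∩ J = [k, j]`. -/
def HasPullbackProperty {C : Type w} [Category.{v} C] {n : ℕ} (F : Subinterval n ⥤ C) : Prop :=
  ∀ (i k j l : Fin (n + 1)) (hik : i ≤ k) (hkj : k ≤ j) (hjl : j ≤ l),
    IsPullback
      (F.map (homOfLE (⟨le_rfl, hjl⟩ :
        (⟨i, l, (hik.trans hkj).trans hjl⟩ : Subinterval n) ≤ ⟨i, j, hik.trans hkj⟩)))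
      (F.map (homOfLE (⟨hik, le_rfl⟩ :
        (⟨i, l, (hik.trans hkj).trans hjl⟩ : Subinterval n) ≤ ⟨k, l, hkj.trans hjl⟩)))
      (F.map (homOfLE (⟨hik, le_rfl⟩ :
        (⟨i, j, hik.trans hkj⟩ : Subinterval n) ≤ ⟨k, j, hkj⟩)))
      (F.map (homOfLE (⟨le_rfl, hjl⟩ :
        (⟨k, l, hkj.trans hjl⟩ : Subinterval n) ≤ ⟨k, j, hkj⟩)))

/-- The span quasicategory of a category. -/
def spanSSet (C : Type w) [Category.{v} C] : SSet.{max v w} where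
  obj n := { F : Subinterval n.unop.len ⥤ C // HasPullbackProperty F }
  map f := ↾fun F => ⟨(Subinterval.map f.unop.toOrderHom).monotone.functor ⋙ F.1,
    fun _ _ _ _ hik hkj hjl => F.2 _ _ _ _ (f.unop.toOrderHom.monotone hik)
      (f.unop.toOrderHom.monotone hkj) (f.unop.toOrderHom.monotone hjl)⟩
  map_id _ := rfl
  map_comp _ _ := rfl

/-- The quasicategory `Span` of spans of finite sets. -/
abbrev Span : SSet.{1} := spanSSet FinSet

/-! ## The bisimplicial set `D^×_+` and the quasicategory `RSpan` -/

/-- A diagram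
```
A <-t- B -u-> C
|a     |b     |c
v      v      v
X <-f- Y -g-> Z
```
is precromulent if it commutes and its right-hand square is a pullback. -/
structure IsPrecromulent {C : Type w} [Category.{v} C] {A B B' X Y Z : C}
    (a : A ⟶ X) (f : Y ⟶ X) (g : Y ⟶ Z)
    (t : B ⟶ A) (u : B ⟶ B') (b : B ⟶ Y) (c : B' ⟶ Z) : Prop where
  comm : t ≫ a = b ≫ f
  isPullback : IsPullback u b c g

/-- A precromulent diagram is cromulent if it is terminal among the precromulent diagrams with
the same edge `A ⟶ X ⟵ Y ⟶ Z`. -/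
structure IsCromulent {C : Type w} [Category.{v} C] {A B B' X Y Z : C}
    (a : A ⟶ X) (f : Y ⟶ X) (g : Y ⟶ Z)
    (t : B ⟶ A) (u : B ⟶ B') (b : B ⟶ Y) (c : B' ⟶ Z) : Prop
    extends IsPrecromulent a f g t u b c where
  terminal : ∀ {P P' : C} (t' : P ⟶ A) (u' : P ⟶ P') (b' : P ⟶ Y) (c' : P' ⟶ Z),
    IsPrecromulent a f g t' u' b' c' →
      ∃! r : (P ⟶ B) × (P' ⟶ B'),
        r.1 ≫ t = t' ∧ r.1 ≫ u = u' ≫ r.2 ∧ r.1 ≫ b = b' ∧ r.2 ≫ c = c'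

/-- The poset `C^m × Δ^n` of pairs of a subinterval of `[m]` and an element of `[n]`. -/
@[ext]
structure Grid (m n : ℕ) : Type where
  int : Subinterval m
  lev : Fin (n + 1)

instance (m n : ℕ) : PartialOrder (Grid m n) where
  le x y := x.int ≤ y.int ∧ x.lev ≤ y.lev
  le_refl _ := ⟨le_rfl, le_rfl⟩
  le_trans _ _ _ h h' := ⟨h.1.trans h'.1, h.2.trans h'.2⟩
  le_antisymm _ _ h h' := Grid.ext (le_antisymm h.1 h'.1) (le_antisymm h.2 h'.2)

/-- The functoriality of `C^m × Δ^n` in both variables. -/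
def Grid.map {m m' n n' : ℕ} (f : Fin (m + 1) →o Fin (m' + 1)) (g : Fin (n + 1) →o Fin (n' + 1)) :
    Grid m n →o Grid m' n' where
  toFun x := ⟨Subinterval.map f x.int, g x.lev⟩
  monotone' _ _ h := ⟨(Subinterval.map f).monotone h.1, g.monotone h.2⟩

/-- The inclusion `C^m × {k} ⊆ C^m × Δ^n`. -/
def Grid.row {m n : ℕ} (k : Fin (n + 1)) : Subinterval m →o Grid m n where
  toFun I := ⟨I, k⟩
  monotone' _ _ h := ⟨h, le_rfl⟩

/-- The conditions on the `(m, n)`-simplices of `D^×_+`: each row is a span diagram, and the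
restriction to `{[i], [i, j], [j]} × {k, l}` is cromulent for all `i ≤ j` and `k ≤ l`. -/
structure IsDistDiagram {m n : ℕ} (F : Grid m n ⥤ FinSet) : Prop where
  row : ∀ k, HasPullbackProperty ((Grid.row k).monotone.functor ⋙ F)
  cromulent : ∀ (i j : Fin (m + 1)) (hij : i ≤ j) (k l : Fin (n + 1)) (hkl : k ≤ l),
    IsCromulent
      (F.map (homOfLE (⟨le_rfl, hkl⟩ : (⟨⟨i, i, le_rfl⟩, k⟩ : Grid m n) ≤ ⟨⟨i, i, le_rfl⟩, l⟩)))
      (F.map (homOfLE (⟨⟨le_rfl, hij⟩, le_rfl⟩ :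
        (⟨⟨i, j, hij⟩, l⟩ : Grid m n) ≤ ⟨⟨i, i, le_rfl⟩, l⟩)))
      (F.map (homOfLE (⟨⟨hij, le_rfl⟩, le_rfl⟩ :
        (⟨⟨i, j, hij⟩, l⟩ : Grid m n) ≤ ⟨⟨j, j, le_rfl⟩, l⟩)))
      (F.map (homOfLE (⟨⟨le_rfl, hij⟩, le_rfl⟩ :
        (⟨⟨i, j, hij⟩, k⟩ : Grid m n) ≤ ⟨⟨i, i, le_rfl⟩, k⟩)))
      (F.map (homOfLE (⟨⟨hij, le_rfl⟩, le_rfl⟩ :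
        (⟨⟨i, j, hij⟩, k⟩ : Grid m n) ≤ ⟨⟨j, j, le_rfl⟩, k⟩)))
      (F.map (homOfLE (⟨le_rfl, hkl⟩ : (⟨⟨i, j, hij⟩, k⟩ : Grid m n) ≤ ⟨⟨i, j, hij⟩, l⟩)))
      (F.map (homOfLE (⟨le_rfl, hkl⟩ : (⟨⟨j, j, le_rfl⟩, k⟩ : Grid m n) ≤ ⟨⟨j, j, le_rfl⟩, l⟩)))

/-- The bisimplicial set `D^×_+`, between `Span` and the category of finite sets. -/
def timesPlus : BiSSet.{1} where
  obj x := { F : Grid x.unop.1.len x.unop.2.len ⥤ FinSet // IsDistDiagram F }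
  map f := ↾fun F =>
    ⟨(Grid.map f.unop.1.toOrderHom f.unop.2.toOrderHom).monotone.functor ⋙ F.1,
      { row := fun _ _ _ _ _ hik hkj hjl => F.2.row _ _ _ _ _ (f.unop.1.toOrderHom.monotone hik)
          (f.unop.1.toOrderHom.monotone hkj) (f.unop.1.toOrderHom.monotone hjl)
        cromulent := fun _ _ hij _ _ hkl => F.2.cromulent _ _ (f.unop.1.toOrderHom.monotone hij)
          _ _ (f.unop.2.toOrderHom.monotone hkl) }⟩
  map_id _ := rfl
  map_comp _ _ := rfl

/-- `RSpan = Span ∘_{D^×_+} FinSet`. -/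
def RSpan : SSet.{1} := composite timesPlus

/-! ## Maps into `RSpan` -/

/-- For a simplex `c = a₀ ⋯ a_q | b₀ ⋯ b_p`, the map of posets `([i, j], k) ↦ [b_i, b_j]`. -/
def multIndex {n p q : ℕ} (c : DistCell.{u} n p q) : Grid p q →o Subinterval n where
  toFun x := ⟨c.b x.int.lo, c.b x.int.hi, c.b.monotone x.int.le⟩
  monotone' _ _ h := ⟨c.b.monotone h.1.1, c.b.monotone h.1.2⟩

/-- For a simplex `c = a₀ ⋯ a_q | b₀ ⋯ b_p`, the map of posets `([i, j], k) ↦ [a_k, b_j]`. -/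
def addIndex {n p q : ℕ} (c : DistCell.{u} n p q) : Grid p q →o Subinterval n where
  toFun x := ⟨c.a x.lev, c.b x.int.hi, c.le' _ _⟩
  monotone' _ _ h := ⟨c.a.monotone h.2, c.b.monotone h.1.2⟩

lemma isCromulent_of_isIso {C : Type w} [Category.{v} C] {A B B' X Y Z : C}
    (a : A ⟶ X) (f : Y ⟶ X) (g : Y ⟶ Z) (t : B ⟶ A) (u : B ⟶ B') (b : B ⟶ Y) (c : B' ⟶ Z)
    [IsIso a] [IsIso b] [IsIso c] (h : t ≫ a = b ≫ f) (h' : u ≫ c = b ≫ g) :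
    IsCromulent a f g t u b c where
  comm := h
  isPullback := IsPullback.of_vert_isIso ⟨h'⟩
  terminal {P P'} t' u' b' c' hP := by
    refine ⟨(b' ≫ inv b, c' ≫ inv c), ⟨?_, ?_, by simp, by simp⟩, ?_⟩
    · rw [← cancel_mono a]
      simp [h, hP.comm]
    · rw [← cancel_mono c]
      simp [h', hP.isPullback.w]
    · rintro ⟨r, r'⟩ ⟨-, -, h₁, h₂⟩
      ext <;> simp [← h₁, ← h₂]

lemma isCromulent_of_isPullback {C : Type w} [Category.{v} C] {A B B' X Y Z : C}
    (a : A ⟶ X) (f : Y ⟶ X) (g : Y ⟶ Z) (t : B ⟶ A) (u : B ⟶ B') (b : B ⟶ Y) (c : B' ⟶ Z)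
    [IsIso u] [IsIso g] (h : IsPullback t b a f) (h' : u ≫ c = b ≫ g) :
    IsCromulent a f g t u b c where
  comm := h.w
  isPullback := IsPullback.of_horiz_isIso ⟨h'⟩
  terminal {P P'} t' u' b' c' hP := by
    have : IsIso u' := hP.isPullback.isIso_fst_of_isIso
    refine ⟨(h.lift t' b' hP.comm, inv u' ≫ h.lift t' b' hP.comm ≫ u),
      ⟨by simp, by simp, by simp, ?_⟩, ?_⟩
    · rw [← cancel_epi u']
      simp [h', hP.isPullback.w]
    · rintro ⟨r, r'⟩ ⟨h₁, h₂, h₃, -⟩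
      have hr : r = h.lift t' b' hP.comm := h.hom_ext (by simpa using h₁) (by simpa using h₃)
      subst hr
      exact Prod.ext rfl (by simp [h₂])

lemma isIso_map_of_eq {C : Type w} [Category.{v} C] {n : ℕ} (G : Subinterval n ⥤ C)
    {I J : Subinterval n} (f : I ⟶ J) (h : I = J) : IsIso (G.map f) := by
  subst h
  rw [Subsingleton.elim f (𝟙 I)]
  infer_instance

lemma map_comm {C : Type w} [Category.{v} C] {n : ℕ} (G : Subinterval n ⥤ C)
    {I J K L : Subinterval n} (f : I ⟶ J) (g : J ⟶ L) (f' : I ⟶ K) (g' : K ⟶ L) :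
    G.map f ≫ G.map g = G.map f' ≫ G.map g' := by
  rw [← G.map_comp, ← G.map_comp, Subsingleton.elim (f ≫ g) (f' ≫ g')]

lemma isDistDiagram_mult {n p q : ℕ} (c : DistCell.{u} n p q) (G : Subinterval n ⥤ FinSet)
    (hG : HasPullbackProperty G) : IsDistDiagram ((multIndex c).monotone.functor ⋙ G) where
  row _ _ _ _ _ hik hkj hjl := hG _ _ _ _ (c.b.monotone hik) (c.b.monotone hkj)
    (c.b.monotone hjl)
  cromulent _ _ _ _ _ _ :=
    @isCromulent_of_isIso _ _ _ _ _ _ _ _ _ _ _ _ _ _ _ (isIso_map_of_eq G _ rfl)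
      (isIso_map_of_eq G _ rfl) (isIso_map_of_eq G _ rfl) (map_comm G _ _ _ _)
      (map_comm G _ _ _ _)

lemma isDistDiagram_add {n p q : ℕ} (c : DistCell.{u} n p q) (G : Subinterval n ⥤ FinSet)
    (hG : HasPullbackProperty G) : IsDistDiagram ((addIndex c).monotone.functor ⋙ G) where
  row _ _ _ _ _ _ _ _ :=
    @IsPullback.of_vert_isIso _ _ _ _ _ _ _ _ _ _ (isIso_map_of_eq G _ rfl)
      (isIso_map_of_eq G _ rfl) ⟨map_comm G _ _ _ _⟩
  cromulent _ _ hij _ _ hkl :=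
    @isCromulent_of_isPullback _ _ _ _ _ _ _ _ _ _ _ _ _ _ _ (isIso_map_of_eq G _ rfl)
      (isIso_map_of_eq G _ rfl)
      (hG _ _ _ _ (c.a.monotone hkl) (c.le' _ _) (c.b.monotone hij)) (map_comm G _ _ _ _)

/-- The inclusion `I_Π : Span → RSpan` of the multiplicative structure. It is the canonical map
`S → S ∘_D T`, which sends a simplex `G` of `S = D_{*,0}` to the map from the distributahedron
whose value on `a₀ ⋯ a_q | b₀ ⋯ b_p` is the restriction of `G` to `b₀ ⋯ b_p`, constant in the second
simplicial direction. On edges it sends `X ← U → Y` to `X ← U → Y = Y`. -/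
def inclMult : Span ⟶ RSpan where
  app _ := ↾fun G =>
    { app := fun _ => ↾fun c => ⟨(multIndex c).monotone.functor ⋙ G.1, isDistDiagram_mult c G.1 G.2⟩
      naturality := fun _ _ _ => rfl }
  naturality _ _ _ := rfl

/-- The inclusion `I_Σ : Span → RSpan` of the additive structure. A simplex `G` of `Span` is a map
from the distributahedron to the bisimplicial set of grids of pullback squares, whose value on
`a₀ ⋯ a_q | b₀ ⋯ b_p` is the grid `X_{j,k} = G [a_k, b_j]`; such a grid is a simplex of `D^×_+` with
value `X_{j,k}` at `([i, j], k)`. On edges `I_Σ` sends `X ← U → Y` to `X ← U = U → Y`. -/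
def inclAdd : Span ⟶ RSpan where
  app _ := ↾fun G =>
    { app := fun _ => ↾fun c => ⟨(addIndex c).monotone.functor ⋙ G.1, isDistDiagram_add c G.1 G.2⟩
      naturality := fun _ _ _ => rfl }
  naturality _ _ _ := rfl

/-- The category of pointed finite sets. -/
abbrev FinSetPointed : Type 1 := ObjectProperty.FullSubcategory fun P : Pointed.{0} => Finite P

/-- The functor `X ↦ X₊` which adds a disjoint basepoint. -/
def addPoint : FinSet ⥤ FinSetPointed :=
  ObjectProperty.lift _ (FintypeCat.incl ⋙ typeToPointed) fun X =>
    inferInstanceAs (Finite (Option X.obj))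

/-- The pointed map `P_j → P_i` in a chain `P₀ → ⋯ → P_n` in the opposite of the category of
pointed finite sets. -/
def chainMap {n : ℕ} (P : ComposableArrows FinSetPointedᵒᵖ n) {i j : Fin (n + 1)} (h : i ≤ j) :
    (P.obj j).unop.obj.X → (P.obj i).unop.obj.X :=
  (P.map (homOfLE h)).unop.hom.toFun

lemma chainMap_id {n : ℕ} (P : ComposableArrows FinSetPointedᵒᵖ n) (j : Fin (n + 1))
    (x : (P.obj j).unop.obj.X) : chainMap P (le_refl j) x = x := by
  change (P.map (𝟙 j)).unop.hom.toFun x = x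
  rw [P.map_id]
  rfl

lemma chainMap_chainMap {n : ℕ} (P : ComposableArrows FinSetPointedᵒᵖ n) {i j k : Fin (n + 1)}
    (h : i ≤ j) (h' : j ≤ k) (x : (P.obj k).unop.obj.X) :
    chainMap P h (chainMap P h' x) = chainMap P (h.trans h') x := by
  have := P.map_comp (homOfLE h) (homOfLE h')
  exact (congrArg (fun f => f.unop.hom.toFun x) this).symm

lemma chainMap_point {n : ℕ} (P : ComposableArrows FinSetPointedᵒᵖ n) {i j : Fin (n + 1)}
    (h : i ≤ j) : chainMap P h (P.obj j).unop.obj.point = (P.obj i).unop.obj.point :=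
  (P.map (homOfLE h)).unop.hom.map_point

/-- The elements of `P_j` whose image in `P_i` is not the basepoint. -/
def Survivors {n : ℕ} (P : ComposableArrows FinSetPointedᵒᵖ n) (I : Subinterval n) : Type :=
  { x : (P.obj I.hi).unop.obj.X // chainMap P I.le x ≠ (P.obj I.lo).unop.obj.point }

instance {n : ℕ} (P : ComposableArrows FinSetPointedᵒᵖ n) (I : Subinterval n) :
    Finite (Survivors P I) :=
  have : Finite (P.obj I.hi).unop.obj.X := (P.obj I.hi).unop.property
  Subtype.finite

/-- The map from the survivors over `[i, j]` to those over `[i', j'] ⊆ [i, j]`. -/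
def Survivors.map {n : ℕ} (P : ComposableArrows FinSetPointedᵒᵖ n) {I J : Subinterval n}
    (h : I ≤ J) (x : Survivors P I) : Survivors P J :=
  ⟨chainMap P h.2 x.1, fun e => x.2 (by
    rw [chainMap_chainMap] at e
    rw [← chainMap_chainMap P h.1 (J.le.trans h.2), e, chainMap_point])⟩

/-- The diagram of spans attached to a chain `P₀ → ⋯ → P_n` in the opposite of the category of
pointed finite sets, i.e. to a chain of pointed maps `P_n → ⋯ → P₀`. Its value at `[i, j]` is
the set of the elements of `P_j` whose image in `P_i` is not the basepoint. -/
def pointedSpan {n : ℕ} (P : ComposableArrows FinSetPointedᵒᵖ n) : Subinterval n ⥤ FinSet where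
  obj I := FintypeCat.of (Survivors P I)
  map f := FintypeCat.homMk (Survivors.map P (leOfHom f))
  map_id I := by
    ext x
    exact Subtype.ext (chainMap_id P _ _)
  map_comp f g := by
    ext x
    exact Subtype.ext (chainMap_chainMap P _ _ _).symm

lemma isPullback_of_existsUnique {W X Y Z : FinSet} (f : W ⟶ X) (g : W ⟶ Y) (h : X ⟶ Z)
    (k : Y ⟶ Z) (comm : f ≫ h = g ≫ k)
    (ex : ∀ (x : X) (y : Y), h x = k y → ∃! w : W, f w = x ∧ g w = y) :
    IsPullback f g h k := by
  refine ⟨⟨comm⟩, ⟨Limits.PullbackCone.IsLimit.mk comm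
    (fun s => FintypeCat.homMk fun z => (ex (s.fst z) (s.snd z)
      (ConcreteCategory.congr_hom s.condition z)).choose) ?_ ?_ ?_⟩⟩
  · intro s
    ext z
    exact (ex (s.fst z) (s.snd z) (ConcreteCategory.congr_hom s.condition z)).choose_spec.1.1
  · intro s
    ext z
    exact (ex (s.fst z) (s.snd z) (ConcreteCategory.congr_hom s.condition z)).choose_spec.1.2
  · intro s m h₁ h₂
    ext z
    exact (ex (s.fst z) (s.snd z) (ConcreteCategory.congr_hom s.condition z)).choose_spec.2 _
      ⟨ConcreteCategory.congr_hom h₁ z, ConcreteCategory.congr_hom h₂ z⟩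

lemma hasPullbackProperty_pointedSpan {n : ℕ} (P : ComposableArrows FinSetPointedᵒᵖ n) :
    HasPullbackProperty (pointedSpan P) := by
  intro i k j l hik hkj hjl
  refine isPullback_of_existsUnique _ _ _ _ (map_comm _ _ _ _ _) ?_
  intro x y hxy
  have hxy' : x.1 = chainMap P hjl y.1 := by
    rw [← chainMap_id P j x.1]
    exact congrArg Subtype.val hxy
  refine ⟨⟨y.1, fun e => x.2 ?_⟩, ⟨Subtype.ext hxy'.symm, Subtype.ext (chainMap_id P _ _)⟩, ?_⟩
  · change chainMap P (hik.trans hkj) x.1 = _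
    rw [hxy', chainMap_chainMap]
    exact e
  · rintro w ⟨-, hw⟩
    refine Subtype.ext ?_
    change w.1 = y.1
    rw [← hw]
    exact (chainMap_id P _ _).symm

/-- The functor `R` from the opposite of the category of pointed finite sets to `Span`. A
morphism from `P` to `Q` in the opposite category, i.e. a pointed map `f : Q → P`, is sent to the
span `P ∖ {*} ← f⁻¹(P ∖ {*}) → Q ∖ {*}`. -/
def fromPointed : nerve FinSetPointedᵒᵖ ⟶ Span where
  app _ := ↾fun P => ⟨pointedSpan P, hasPullbackProperty_pointedSpan P⟩
  naturality _ _ _ := rfl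

/-- The diagram of spans attached to a chain `X₀ → ⋯ → X_n` in the opposite of the category of
finite sets: its value at `[i, j]` is `X_j`. -/
def finSetSpan {n : ℕ} (X : ComposableArrows FinSetᵒᵖ n) : Subinterval n ⥤ FinSet where
  obj I := (X.obj I.hi).unop
  map f := (X.map (homOfLE (leOfHom f).2)).unop
  map_id I := congrArg Quiver.Hom.unop (X.map_id I.hi)
  map_comp f g := congrArg Quiver.Hom.unop
    (X.map_comp (homOfLE (leOfHom g).2) (homOfLE (leOfHom f).2))

lemma hasPullbackProperty_finSetSpan {n : ℕ} (X : ComposableArrows FinSetᵒᵖ n) :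
    HasPullbackProperty (finSetSpan X) := by
  intro i k j l hik hkj hjl
  have h : ∀ (I J : Subinterval n) (f : I ⟶ J), I.hi = J.hi → IsIso ((finSetSpan X).map f) := by
    rintro ⟨a, b, _⟩ ⟨a', b', _⟩ f rfl
    change IsIso (X.map (𝟙 b)).unop
    infer_instance
  exact @IsPullback.of_vert_isIso _ _ _ _ _ _ _ _ _ _ (h _ _ _ rfl) (h _ _ _ rfl)
    ⟨map_comm _ _ _ _ _⟩

/-- The functor from the opposite of the category of finite sets to `Span` which is the identity
on objects and sends a map of finite sets `f : Y → X` to the span `X ←f- Y = Y`. -/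
def fromFinSet : nerve FinSetᵒᵖ ⟶ Span where
  app _ := ↾fun X => ⟨finSetSpan X, hasPullbackProperty_finSetSpan X⟩
  naturality _ _ _ := rfl

/-- A finite set, seen as a vertex of `RSpan`. -/
def rspanObj (X : FinSet) : RSpan _⦋0⦌ :=
  (fromFinSet ≫ inclMult).app (op ⦋0⦌) (ComposableArrows.mk₀ (op X))

/-- The edge `X ←f- Y = Y = Y` of `RSpan` given by a map of finite sets `f : Y → X`. -/
def rspanCopy {X Y : FinSet} (f : Y ⟶ X) : RSpan _⦋1⦌ :=
  (fromFinSet ≫ inclMult).app (op ⦋1⦌) (ComposableArrows.mk₁ f.op)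

/-- The cone in `RSpan` over a family of finite sets `X i` with vertex the disjoint union
`⊔ᵢ X i`, whose `i`-th projection is the edge `⊔ᵢ X i ← X i = X i = X i` given by the inclusion
of `X i`. -/
def disjointUnionCone {ι : Type} [Finite ι] (X : ι → FinSet) :
    (overFamily fun i => rspanObj (X i)) _⦋0⦌ where
  base := rspanObj (FintypeCat.of (Σ i, (X i).obj))
  leg i := rspanCopy (X := FintypeCat.of (Σ i, (X i).obj)) (Y := X i)
    (FintypeCat.homMk fun x => ⟨i, x⟩)
  restrict i := by
    refine (NatTrans.naturality_apply (fromFinSet ≫ inclMult) _ _).symm.trans ?_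
    exact congrArg ((fromFinSet ≫ inclMult).app (op ⦋0⦌)) (ComposableArrows.ext₀ rfl)
  last i := by
    refine (NatTrans.naturality_apply (fromFinSet ≫ inclMult) _ _).symm.trans ?_
    exact congrArg ((fromFinSet ≫ inclMult).app (op ⦋0⦌)) (ComposableArrows.ext₀ rfl)

end RingSpans

/-!
Let `B` be the bicategory of finite sets, bispans `X ← U → V → Y` and isomorphisms of bispans. The
idea is that `RSpan` is, up to an acyclic Kan fibration, the Duskin nerve of `B`, for which all
claims can be checked in low dimensions.

*The nerve.* A bispan gives the polynomial functor `y ↦ ∑_{q v = y} ∏_{r u = v} A (f u)` from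
families over `X` to families over `Y` (`Poly`). An identification of a bispan with a composite is
encoded as a natural bijection of polynomial functors (`TwoCell`), which by the Yoneda lemma amounts
to data in terms of elements (`Dist`, `TwoCell.toDist`). With the first encoding, cocycle conditions
are equations between composites of bijections. Hence three faces of a tetrahedron determine an
inner one (`exists_coc_023`, `exists_coc_013`), and the pentagon identities hold, so that
`bispanNerve` is a `(2,1)`-category (`isTwoOneCategory_bispanNerve`).

*The projection.* The cells of the distributahedron glue, so that a simplex of `RSpan` is a diagram
of finite sets indexed by the triples `(a, [b, c])` with `a ≤ b ≤ c` (`RSimplex`, `toRSpan`). Its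
values at `(a, [a, b])` and `(a, [b, b])` are the edges of a simplex of the nerve (`rspanToNerve`).
Conversely, this simplex determines the whole diagram up to a unique isomorphism fixing the edges,
since the value at `(a, [b, c])` is a pullback of components of the edges `a → c` and `b → c`
(`NSimplex.canonical`). So every simplex of the nerve can be lifted to `RSpan`, with arbitrary
compatible lifts of its faces prescribed (`RSimplex.exists_lift`, `HasMatchingLift`). Thus the
projection is an acyclic Kan fibration, `RSpan` is a quasicategory, and product cones can be
detected in the nerve (`HasMatchingLift.isProductCone`).

*Products.* Let `P ← U i → V i → A i` be bispans for which the maps `U i → V i → A i` are bijective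
and the `U i` present `P` as a disjoint union. Their polynomial functors are jointly fully faithful
(`IsProj.existsUnique_map`), so that the lifting property of a terminal cone holds in dimensions
`1`, `2` and `3`, where it concerns bispans, two-cells and cocycle conditions; in higher dimensions
there is nothing to check (`isProductCone_of_isProjEdges`). This applies to the images under both
inclusions `Span → RSpan` of the spans `P ← U i → A i` (`isProductCone_of_isSpanProj`), and thus to
disjoint unions. A product cone in the opposite of the category of pointed finite sets is a wedge
sum (`isWedge_of_exists_of_eq`), which also gives such spans. Finally, every vertex of `RSpan` is a
finite set (`exists_eq_rspanObj`), whence essential surjectivity.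
-/

namespace RingSpans

/-! ### Polynomial functors -/

/-- A diagram `X ←f- U -r→ V -q→ Y` of finite sets. -/
structure Bispan (X Y : FinSet) : Type 1 where
  U : FinSet
  V : FinSet
  f : U → X
  r : U → V
  q : V → Y

/-- The polynomial functor of a bispan, from families over `X` to families over `Y`:
`y ↦ ∑_{q v = y} ∏_{r u = v} A (f u)`. The extra argument `x` of `g`, with `E.f u = x`, makes
it unnecessary to transport elements of the family `A` along equalities. -/
structure Poly {X Y : FinSet} (E : Bispan X Y) (A : X → Type) (y : Y) : Type where
  v : E.V
  hv : E.q v = y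
  g : ∀ u x, E.r u = v → E.f u = x → A x

namespace Poly

variable {X Y : FinSet} {E : Bispan X Y}

lemma ext_elim {A : X → Type} {y : Y} {a b : Poly E A y} (h : a = b) :
    a.v = b.v ∧ ∀ u x h h' hx, a.g u x h hx = b.g u x h' hx := by
  subst h
  exact ⟨rfl, fun _ _ _ _ _ => rfl⟩

lemma ext' {A : X → Type} {y : Y} {a b : Poly E A y} (hv : a.v = b.v)
    (hg : ∀ u x h h' hx, a.g u x h hx = b.g u x h' hx) : a = b := by
  obtain ⟨v, hv1, g⟩ := a
  obtain ⟨v', hv2, g'⟩ := b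
  obtain rfl : v = v' := hv
  have : g = g' := by
    funext u x h hx
    exact hg u x h h hx
  rw [this]

/-- Functoriality of the polynomial functor. -/
def map {A B : X → Type} {y : Y} (t : ∀ x, A x → B x) (a : Poly E A y) : Poly E B y :=
  ⟨a.v, a.hv, fun u x h hx => t x (a.g u x h hx)⟩

lemma map_injective {A B : X → Type} {y : Y} {t : ∀ x, A x → B x}
    (ht : ∀ x, Function.Injective (t x)) :
    Function.Injective (map t : Poly E A y → Poly E B y) := by
  intro a b h
  have := ext_elim h
  exact ext' this.1 fun u x h h' hx => ht x (this.2 u x h h' hx)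

lemma map_surjective {A B : X → Type} {y : Y} {t : ∀ x, A x → B x}
    (ht : ∀ x, Function.Surjective (t x)) :
    Function.Surjective (map t : Poly E A y → Poly E B y) := by
  intro b
  exact ⟨⟨b.v, b.hv, fun u x h hx => (ht x (b.g u x h hx)).choose⟩,
    ext' rfl fun u x h h' hx => (ht x (b.g u x h hx)).choose_spec⟩

lemma map_bijective {A B : X → Type} {y : Y} {t : ∀ x, A x → B x}
    (ht : ∀ x, Function.Bijective (t x)) :
    Function.Bijective (map t : Poly E A y → Poly E B y) :=
  ⟨map_injective fun x => (ht x).1, map_surjective fun x => (ht x).2⟩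

end Poly

/-- An identification of the polynomial functor of `E02` with the composite of those of `E01`
and `E12`, i.e. a natural bijection. In this form the associativity of the composition of bispans
is that of the composition of functions; `TwoCell.toDist` recovers the underlying map of bispans. -/
structure TwoCell {X0 X1 X2 : FinSet} (E01 : Bispan X0 X1) (E12 : Bispan X1 X2)
    (E02 : Bispan X0 X2) : Type 1 where
  app : ∀ (A : X0 → Type) (y : X2), Poly E02 A y → Poly E12 (Poly E01 A) y
  nat : ∀ (A B : X0 → Type) (t : ∀ x, A x → B x) (y : X2) (a : Poly E02 A y),
    app B y (a.map t) = (app A y a).map fun _ b => b.map t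
  bij : ∀ A y, Function.Bijective (app A y)

lemma TwoCell.ext' {X0 X1 X2 : FinSet} {E01 : Bispan X0 X1} {E12 : Bispan X1 X2}
    {E02 : Bispan X0 X2} {φ ψ : TwoCell E01 E12 E02}
    (h : ∀ A y a, φ.app A y a = ψ.app A y a) : φ = ψ := by
  obtain ⟨φ, _, _⟩ := φ
  obtain ⟨ψ, _, _⟩ := ψ
  have : φ = ψ := by
    funext A y a
    exact h A y a
  subst this
  rfl

/-- An identification of the bispan `E02` with the composite of `E01` and `E12`, in terms of
elements. An element `w` of the composite is an element `z w` of `E12` together with an element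
`s w u` of `E01` for each `u` over `z w`, and the elements over `w` are the
`j w u x`, with `u` over `z w` and `x` over `s w u`. -/
structure Dist {X0 X1 X2 : FinSet} (E01 : Bispan X0 X1) (E12 : Bispan X1 X2)
    (E02 : Bispan X0 X2) : Type where
  z : E02.V → E12.V
  s : ∀ w u, E12.r u = z w → E01.V
  j : ∀ w u h x, E01.r x = s w u h → E02.U
  q_z : ∀ w, E12.q (z w) = E02.q w
  q_s : ∀ w u h, E01.q (s w u h) = E12.f u
  r_j : ∀ w u h x hx, E02.r (j w u h x hx) = w
  f_j : ∀ w u h x hx, E02.f (j w u h x hx) = E01.f x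
  zs_inj : ∀ w w', z w = z w' → (∀ u h h', s w u h = s w' u h') → w = w'
  zs_surj : ∀ v (k : ∀ u, E12.r u = v → E01.V), (∀ u h, E01.q (k u h) = E12.f u) →
    ∃ w, ∃ hz : z w = v, ∀ u h, s w u h = k u (h.trans hz)
  j_inj : ∀ w u h x hx u' h' x' hx', j w u h x hx = j w u' h' x' hx' → u = u' ∧ x = x'
  j_surj : ∀ w y, E02.r y = w → ∃ u h x hx, j w u h x hx = y

section

variable {X0 X1 X2 : FinSet} {E01 : Bispan X0 X1} {E12 : Bispan X1 X2} {E02 : Bispan X0 X2}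

/-- The natural bijection given by an identification of bispans. -/
def Dist.toTwoCell (D : Dist E01 E12 E02) : TwoCell E01 E12 E02 where
  app A y a := ⟨D.z a.v, (D.q_z _).trans a.hv, fun u x1 h h1 =>
    ⟨D.s a.v u h, (D.q_s _ _ _).trans h1, fun x x0 hx h0 =>
      a.g (D.j a.v u h x hx) x0 (D.r_j _ _ _ _ _) ((D.f_j _ _ _ _ _).trans h0)⟩⟩
  nat _ _ _ _ _ := rfl
  bij A y := by
    constructor
    · intro a b hab
      obtain ⟨h1, h2⟩ := Poly.ext_elim hab
      have hv : a.v = b.v := D.zs_inj _ _ h1 fun u h h' =>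
        (Poly.ext_elim (h2 u _ h h' rfl)).1
      obtain ⟨v, hv1, g⟩ := a
      obtain ⟨v', hv2, g'⟩ := b
      obtain rfl : v = v' := hv
      refine Poly.ext' rfl fun u x h h' hx => ?_
      obtain ⟨u1, h1, x1, hx1, rfl⟩ := D.j_surj _ u h
      exact (Poly.ext_elim (h2 u1 _ h1 h1 rfl)).2 x1 x hx1 hx1 ((D.f_j _ _ _ _ _).symm.trans hx)
    · intro b
      obtain ⟨w, hz, hs⟩ := D.zs_surj b.v (fun u h => (b.g u _ h rfl).v)
        fun u h => (b.g u _ h rfl).hv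
      -- `D.j` is bijective onto the elements over `w`, so the values of `b` determine those of `a`.
      have key : ∀ u x, E02.r u = w → E02.f u = x → ∃ a : A x, ∀ u1 h1 x1 hx1 (h2 : E01.f x1 = x),
          D.j w u1 h1 x1 hx1 = u →
            a = (b.g u1 _ (h1.trans hz) rfl).g x1 x (hx1.trans (hs _ _)) h2 := by
        intro u x h hx
        obtain ⟨u1, h1, x1, hx1, rfl⟩ := D.j_surj _ u h
        refine ⟨(b.g u1 _ (h1.trans hz) rfl).g x1 x (hx1.trans (hs _ _))
          ((D.f_j _ _ _ _ _).symm.trans hx), fun u2 h2 x2 hx2 h3 e => ?_⟩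
        obtain ⟨rfl, rfl⟩ := D.j_inj _ _ _ _ _ _ _ _ _ e
        rfl
      choose g hg using key
      refine ⟨⟨w, (D.q_z w).symm.trans ((congrArg E12.q hz).trans b.hv), g⟩, ?_⟩
      refine Poly.ext' hz fun u x1 h h' hx => ?_
      subst hx
      refine Poly.ext' (hs u h) fun x x0 hx hx' h0 => ?_
      exact hg _ _ _ _ _ h _ hx _ rfl

/-- The universal family with an element of the polynomial functor of `E` at `w`. -/
def generic {X Y : FinSet} {E : Bispan X Y} (w : E.V) :
    Poly E (fun x => { u : E.U // E.r u = w ∧ E.f u = x }) (E.q w) :=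
  ⟨w, rfl, fun u _ h hx => ⟨u, h, hx⟩⟩

namespace TwoCell

variable (φ : TwoCell E01 E12 E02)

/-- By naturality, a two-cell is determined by its values on the generic elements. -/
lemma app_mk_generic {A : X0 → Type} (w : E02.V) (g) :
    φ.app A (E02.q w) ⟨w, rfl, g⟩ =
      (φ.app _ _ (generic w)).map fun _ b => b.map fun x t => g t.1 x t.2.1 t.2.2 :=
  φ.nat _ _ (fun x (t : { u : E02.U // E02.r u = w ∧ E02.f u = x }) => g t.1 x t.2.1 t.2.2) _
    (generic w)

lemma app_v {A : X0 → Type} {y : X2} (w : E02.V) (hw : E02.q w = y) (g) :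
    (φ.app A y ⟨w, hw, g⟩).v = (φ.app _ _ (generic w)).v := by
  subst hw
  rw [app_mk_generic]
  rfl

lemma app_g_v {A : X0 → Type} {y : X2} (w : E02.V) (hw : E02.q w = y) (g) (u x1 h h' h1) :
    ((φ.app A y ⟨w, hw, g⟩).g u x1 h h1).v = ((φ.app _ _ (generic w)).g u x1 h' h1).v := by
  subst hw
  have := app_mk_generic φ w g
  generalize φ.app A (E02.q w) ⟨w, rfl, g⟩ = b at *
  subst this
  rfl

lemma app_g_g {A : X0 → Type} {y : X2} (w : E02.V) (hw : E02.q w = y) (g)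
    (u x1 h h' h1 x x0 hx hx' h0) :
    ((φ.app A y ⟨w, hw, g⟩).g u x1 h h1).g x x0 hx h0 =
      g (((φ.app _ _ (generic w)).g u x1 h' h1).g x x0 hx' h0).1 x0
        (((φ.app _ _ (generic w)).g u x1 h' h1).g x x0 hx' h0).2.1
        (((φ.app _ _ (generic w)).g u x1 h' h1).g x x0 hx' h0).2.2 := by
  subst hw
  have := app_mk_generic φ w g
  generalize φ.app A (E02.q w) ⟨w, rfl, g⟩ = b at *
  subst this
  rfl

/-- The identification of bispans underlying a two-cell, by the Yoneda lemma. -/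
def toDist : Dist E01 E12 E02 :=
  have key1 : ∀ w w' : E02.V,
      (φ.app _ _ (generic w)).v = (φ.app _ _ (generic w')).v →
      (∀ u h h', ((φ.app _ _ (generic w)).g u (E12.f u) h rfl).v =
        ((φ.app _ _ (generic w')).g u (E12.f u) h' rfl).v) → w = w' := by
    intro w w' hz hs
    have hq : E02.q w' = E02.q w := by
      rw [← (φ.app _ _ (generic w)).hv, ← (φ.app _ _ (generic w')).hv, hz]
    -- For the constant family `Unit`, an element of the polynomial functor is just its `v`.
    have := (φ.bij (fun _ => Unit) (E02.q w)).1
      (a₁ := ⟨w, rfl, fun _ _ _ _ => ()⟩) (a₂ := ⟨w', hq, fun _ _ _ _ => ()⟩) (by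
        refine Poly.ext' ?_ fun u x1 h h' h1 => ?_
        · exact (app_v φ _ _ _).trans (hz.trans (app_v φ _ _ _).symm)
        · subst h1
          refine Poly.ext' ?_ fun _ _ _ _ _ => rfl
          have e1 := h
          rw [app_v] at e1
          have e2 := h'
          rw [app_v] at e2
          rw [app_g_v φ _ _ _ _ _ _ e1, app_g_v φ _ _ _ _ _ _ e2]
          exact hs _ _ _)
    exact (Poly.ext_elim this).1
  { z w := (φ.app _ _ (generic w)).v
    s w u h := ((φ.app _ _ (generic w)).g u (E12.f u) h rfl).v
    j w u h x hx := (((φ.app _ _ (generic w)).g u (E12.f u) h rfl).g x (E01.f x) hx rfl).1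
    q_z w := (φ.app _ _ (generic w)).hv
    q_s w u h := ((φ.app _ _ (generic w)).g u (E12.f u) h rfl).hv
    r_j w u h x hx := (((φ.app _ _ (generic w)).g u (E12.f u) h rfl).g x (E01.f x) hx rfl).2.1
    f_j w u h x hx := (((φ.app _ _ (generic w)).g u (E12.f u) h rfl).g x (E01.f x) hx rfl).2.2
    zs_inj := key1
    zs_surj v k hk := by
      obtain ⟨⟨w, hw, g⟩, ha⟩ := (φ.bij (fun _ => Unit) (E12.q v)).2
        ⟨v, rfl, fun u x1 h h1 => ⟨k u h, (hk u h).trans h1, fun _ _ _ _ => ()⟩⟩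
      obtain ⟨e1, e2⟩ := Poly.ext_elim ha
      refine ⟨w, (app_v φ _ _ _).symm.trans e1, fun u h => ?_⟩
      have e3 := h
      rw [← app_v φ w hw g] at e3
      have := (Poly.ext_elim (e2 u (E12.f u) e3 (e3.trans e1) rfl)).1
      rw [app_g_v φ _ _ _ _ _ _ h] at this
      exact this
    j_inj w u h x hx u' h' x' hx' e := by
      -- The family `Prop` detects elements: pull back the indicator function of `(u, x)`.
      let G := φ.app _ _ (generic w)
      obtain ⟨a, ha⟩ := (φ.bij (fun _ => Prop) (E02.q w)).2
        ⟨G.v, G.hv, fun u2 x1 h2 h1 => ⟨(G.g u2 x1 h2 h1).v, (G.g u2 x1 h2 h1).hv,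
          fun x2 _ _ _ => u2 = u ∧ x2 = x⟩⟩
      obtain ⟨e1, e2⟩ := Poly.ext_elim ha
      obtain ⟨w', hw', g⟩ := a
      obtain rfl : w' = w := by
        refine key1 _ _ ((app_v φ _ hw' g).symm.trans e1) fun u2 h2 h2' => ?_
        rw [← app_g_v φ w' hw' g _ _ (h2.trans (app_v φ _ _ _).symm)]
        exact (Poly.ext_elim (e2 u2 _ _ h2' rfl)).1
      have e3 : ∀ u2 h2 x2 hx2, g ((G.g u2 (E12.f u2) h2 rfl).g x2 (E01.f x2) hx2 rfl).1 (E01.f x2)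
          ((G.g u2 (E12.f u2) h2 rfl).g x2 (E01.f x2) hx2 rfl).2.1
          ((G.g u2 (E12.f u2) h2 rfl).g x2 (E01.f x2) hx2 rfl).2.2 = (u2 = u ∧ x2 = x) := by
        intro u2 h2 x2 hx2
        have h3 := h2
        rw [← app_v φ w' hw' g] at h3
        have hx3 := hx2
        rw [← app_g_v φ w' hw' g _ _ h3] at hx3
        have := (Poly.ext_elim (e2 u2 (E12.f u2) h3 h2 rfl)).2 x2 (E01.f x2) hx3 hx2 rfl
        rw [app_g_g φ _ _ _ _ _ _ h2 _ _ _ _ hx2] at this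
        exact this
      have e4 := (e3 u h x hx).mpr ⟨rfl, rfl⟩
      have e5 : ∀ (y y' : E02.U) (x0 x0' : X0) (_ : y = y') (h1 h2 h1' h2'),
          g y x0 h1 h2 → g y' x0' h1' h2' := by
        rintro y y' x0 x0' rfl h1 rfl h1' rfl hg
        exact hg
      obtain ⟨h6, h7⟩ := (e3 u' h' x' hx').mp (e5 _ _ _ _ e _ _ _ _ e4)
      exact ⟨h6.symm, h7.symm⟩
    j_surj w y hy := by
      subst hy
      by_contra hc
      -- Otherwise the constant function `True` and the indicator function of the complement of `y`
      -- have the same image.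
      have := (φ.bij (fun _ => Prop) (E02.q (E02.r y))).1
        (a₁ := ⟨E02.r y, rfl, fun _ _ _ _ => True⟩)
        (a₂ := ⟨E02.r y, rfl, fun y' _ _ _ => y' ≠ y⟩) (by
          refine Poly.ext' ?_ fun u x1 h h' h1 => ?_
          · exact (app_v φ _ _ _).trans (app_v φ _ _ _).symm
          · subst h1
            have e1 := h
            rw [app_v] at e1
            refine Poly.ext' ?_ fun x x0 hx hx' h0 => ?_
            · rw [app_g_v φ _ _ _ _ _ _ e1, app_g_v φ _ _ _ _ _ _ e1]
            · subst h0
              have e2 := hx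
              rw [app_g_v φ _ _ _ _ _ _ e1] at e2
              rw [app_g_g φ _ _ _ _ _ _ e1 _ _ _ _ e2, app_g_g φ _ _ _ _ _ _ e1 _ _ _ _ e2]
              refine (eq_true fun e => hc ?_).symm
              exact ⟨u, e1, x, e2, e⟩)
      have h2 := (Poly.ext_elim this).2 y _ rfl rfl rfl
      exact h2.mp trivial rfl }

lemma toTwoCell_toDist : φ.toDist.toTwoCell = φ := by
  refine ext' fun A y a => ?_
  obtain ⟨w, rfl, g⟩ := a
  rw [φ.app_mk_generic]
  refine Poly.ext' rfl fun u x1 h h' h1 => ?_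
  subst h1
  refine Poly.ext' rfl fun x x0 hx hx' h0 => ?_
  subst h0
  rfl

end TwoCell

/-- Two identifications of bispans with the same underlying maps give the same two-cell. -/
lemma Dist.toTwoCell_congr (D D' : Dist E01 E12 E02) (hz : ∀ w, D.z w = D'.z w)
    (hs : ∀ w u h h', D.s w u h = D'.s w u h')
    (hj : ∀ w u h h' x hx hx', D.j w u h x hx = D'.j w u h' x hx') :
    D.toTwoCell = D'.toTwoCell := by
  have h1 : D.z = D'.z := funext hz
  obtain ⟨z, s, j, _, _, _, _, _, _, _, _⟩ := D
  obtain ⟨z', s', j', _, _, _, _, _, _, _, _⟩ := D'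
  obtain rfl : z = z' := h1
  obtain rfl : s = s' := by
    funext w u h
    exact hs w u h h
  obtain rfl : j = j' := by
    funext w u h x hx
    exact hj w u h h x hx hx
  rfl

end

/-! ### The Duskin nerve of the bicategory of bispans -/

/-- The identity bispan. -/
def Bispan.id (X : FinSet) : Bispan X X := ⟨X, X, _root_.id, _root_.id, _root_.id⟩

/-- The left unit law of the composition of bispans. -/
def Dist.unitLeft {X Y : FinSet} (E : Bispan X Y) : Dist (Bispan.id X) E E where
  z w := w
  s _ u _ := E.f u
  j _ u _ _ _ := u
  q_z _ := rfl
  q_s _ _ _ := rfl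
  r_j _ _ h _ _ := h
  f_j _ _ _ _ hx := hx.symm
  zs_inj _ _ h _ := h
  zs_surj v _ h := ⟨v, rfl, fun u hu => (h u hu).symm⟩
  j_inj _ _ _ _ hx _ _ _ hx' e := ⟨e, hx.trans ((congrArg E.f e).trans hx'.symm)⟩
  j_surj _ y h := ⟨y, h, E.f y, rfl, rfl⟩

/-- The right unit law of the composition of bispans. -/
def Dist.unitRight {X Y : FinSet} (E : Bispan X Y) : Dist E (Bispan.id Y) E where
  z w := E.q w
  s w _ _ := w
  j _ _ _ x _ := x
  q_z _ := rfl
  q_s _ _ h := h.symm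
  r_j _ _ _ _ hx := hx
  f_j _ _ _ _ _ := rfl
  zs_inj w _ e h := h (E.q w) rfl e
  zs_surj v k h := ⟨k v rfl, h v rfl, fun u hu => by
    obtain rfl : u = v := hu.trans (h v rfl)
    rfl⟩
  j_inj _ _ h _ _ _ h' _ _ e := ⟨h.trans h'.symm, e⟩
  j_surj w y h := ⟨E.q w, rfl, y, h, rfl⟩

/-- A bispan together with its source and its target. -/
structure Edge : Type 1 where
  X : FinSet
  Y : FinSet
  E : Bispan X Y

/-- A triangle of bispans: three bispans and an identification of the third one with the
composite of the others. -/
structure Tri : Type 1 where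
  X0 : FinSet
  X1 : FinSet
  X2 : FinSet
  E01 : Bispan X0 X1
  E12 : Bispan X1 X2
  E02 : Bispan X0 X2
  φ : TwoCell E01 E12 E02

namespace Tri

/-- The face opposite to the vertex `0`. -/
def d0 (T : Tri) : Edge := ⟨T.X1, T.X2, T.E12⟩

/-- The face opposite to the vertex `1`. -/
def d1 (T : Tri) : Edge := ⟨T.X0, T.X2, T.E02⟩

/-- The face opposite to the vertex `2`. -/
def d2 (T : Tri) : Edge := ⟨T.X0, T.X1, T.E01⟩

end Tri

namespace Edge

/-- The degenerate edge at a finite set. -/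
def id (X : FinSet) : Edge := ⟨X, X, Bispan.id X⟩

/-- The degenerate triangle given by the left unit law. -/
def deg0 (e : Edge) : Tri := ⟨_, _, _, _, _, _, (Dist.unitLeft e.E).toTwoCell⟩

/-- The degenerate triangle given by the right unit law. -/
def deg1 (e : Edge) : Tri := ⟨_, _, _, _, _, _, (Dist.unitRight e.E).toTwoCell⟩

lemma deg0_id (X : FinSet) : deg0 (id X) = deg1 (id X) := by
  have : (Dist.unitLeft (Bispan.id X)).toTwoCell = (Dist.unitRight (Bispan.id X)).toTwoCell :=
    Dist.toTwoCell_congr _ _ (fun _ => rfl) (fun _ _ h _ => h)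
      fun _ _ _ _ _ hx _ => Eq.symm hx
  unfold deg0 deg1 id
  rw [this]

end Edge

/-- The cocycle condition: the two identifications of `E03` with the triple composite of
`E01`, `E12` and `E23` agree. -/
def Coc {X0 X1 X2 X3 : FinSet} {E01 : Bispan X0 X1} {E12 : Bispan X1 X2} {E23 : Bispan X2 X3}
    {E02 : Bispan X0 X2} {E13 : Bispan X1 X3} {E03 : Bispan X0 X3}
    (φ123 : TwoCell E12 E23 E13) (φ023 : TwoCell E02 E23 E03) (φ013 : TwoCell E01 E13 E03)
    (φ012 : TwoCell E01 E12 E02) : Prop :=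
  ∀ A y a, φ123.app (Poly E01 A) y (φ013.app A y a) =
    (φ023.app A y a).map fun y' b => φ012.app A y' b

/-- Four triangles are the faces of a tetrahedron; they are listed in the order of the opposite
vertices `0`, `1`, `2`, `3`. The edges which they share are equal, and the cocycle condition
holds. -/
inductive Tetra : Tri → Tri → Tri → Tri → Prop where
  | mk (X0 X1 X2 X3 : FinSet) (E01 : Bispan X0 X1) (E12 : Bispan X1 X2) (E23 : Bispan X2 X3)
    (E02 : Bispan X0 X2) (E13 : Bispan X1 X3) (E03 : Bispan X0 X3)
    (φ123 : TwoCell E12 E23 E13) (φ023 : TwoCell E02 E23 E03) (φ013 : TwoCell E01 E13 E03)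
    (φ012 : TwoCell E01 E12 E02) (h : Coc φ123 φ023 φ013 φ012) :
    Tetra ⟨_, _, _, _, _, _, φ123⟩ ⟨_, _, _, _, _, _, φ023⟩ ⟨_, _, _, _, _, _, φ013⟩
      ⟨_, _, _, _, _, _, φ012⟩

namespace Tetra

lemma coc {X0 X1 X2 X3 : FinSet} {E01 : Bispan X0 X1} {E12 : Bispan X1 X2} {E23 : Bispan X2 X3}
    {E02 : Bispan X0 X2} {E13 : Bispan X1 X3} {E03 : Bispan X0 X3}
    {φ123 : TwoCell E12 E23 E13} {φ023 : TwoCell E02 E23 E03} {φ013 : TwoCell E01 E13 E03}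
    {φ012 : TwoCell E01 E12 E02}
    (h : Tetra ⟨_, _, _, _, _, _, φ123⟩ ⟨_, _, _, _, _, _, φ023⟩ ⟨_, _, _, _, _, _, φ013⟩
      ⟨_, _, _, _, _, _, φ012⟩) : Coc φ123 φ023 φ013 φ012 := by
  cases h with
  | mk _ _ _ _ _ _ _ _ _ _ _ _ _ _ h => exact h

/-- The degenerate tetrahedron at a triangle with the vertex `0` repeated: the left unit law is
natural, and compatible with composition. -/
lemma degen0 (T : Tri) : Tetra T T T.d1.deg0 T.d2.deg0 := by
  refine mk _ _ _ _ _ _ _ _ _ _ (φ012 := (Dist.unitLeft T.E01).toTwoCell)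
    (φ013 := (Dist.unitLeft T.E02).toTwoCell) (φ023 := T.φ) (φ123 := T.φ) fun A y a => ?_
  have := T.φ.nat _ (Poly (Bispan.id T.X0) A)
    (fun x b => (⟨x, rfl, fun u x0 hx h0 => (hx.symm.trans h0 : x = x0) ▸ b⟩ :
      Poly (Bispan.id T.X0) A x)) y a
  refine Eq.trans (congrArg _ ?_) (this.trans ?_)
  · refine Poly.ext' rfl fun u x1 h h' h1 => ?_
    refine Poly.ext' h1 fun x x0 hx hx' h0 => ?_
    cases h0
    cases hx
    cases h1
    rfl
  · refine Poly.ext' rfl fun u x1 h h' h1 => ?_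
    refine Poly.ext' rfl fun x x0 hx hx' h0 => ?_
    refine Poly.ext' h0.symm fun x2 x3 hx2 hx2' h3 => ?_
    cases h3
    cases hx2
    cases h0
    rfl

/-- The degenerate tetrahedron at a triangle with the vertex `1` repeated: the triangle identity for
the unit laws. -/
lemma degen1 (T : Tri) : Tetra T.d0.deg0 T T T.d2.deg1 := by
  refine mk _ _ _ _ _ _ _ _ _ _ (φ012 := (Dist.unitRight T.E01).toTwoCell)
    (φ123 := (Dist.unitLeft T.E12).toTwoCell) (φ023 := T.φ) (φ013 := T.φ) fun A y a => ?_
  refine Poly.ext' rfl fun u x1 h h' h1 => ?_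
  refine Poly.ext' ?_ fun x x0 hx hx' h0 => ?_
  · cases h1
    exact ((T.φ.app A y a).g u _ h rfl).hv.symm
  · cases h1
    cases h0
    cases hx
    rfl

/-- The degenerate tetrahedron at a triangle with the vertex `2` repeated: the right unit law is
natural, and compatible with composition. -/
lemma degen2 (T : Tri) : Tetra T.d0.deg1 T.d1.deg1 T T := by
  refine mk _ _ _ _ _ _ _ _ _ _ (φ023 := (Dist.unitRight T.E02).toTwoCell)
    (φ123 := (Dist.unitRight T.E12).toTwoCell) (φ012 := T.φ) (φ013 := T.φ) fun A y a => ?_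
  refine Poly.ext' ?_ fun u x1 h h' h1 => ?_
  · exact ((T.φ.app A y a).hv.trans a.hv.symm)
  · obtain ⟨w, rfl, g⟩ := a
    cases h1
    cases h'
    rfl

end Tetra

/-- An `n`-simplex of the Duskin nerve of the bicategory of finite sets, bispans and
isomorphisms. Edges and triangles are recorded for all `a ≤ b ≤ c`, and not only for `a < b < c`,
so that simplices can be restricted along monotone maps; the fields `deg0` and `deg1` prescribe
the degenerate ones. -/
structure NSimplex (n : ℕ) : Type 1 where
  x : Fin (n + 1) → FinSet
  E : ∀ a b, a ≤ b → Bispan (x a) (x b)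
  φ : ∀ a b c (hab : a ≤ b) (hbc : b ≤ c), TwoCell (E a b hab) (E b c hbc) (E a c (hab.trans hbc))
  deg0 : ∀ a b (h : a ≤ b),
    (⟨_, _, _, _, _, _, φ a a b le_rfl h⟩ : Tri) = Edge.deg0 ⟨_, _, E a b h⟩
  deg1 : ∀ a b (h : a ≤ b),
    (⟨_, _, _, _, _, _, φ a b b h le_rfl⟩ : Tri) = Edge.deg1 ⟨_, _, E a b h⟩
  coc : ∀ a b c d (hab : a ≤ b) (hbc : b ≤ c) (hcd : c ≤ d),
    Coc (φ b c d hbc hcd) (φ a c d (hab.trans hbc) hcd) (φ a b d hab (hbc.trans hcd))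
      (φ a b c hab hbc)

namespace NSimplex

variable {n m : ℕ}

/-- The edge from `a` to `b`, bundled with its end points, so that edges of different simplices can
be compared without transport. -/
def edge (ν : NSimplex n) (a b : Fin (n + 1)) (h : a ≤ b) : Edge := ⟨_, _, ν.E a b h⟩

/-- The triangle with vertices `a`, `b`, `c`, bundled with its edges and its vertices. -/
def tri (ν : NSimplex n) (a b c : Fin (n + 1)) (hab : a ≤ b) (hbc : b ≤ c) : Tri :=
  ⟨_, _, _, _, _, _, ν.φ a b c hab hbc⟩

lemma tetra (ν : NSimplex n) (a b c d : Fin (n + 1)) (hab : a ≤ b) (hbc : b ≤ c) (hcd : c ≤ d) :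
    Tetra (ν.tri b c d hbc hcd) (ν.tri a c d (hab.trans hbc) hcd)
      (ν.tri a b d hab (hbc.trans hcd)) (ν.tri a b c hab hbc) :=
  Tetra.mk _ _ _ _ _ _ _ _ _ _ _ _ _ _ (ν.coc a b c d hab hbc hcd)

lemma edge_self (ν : NSimplex n) (a : Fin (n + 1)) : ν.edge a a le_rfl = Edge.id (ν.x a) :=
  congrArg Tri.d2 (ν.deg0 a a le_rfl)

/-- The restriction of a simplex along a monotone map. -/
def map (ν : NSimplex n) (f : Fin (m + 1) →o Fin (n + 1)) : NSimplex m where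
  x a := ν.x (f a)
  E a b h := ν.E (f a) (f b) (f.monotone h)
  φ a b c hab hbc := ν.φ (f a) (f b) (f c) (f.monotone hab) (f.monotone hbc)
  deg0 a b h := ν.deg0 (f a) (f b) (f.monotone h)
  deg1 a b h := ν.deg1 (f a) (f b) (f.monotone h)
  coc a b c d hab hbc hcd :=
    ν.coc (f a) (f b) (f c) (f d) (f.monotone hab) (f.monotone hbc) (f.monotone hcd)

/-- A simplex is determined by its edges and its nondegenerate triangles. -/
lemma ext_strict {ν ν' : NSimplex n} (he : ∀ a b h, ν.edge a b h = ν'.edge a b h)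
    (ht : ∀ a b c (hab : a < b) (hbc : b < c),
      ν.tri a b c hab.le hbc.le = ν'.tri a b c hab.le hbc.le) : ν = ν' := by
  have ht' : ∀ a b c hab hbc, ν.tri a b c hab hbc = ν'.tri a b c hab hbc := by
    intro a b c hab hbc
    rcases hab.eq_or_lt with rfl | hab'
    · exact (ν.deg0 a c hbc).trans ((congrArg Edge.deg0 (he a c hbc)).trans (ν'.deg0 a c hbc).symm)
    rcases hbc.eq_or_lt with rfl | hbc'
    · exact (ν.deg1 a b hab).trans ((congrArg Edge.deg1 (he a b hab)).trans (ν'.deg1 a b hab).symm)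
    exact ht a b c hab' hbc'
  obtain ⟨x, E, φ, _, _, _⟩ := ν
  obtain ⟨x', E', φ', _, _, _⟩ := ν'
  obtain rfl : x = x' := funext fun a => congrArg Edge.X (he a a le_rfl)
  obtain rfl : E = E' := by
    funext a b h
    exact eq_of_heq (Edge.mk.inj (he a b h)).2.2
  obtain rfl : φ = φ' := by
    funext a b c hab hbc
    exact eq_of_heq (Tri.mk.inj (ht' a b c hab hbc)).2.2.2.2.2.2
  rfl

/-- A simplex can be constructed from its edges and its nondegenerate triangles, provided that
the nondegenerate triangles satisfy the cocycle condition. For degenerate tetrahedra, this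
condition follows from the coherence of the unit laws. -/
lemma exists_of_strict (x : Fin (n + 1) → FinSet) (e : ∀ a b : Fin (n + 1), a ≤ b → Edge)
    (t : ∀ a b c : Fin (n + 1), a < b → b < c → Tri)
    (he : ∀ a, e a a le_rfl = Edge.id (x a))
    (hX : ∀ a b h, (e a b h).X = x a) (hY : ∀ a b h, (e a b h).Y = x b)
    (h2 : ∀ a b c hab hbc, (t a b c hab hbc).d2 = e a b hab.le)
    (h0 : ∀ a b c hab hbc, (t a b c hab hbc).d0 = e b c hbc.le)
    (h1 : ∀ a b c hab hbc, (t a b c hab hbc).d1 = e a c (hab.trans hbc).le)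
    (h3 : ∀ a b c d (hab : a < b) (hbc : b < c) (hcd : c < d),
      Tetra (t b c d hbc hcd) (t a c d (hab.trans hbc) hcd) (t a b d hab (hbc.trans hcd))
        (t a b c hab hbc)) :
    ∃ ν : NSimplex n, (∀ a b h, ν.edge a b h = e a b h) ∧
      ∀ a b c (hab : a < b) (hbc : b < c), ν.tri a b c hab.le hbc.le = t a b c hab hbc := by
  have hE : ∀ a b h, ∃ E : Bispan (x a) (x b), e a b h = ⟨_, _, E⟩ := by
    intro a b h
    have e1 := hX a b h
    have e2 := hY a b h
    generalize e a b h = ε at *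
    obtain ⟨X, Y, E⟩ := ε
    cases e1
    cases e2
    exact ⟨E, rfl⟩
  choose E hE using hE
  have hid : ∀ a, E a a le_rfl = Bispan.id (x a) := fun a =>
    eq_of_heq (Edge.mk.inj ((hE a a le_rfl).symm.trans (he a))).2.2
  have hφ : ∀ a b c (hab : a ≤ b) (hbc : b ≤ c),
      ∃ φ : TwoCell (E a b hab) (E b c hbc) (E a c (hab.trans hbc)),
        (a = b → (⟨_, _, _, _, _, _, φ⟩ : Tri) = (e b c hbc).deg0) ∧
        (b = c → (⟨_, _, _, _, _, _, φ⟩ : Tri) = (e a b hab).deg1) ∧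
        ∀ (hab' : a < b) (hbc' : b < c), (⟨_, _, _, _, _, _, φ⟩ : Tri) = t a b c hab' hbc' := by
    intro a b c hab hbc
    rcases hab.eq_or_lt with rfl | hab'
    · have : ∃ φ : TwoCell (E a a hab) (E a c hbc) (E a c (hab.trans hbc)),
          (⟨_, _, _, _, _, _, φ⟩ : Tri) = (e a c hbc).deg0 := by
        rw [hid, hE a c hbc]
        exact ⟨_, rfl⟩
      obtain ⟨φ, hφ⟩ := this
      refine ⟨φ, fun _ => hφ, ?_, fun h => absurd h (lt_irrefl _)⟩
      rintro rfl
      rw [hφ, he, Edge.deg0_id]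
    rcases hbc.eq_or_lt with rfl | hbc'
    · have : ∃ φ : TwoCell (E a b hab) (E b b hbc) (E a b (hab.trans hbc)),
          (⟨_, _, _, _, _, _, φ⟩ : Tri) = (e a b hab).deg1 := by
        rw [hid, hE a b hab]
        exact ⟨_, rfl⟩
      obtain ⟨φ, hφ⟩ := this
      exact ⟨φ, fun h => absurd h hab'.ne, fun _ => hφ, fun _ h => absurd h (lt_irrefl _)⟩
    have e0 := (h0 a b c hab' hbc').trans (hE b c hbc)
    have e1 := (h1 a b c hab' hbc').trans (hE a c _)
    have e2 := (h2 a b c hab' hbc').trans (hE a b hab)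
    have : ∀ T : Tri, T.d0 = ⟨_, _, E b c hbc⟩ → T.d1 = ⟨_, _, E a c (hab.trans hbc)⟩ →
        T.d2 = ⟨_, _, E a b hab⟩ →
        ∃ φ : TwoCell (E a b hab) (E b c hbc) (E a c (hab.trans hbc)),
          ⟨_, _, _, _, _, _, φ⟩ = T := by
      rintro ⟨X0, X1, X2, E01, E12, E02, φ⟩ e0 e1 e2
      cases e0
      cases e1
      cases e2
      exact ⟨φ, rfl⟩
    obtain ⟨φ, hφ⟩ := this _ e0 e1 e2
    exact ⟨φ, fun h => absurd h hab'.ne, fun h => absurd h hbc'.ne, fun _ _ => hφ⟩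
  choose φ hφ0 hφ1 hφt using hφ
  refine ⟨⟨x, E, φ, ?_, ?_, ?_⟩, fun a b h => (hE a b h).symm, fun a b c hab hbc =>
    hφt a b c _ _ hab hbc⟩
  · intro a b h
    rw [hφ0 a a b le_rfl h rfl, hE a b h]
  · intro a b h
    rw [hφ1 a b b h le_rfl rfl, hE a b h]
  · intro a b c d hab hbc hcd
    apply Tetra.coc
    rcases hab.eq_or_lt with rfl | hab'
    · rw [hφ0 a a c le_rfl hbc rfl, hφ0 a a d le_rfl _ rfl, hE, hE]
      exact Tetra.degen0 (⟨_, _, _, _, _, _, φ a c d hbc hcd⟩ : Tri)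
    rcases hbc.eq_or_lt with rfl | hbc'
    · rw [hφ0 b b d le_rfl hcd rfl, hφ1 a b b hab le_rfl rfl, hE, hE]
      exact Tetra.degen1 (⟨_, _, _, _, _, _, φ a b d hab hcd⟩ : Tri)
    rcases hcd.eq_or_lt with rfl | hcd'
    · rw [hφ1 b c c hbc le_rfl rfl, hφ1 a c c _ le_rfl rfl, hE, hE]
      exact Tetra.degen2 (⟨_, _, _, _, _, _, φ a b c hab hbc⟩ : Tri)
    rw [hφt a b c _ _ hab' hbc', hφt a b d _ _ hab' (hbc'.trans hcd'),
      hφt a c d _ _ (hab'.trans hbc') hcd', hφt b c d _ _ hbc' hcd']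
    exact h3 a b c d hab' hbc' hcd'

end NSimplex

/-- The Duskin nerve of the bicategory of finite sets, bispans and isomorphisms. -/
def bispanNerve : SSet.{1} where
  obj n := NSimplex n.unop.len
  map f := ↾fun ν => ν.map f.unop.toOrderHom
  map_id _ := rfl
  map_comp _ _ := rfl

/-! ### Composition of bispans -/

/-- Bispans can be composed. -/
lemma exists_dist {X0 X1 X2 : FinSet} (E01 : Bispan X0 X1) (E12 : Bispan X1 X2) :
    ∃ E02 : Bispan X0 X2, Nonempty (Dist E01 E12 E02) := by
  classical
  -- An element of the composite is an element `v` of `E12` together with elements of `E01` over the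
  -- images of the elements of `E12` over `v`.
  let V := Σ v : E12.V, { k : { u : E12.U // E12.r u = v } → E01.V //
    ∀ u, E01.q (k u) = E12.f u.1 }
  let U := Σ w : V, Σ u : { u : E12.U // E12.r u = w.1 }, { x : E01.U // E01.r x = w.2.1 u }
  refine ⟨⟨FintypeCat.of U, FintypeCat.of V, fun y => E01.f y.2.2.1, fun y => y.1,
    fun w => E12.q w.1⟩, ⟨?_⟩⟩
  exact
    { z := fun w => w.1
      s := fun w u h => w.2.1 ⟨u, h⟩
      j := fun w u h x hx => ⟨w, ⟨u, h⟩, ⟨x, hx⟩⟩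
      q_z := fun _ => rfl
      q_s := fun w u h => w.2.2 ⟨u, h⟩
      r_j := fun _ _ _ _ _ => rfl
      f_j := fun _ _ _ _ _ => rfl
      zs_inj := by
        rintro ⟨v, k, hk⟩ ⟨v', k', hk'⟩ h1 h2
        obtain rfl : v = v' := h1
        obtain rfl : k = k' := funext fun u => h2 u.1 u.2 u.2
        rfl
      zs_surj := fun v k hk => ⟨⟨v, fun u => k u.1 u.2, fun u => hk u.1 u.2⟩, rfl, fun _ _ => rfl⟩
      j_inj := by
        intro w u h x hx u' h' x' hx' e
        have e1 := eq_of_heq (Sigma.mk.inj e).2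
        have e2 : u = u' := congrArg Subtype.val (Sigma.mk.inj e1).1
        subst e2
        exact ⟨rfl, congrArg Subtype.val (eq_of_heq (Sigma.mk.inj e1).2)⟩
      j_surj := by
        rintro w ⟨w', u, x⟩ h
        obtain rfl : w' = w := h
        exact ⟨u.1, u.2, x.1, x.2, rfl⟩ }

/-- Every composable pair of bispans belongs to a triangle. -/
lemma exists_tri (e e' : Edge) (h : e.Y = e'.X) : ∃ T : Tri, T.d2 = e ∧ T.d0 = e' := by
  obtain ⟨X, Y, E⟩ := e
  obtain ⟨Y', Z, E'⟩ := e'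
  obtain rfl : Y = Y' := h
  obtain ⟨E02, ⟨D⟩⟩ := exists_dist E E'
  exact ⟨⟨_, _, _, _, _, _, D.toTwoCell⟩, rfl, rfl⟩

/-! ### Filling tetrahedra -/

section

variable {X0 X1 X2 X3 : FinSet} {E01 : Bispan X0 X1} {E12 : Bispan X1 X2} {E23 : Bispan X2 X3}
  {E02 : Bispan X0 X2} {E13 : Bispan X1 X3} {E03 : Bispan X0 X3}

/-- A natural bijection `β` factors through a natural bijection `α` with the same target. -/
lemma TwoCell.exists_eq {F F' : (X0 → Type) → X3 → Type}
    (mF : ∀ {A B : X0 → Type}, (∀ x, A x → B x) → ∀ y, F A y → F B y)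
    (mF' : ∀ {A B : X0 → Type}, (∀ x, A x → B x) → ∀ y, F' A y → F' B y)
    (α : ∀ A y, F A y → F' A y) (hα : ∀ A y, Function.Bijective (α A y))
    (nα : ∀ (A B : X0 → Type) (t : ∀ x, A x → B x) y a, α B y (mF t y a) = mF' t y (α A y a))
    (β : ∀ A y, Poly E03 A y → F' A y) (hβ : ∀ A y, Function.Bijective (β A y))
    (nβ : ∀ (A B : X0 → Type) (t : ∀ x, A x → B x) y a, β B y (a.map t) = mF' t y (β A y a)) :
    ∃ γ : ∀ A y, Poly E03 A y → F A y, (∀ A y, Function.Bijective (γ A y)) ∧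
      (∀ (A B : X0 → Type) (t : ∀ x, A x → B x) y a, γ B y (a.map t) = mF t y (γ A y a)) ∧
      ∀ A y a, α A y (γ A y a) = β A y a := by
  refine ⟨fun A y a => (Equiv.ofBijective _ (hα A y)).symm (β A y a), fun A y =>
    (Equiv.bijective _).comp (hβ A y), fun A B t y a => ?_, fun A y a =>
    (Equiv.ofBijective _ (hα A y)).apply_symm_apply _⟩
  apply (hα B y).1
  rw [nα]
  refine ((Equiv.ofBijective _ (hα B y)).apply_symm_apply _).trans ?_
  rw [nβ]
  exact congrArg _ ((Equiv.ofBijective _ (hα A y)).apply_symm_apply _).symm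

/-- Two-cells are invertible, so that in a tetrahedron the face opposite to the vertex `1` is
determined by the other faces, which can be chosen freely. -/
lemma exists_coc_023 (φ123 : TwoCell E12 E23 E13) (φ013 : TwoCell E01 E13 E03)
    (φ012 : TwoCell E01 E12 E02) : ∃! φ023 : TwoCell E02 E23 E03, Coc φ123 φ023 φ013 φ012 := by
  obtain ⟨γ, h1, h2, h3⟩ := TwoCell.exists_eq (X0 := X0) (E03 := E03)
    (F := fun A => Poly E23 (Poly E02 A)) (F' := fun A => Poly E23 (Poly E12 (Poly E01 A)))
    (fun t _ => Poly.map fun _ => Poly.map t)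
    (fun t _ => Poly.map fun _ => Poly.map fun _ => Poly.map t)
    (fun A _ a => a.map fun y' b => φ012.app A y' b)
    (fun A y => Poly.map_bijective fun y' => φ012.bij A y')
    (fun A B t y a => Poly.ext' rfl fun u x h h' hx => φ012.nat _ _ _ _ _)
    (fun A y a => φ123.app (Poly E01 A) y (φ013.app A y a))
    (fun A y => (φ123.bij _ _).comp (φ013.bij _ _))
    (fun A B t y a => by rw [φ013.nat, φ123.nat])
  refine ⟨⟨γ, h2, h1⟩, fun A y a => (h3 A y a).symm, fun φ hφ => TwoCell.ext' fun A y a => ?_⟩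
  apply Poly.map_injective fun y' => (φ012.bij A y').1
  exact (hφ A y a).symm.trans (h3 A y a).symm

/-- Two-cells are invertible, so that in a tetrahedron the face opposite to the vertex `2` is
determined by the other faces, which can be chosen freely. -/
lemma exists_coc_013 (φ123 : TwoCell E12 E23 E13) (φ023 : TwoCell E02 E23 E03)
    (φ012 : TwoCell E01 E12 E02) : ∃! φ013 : TwoCell E01 E13 E03, Coc φ123 φ023 φ013 φ012 := by
  obtain ⟨γ, h1, h2, h3⟩ := TwoCell.exists_eq (X0 := X0) (E03 := E03)
    (F := fun A => Poly E13 (Poly E01 A)) (F' := fun A => Poly E23 (Poly E12 (Poly E01 A)))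
    (fun t _ => Poly.map fun _ => Poly.map t)
    (fun t _ => Poly.map fun _ => Poly.map fun _ => Poly.map t)
    (fun A y a => φ123.app (Poly E01 A) y a)
    (fun A y => φ123.bij _ _)
    (fun A B t y a => φ123.nat _ _ _ _ _)
    (fun A y a => (φ023.app A y a).map fun y' b => φ012.app A y' b)
    (fun A y => (Poly.map_bijective fun y' => φ012.bij A y').comp (φ023.bij _ _))
    (fun A B t y a => by
      rw [φ023.nat]
      exact Poly.ext' rfl fun u x h h' hx => φ012.nat _ _ _ _ _)
  refine ⟨⟨γ, h2, h1⟩, fun A y a => h3 A y a, fun φ hφ => TwoCell.ext' fun A y a => ?_⟩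
  exact (φ123.bij _ _).1 ((hφ A y a).trans (h3 A y a).symm)

end

namespace Tri

/-- The inner horn `Λ[3, 1]` can be filled. -/
lemma exists_tetra_023 {T123 T013 T012 : Tri} (h1 : T012.d0 = T123.d2) (h2 : T012.d2 = T013.d2)
    (h3 : T123.d1 = T013.d0) : ∃ T023, Tetra T123 T023 T013 T012 := by
  obtain ⟨X0, X1, X2, E01, E12, E02, φ012⟩ := T012
  obtain ⟨_, _, X3, _, E23, E13, φ123⟩ := T123
  cases h1
  obtain ⟨_, _, _, _, _, E03, φ013⟩ := T013
  cases h2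
  cases h3
  obtain ⟨φ023, h, -⟩ := exists_coc_023 φ123 φ013 φ012
  exact ⟨_, Tetra.mk _ _ _ _ _ _ _ _ _ _ _ _ _ _ h⟩

/-- The inner horn `Λ[3, 2]` can be filled. -/
lemma exists_tetra_013 {T123 T023 T012 : Tri} (h1 : T012.d0 = T123.d2) (h2 : T012.d1 = T023.d2)
    (h3 : T123.d0 = T023.d0) : ∃ T013, Tetra T123 T023 T013 T012 := by
  obtain ⟨X0, X1, X2, E01, E12, E02, φ012⟩ := T012
  obtain ⟨_, _, X3, _, E23, E13, φ123⟩ := T123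
  cases h1
  obtain ⟨_, _, _, _, _, E03, φ023⟩ := T023
  cases h2
  cases h3
  obtain ⟨φ013, h, -⟩ := exists_coc_013 φ123 φ023 φ012
  exact ⟨_, Tetra.mk _ _ _ _ _ _ _ _ _ _ _ _ _ _ h⟩

end Tri

namespace Tetra

lemma unique_023 {T123 T023 T023' T013 T012 : Tri} (h : Tetra T123 T023 T013 T012)
    (h' : Tetra T123 T023' T013 T012) : T023 = T023' := by
  cases h with
  | mk _ _ _ _ _ _ _ _ _ _ φ123 φ023 φ013 φ012 h =>
  cases h' with
  | mk _ _ _ _ _ _ _ _ _ _ _ φ023' _ _ h' =>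
  rw [(exists_coc_023 φ123 φ013 φ012).unique h h']

lemma unique_013 {T123 T023 T013' T013 T012 : Tri} (h : Tetra T123 T023 T013 T012)
    (h' : Tetra T123 T023 T013' T012) : T013 = T013' := by
  cases h with
  | mk _ _ _ _ _ _ _ _ _ _ φ123 φ023 φ013 φ012 h =>
  cases h' with
  | mk _ _ _ _ _ _ _ _ _ _ _ _ φ013' _ h' =>
  rw [(exists_coc_013 φ123 φ023 φ012).unique h h']

end Tetra

/-! ### The pentagon -/

namespace Tetra

variable {T012 T013 T014 T023 T024 T034 T123 T124 T134 T234 : Tri}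

/-- The pentagon identity: if all the faces of a `4`-simplex except the one opposite to the vertex
`1` are tetrahedra, so is that one. Both sides of its cocycle condition become equal after
composition with the injective map given by `φ012`. -/
lemma pentagon_0234 (h1234 : Tetra T234 T134 T124 T123) (h0134 : Tetra T134 T034 T014 T013)
    (h0124 : Tetra T124 T024 T014 T012) (h0123 : Tetra T123 T023 T013 T012) :
    Tetra T234 T034 T024 T023 := by
  cases h1234 with
  | mk _ _ _ _ _ _ _ _ _ _ φ234 φ134 φ124 φ123 h1234 =>
  cases h0123 with
  | mk _ _ _ _ _ _ _ _ _ _ _ φ023 φ013 φ012 h0123 =>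
  cases h0134 with
  | mk _ _ _ _ _ _ _ _ _ _ _ φ034 φ014 _ h0134 =>
  cases h0124 with
  | mk _ _ _ _ _ _ _ _ _ _ _ φ024 _ _ h0124 =>
  refine Tetra.mk _ _ _ _ _ _ _ _ _ _ _ _ _ _ fun A y a => ?_
  apply Poly.map_injective fun y' => Poly.map_injective fun y'' => (φ012.bij A y'').1
  rw [← φ234.nat, ← h0124, h1234, h0134]
  exact Poly.ext' rfl fun u x h h' hx => h0123 _ _ _

/-- The pentagon identity for the face opposite to the vertex `2`. -/
lemma pentagon_0134 (h1234 : Tetra T234 T134 T124 T123) (h0234 : Tetra T234 T034 T024 T023)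
    (h0124 : Tetra T124 T024 T014 T012) (h0123 : Tetra T123 T023 T013 T012) :
    Tetra T134 T034 T014 T013 := by
  cases h1234 with
  | mk _ _ _ _ _ _ _ _ _ _ φ234 φ134 φ124 φ123 h1234 =>
  cases h0123 with
  | mk _ _ _ _ _ _ _ _ _ _ _ φ023 φ013 φ012 h0123 =>
  cases h0234 with
  | mk _ _ _ _ _ _ _ _ _ _ _ φ034 φ024 _ h0234 =>
  cases h0124 with
  | mk _ _ _ _ _ _ _ _ _ _ _ _ φ014 _ h0124 =>
  refine Tetra.mk _ _ _ _ _ _ _ _ _ _ _ _ _ _ fun A y a => ?_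
  apply Poly.map_injective fun y' => (φ123.bij _ y').1
  rw [← h1234, h0124, φ234.nat, h0234]
  exact Poly.ext' rfl fun u x h h' hx => (h0123 _ _ _).symm

/-- The pentagon identity for the face opposite to the vertex `3`. -/
lemma pentagon_0124 (h1234 : Tetra T234 T134 T124 T123) (h0234 : Tetra T234 T034 T024 T023)
    (h0134 : Tetra T134 T034 T014 T013) (h0123 : Tetra T123 T023 T013 T012) :
    Tetra T124 T024 T014 T012 := by
  cases h1234 with
  | mk _ _ _ _ _ _ _ _ _ _ φ234 φ134 φ124 φ123 h1234 =>
  cases h0123 with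
  | mk _ _ _ _ _ _ _ _ _ _ _ φ023 φ013 φ012 h0123 =>
  cases h0234 with
  | mk _ _ _ _ _ _ _ _ _ _ _ φ034 φ024 _ h0234 =>
  cases h0134 with
  | mk _ _ _ _ _ _ _ _ _ _ _ _ φ014 _ h0134 =>
  refine Tetra.mk _ _ _ _ _ _ _ _ _ _ _ _ _ _ fun A y a => ?_
  apply (φ234.bij _ _).1
  rw [h1234, h0134, φ234.nat, h0234]
  exact Poly.ext' rfl fun u x h h' hx => (h0123 _ _ _)

end Tetra

/-! ### Product projections -/

/-- A family of bispans `P ← U i → V i → A i` in which the maps `U i → V i → A i` are bijective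
and the maps `U i → P` present `P` as a disjoint union. -/
structure IsProj {ι : Type} {P : FinSet} {A : ι → FinSet} (L : ∀ i, Bispan P (A i)) : Prop where
  r : ∀ i, Function.Bijective (L i).r
  q : ∀ i, Function.Bijective (L i).q
  f : Function.Bijective fun x : Σ i, (L i).U => (L x.1).f x.2

namespace IsProj

variable {ι : Type} {P : FinSet} {A : ι → FinSet} {L : ∀ i, Bispan P (A i)}

/-- The polynomial functors of a family of projections are jointly fully faithful. -/
lemma existsUnique_map (hL : IsProj L) {B B' : P → Type}
    (g : ∀ i y, Poly (L i) B y → Poly (L i) B' y) :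
    ∃! t : ∀ p, B p → B' p, ∀ i y a, a.map t = g i y a := by
  -- As `r` is injective, an element of the polynomial functor of `L i` is a single element `b` of
  -- the family, at the image of some `u`.
  let single : ∀ i u p, (L i).f u = p → B p → Poly (L i) B ((L i).q ((L i).r u)) :=
    fun i u p hu b => ⟨(L i).r u, rfl, fun u' x h hx =>
      (hu.symm.trans ((congrArg (L i).f ((hL.r i).1 h)).symm.trans hx)) ▸ b⟩
  have single_eq : ∀ i (a : ∀ y, Poly (L i) B y → Prop) (_ : ∀ u p hu b, a _ (single i u p hu b))
      y b, a y b := by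
    rintro i a ha _ ⟨v, rfl, g⟩
    obtain ⟨u, rfl⟩ := (hL.r i).2 v
    have := ha u _ rfl (g u _ rfl rfl)
    convert this
    rename_i u' x h hx
    obtain rfl := (hL.r i).1 h
    cases hx
    rfl
  have hr : ∀ i u (b : Poly (L i) B' ((L i).q ((L i).r u))), (L i).r u = b.v :=
    fun i u b => (hL.q i).1 b.hv.symm
  have key : ∀ p (b : B p), ∃ b' : B' p, ∀ i u (hu : (L i).f u = p),
      b' = (g i _ (single i u p hu b)).g u p (hr _ _ _) hu := by
    intro p b
    obtain ⟨⟨i, u⟩, hu⟩ := hL.f.2 p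
    refine ⟨(g i _ (single i u p hu b)).g u p (hr _ _ _) hu, fun i' u' hu' => ?_⟩
    cases hL.f.1 (a₁ := ⟨i, u⟩) (a₂ := ⟨i', u'⟩) (hu.trans hu'.symm)
    rfl
  choose t ht using key
  refine ⟨t, fun i y a => ?_, fun t' ht' => ?_⟩
  · refine single_eq i (fun y a => a.map t = g i y a) (fun u p hu b => ?_) y a
    refine Poly.ext' (hr _ _ _) fun u' x h h' hx => ?_
    obtain rfl := (hL.r i).1 h
    cases hu
    cases hx
    exact ht _ _ i u' rfl
  · funext p b
    obtain ⟨⟨i, u⟩, hu⟩ := hL.f.2 p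
    rw [ht p b i u hu]
    refine Eq.trans ?_ ((Poly.ext_elim (ht' i _ (single i u p hu b))).2 u p rfl (hr _ _ _) hu)
    rfl

lemma map_inj (hL : IsProj L) {B B' : P → Type} {t t' : ∀ p, B p → B' p}
    (h : ∀ i y (a : Poly (L i) B y), a.map t = a.map t') : t = t' :=
  (hL.existsUnique_map fun _ _ a => a.map t').unique h fun _ _ _ => rfl

lemma bijective_of_map (hL : IsProj L) {B B' : P → Type} {t : ∀ p, B p → B' p}
    (h : ∀ i y, Function.Bijective (Poly.map t : Poly (L i) B y → Poly (L i) B' y)) (p : P) :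
    Function.Bijective (t p) := by
  obtain ⟨t', ht', -⟩ := hL.existsUnique_map fun i y => (Equiv.ofBijective _ (h i y)).symm
  have h1 : (fun p b => t' p (t p b)) = fun p b => b := hL.map_inj fun i y a => by
    refine (ht' i y (a.map t)).trans ?_
    exact (Equiv.ofBijective _ (h i y)).symm_apply_apply a
  have h2 : (fun p b => t p (t' p b)) = fun p b => b := hL.map_inj fun i y a => by
    refine (congrArg (Poly.map t) (ht' i y a)).trans ?_
    exact (Equiv.ofBijective _ (h i y)).apply_symm_apply a
  exact Function.bijective_iff_has_inverse.mpr ⟨t' p, fun b => congrFun (congrFun h1 p) b,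
    fun b => congrFun (congrFun h2 p) b⟩

/-- Every family of bispans to the factors is induced by a bispan to the product. -/
lemma exists_dist [Finite ι] (hL : IsProj L) {X : FinSet} (E : ∀ i, Bispan X (A i)) :
    ∃ E' : Bispan X P, ∀ i, Nonempty (Dist E' (L i) (E i)) := by
  let y : ∀ i, A i → (L i).U := fun i =>
    (Equiv.ofBijective _ ((hL.q i).comp (hL.r i))).symm
  have hy : ∀ i a, (L i).q ((L i).r (y i a)) = a := fun i =>
    (Equiv.ofBijective _ ((hL.q i).comp (hL.r i))).apply_symm_apply
  -- The induced bispan is the disjoint union of the given ones.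
  refine ⟨⟨FintypeCat.of (Σ i, (E i).U), FintypeCat.of (Σ i, (E i).V), fun u => (E u.1).f u.2,
    fun u => ⟨u.1, (E u.1).r u.2⟩, fun v => (L v.1).f (y v.1 ((E v.1).q v.2))⟩, fun i => ⟨?_⟩⟩
  have hs : ∀ (v v' : (E i).V), (⟨i, v⟩ : Σ i, (E i).V) = ⟨i, v'⟩ → v = v' := fun v v' e =>
    eq_of_heq (Sigma.mk.inj e).2
  let tr : ∀ x : Σ i, (E i).U, x.1 = i → (E i).U := fun x h => h ▸ x.2
  exact
    { z := fun w => (L i).r (y i ((E i).q w))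
      s := fun w _ _ => ⟨i, w⟩
      j := fun w u h x hx => tr x (congrArg Sigma.fst hx)
      q_z := fun w => hy _ _
      q_s := fun w u h => congrArg (L i).f ((hL.r i).1 h.symm)
      r_j := by
        rintro w u h ⟨i', x⟩ hx
        obtain rfl : i' = i := congrArg Sigma.fst hx
        exact hs _ _ hx
      f_j := by
        rintro w u h ⟨i', x⟩ hx
        obtain rfl : i' = i := congrArg Sigma.fst hx
        rfl
      zs_inj := fun w w' h h' => hs _ _ (h' _ rfl h)
      zs_surj := by
        intro v k hk
        obtain ⟨u, rfl⟩ := (hL.r i).2 v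
        have h1 := hk u rfl
        generalize hv : k u rfl = v' at h1
        obtain ⟨i', w⟩ := v'
        have h2 := hL.f.1 (a₁ := ⟨i', _⟩) (a₂ := ⟨i, u⟩) h1
        obtain rfl : i' = i := congrArg Sigma.fst h2
        have h3 := eq_of_heq (Sigma.mk.inj h2).2
        refine ⟨w, congrArg (L i').r h3, fun u' h => ?_⟩
        obtain rfl : u' = u := (hL.r i').1 (h.trans (congrArg (L i').r h3))
        exact hv.symm
      j_inj := by
        rintro w u h ⟨i1, x1⟩ hx1 u' h' ⟨i2, x2⟩ hx2 e
        obtain rfl : i1 = i := congrArg Sigma.fst hx1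
        obtain rfl : i2 = i1 := congrArg Sigma.fst hx2
        obtain rfl : x1 = x2 := e
        exact ⟨(hL.r i2).1 (h.trans h'.symm), rfl⟩
      j_surj := fun w x hx => ⟨_, rfl, ⟨i, x⟩, congrArg (Sigma.mk i) hx, rfl⟩ }

/-- Two-cells to a product can be constructed from their composites with the projections. -/
lemma exists_coc (hL : IsProj L) {X0 X1 : FinSet} {E01 : Bispan X0 X1} {E12 : Bispan X1 P}
    {E02 : Bispan X0 P} {E13 : ∀ i, Bispan X1 (A i)} {E03 : ∀ i, Bispan X0 (A i)}
    (φ123 : ∀ i, TwoCell E12 (L i) (E13 i)) (φ023 : ∀ i, TwoCell E02 (L i) (E03 i))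
    (φ013 : ∀ i, TwoCell E01 (E13 i) (E03 i)) :
    ∃ φ012 : TwoCell E01 E12 E02, ∀ i, Coc (φ123 i) (φ023 i) (φ013 i) φ012 := by
  have key := fun A => hL.existsUnique_map (B := Poly E02 A) (B' := Poly E12 (Poly E01 A))
    fun i y b => (φ123 i).app _ y ((φ013 i).app A y
      ((Equiv.ofBijective _ ((φ023 i).bij A y)).symm b))
  choose t ht _ using key
  refine ⟨⟨t, fun B B' s => ?_, fun A p => ?_⟩, fun i A y a => ?_⟩
  · suffices (fun p b => t B' p (Poly.map s b)) =
        fun p b => Poly.map (fun _ => Poly.map s) (t B p b) from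
      fun p b => congrFun (congrFun this p) b
    refine hL.map_inj fun i y a => ?_
    obtain ⟨a, rfl⟩ := ((φ023 i).bij B y).2 a
    have h1 := ht B' i y (((φ023 i).app B y a).map fun _ b => b.map s)
    have h2 := ht B i y ((φ023 i).app B y a)
    rw [← (φ023 i).nat] at h1
    have h3 : ∀ (A) a, (Equiv.ofBijective _ ((φ023 i).bij A y)).symm ((φ023 i).app A y a) = a :=
      fun A a => (Equiv.ofBijective _ ((φ023 i).bij A y)).symm_apply_apply a
    rw [h3] at h1 h2
    rw [(φ013 i).nat, (φ123 i).nat, ← h2, (φ023 i).nat] at h1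
    exact h1
  · refine hL.bijective_of_map (fun i y => ?_) p
    rw [show (Poly.map (t A) : Poly (L i) _ y → _) = _ from funext (ht A i y)]
    exact ((φ123 i).bij _ _).comp (((φ013 i).bij _ _).comp (Equiv.bijective _))
  · refine ((ht A i y _).trans ?_).symm
    exact congrArg (fun b => (φ123 i).app _ y ((φ013 i).app A y b))
      ((Equiv.ofBijective _ ((φ023 i).bij A y)).symm_apply_apply a)

/-- The cocycle condition for bispans to a product can be checked after composition with the
projections. -/
lemma coc_of_forall (hL : IsProj L) {X0 X1 X2 : FinSet} {E01 : Bispan X0 X1} {E12 : Bispan X1 X2}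
    {E02 : Bispan X0 X2} {E23 : Bispan X2 P} {E13 : Bispan X1 P} {E03 : Bispan X0 P}
    {E04 : ∀ i, Bispan X0 (A i)} {E14 : ∀ i, Bispan X1 (A i)} {E24 : ∀ i, Bispan X2 (A i)}
    {φ012 : TwoCell E01 E12 E02} {φ013 : TwoCell E01 E13 E03} {φ023 : TwoCell E02 E23 E03}
    {φ123 : TwoCell E12 E23 E13} {φ014 : ∀ i, TwoCell E01 (E14 i) (E04 i)}
    {φ024 : ∀ i, TwoCell E02 (E24 i) (E04 i)} {φ034 : ∀ i, TwoCell E03 (L i) (E04 i)}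
    {φ124 : ∀ i, TwoCell E12 (E24 i) (E14 i)} {φ134 : ∀ i, TwoCell E13 (L i) (E14 i)}
    {φ234 : ∀ i, TwoCell E23 (L i) (E24 i)}
    (h1234 : ∀ i, Coc (φ234 i) (φ134 i) (φ124 i) φ123)
    (h0234 : ∀ i, Coc (φ234 i) (φ034 i) (φ024 i) φ023)
    (h0134 : ∀ i, Coc (φ134 i) (φ034 i) (φ014 i) φ013)
    (h0124 : ∀ i, Coc (φ124 i) (φ024 i) (φ014 i) φ012) : Coc φ123 φ023 φ013 φ012 := by
  intro B
  suffices (fun p b => φ123.app (Poly E01 B) p (φ013.app B p b)) =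
      fun p b => (φ023.app B p b).map fun y' b => φ012.app B y' b from
    fun p b => congrFun (congrFun this p) b
  refine hL.map_inj fun i y a => ?_
  obtain ⟨a, rfl⟩ := ((φ034 i).bij B y).2 a
  have h1 := h0134 i B y a
  have h2 := h0234 i B y a
  have h3 := h1234 i (Poly E01 B) y ((φ014 i).app B y a)
  rw [h0124, (φ234 i).nat, h2, h1] at h3
  exact h3.symm

end IsProj

/-! ### Simplices of `RSpan` as diagrams of finite sets -/

/-- The index `(a, [b, c])`, with `a ≤ b ≤ c`, for the value of a simplex of `RSpan` at the edge
`a | b c` of the distributahedron. -/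
@[ext]
structure DistIdx (n : ℕ) : Type where
  a : Fin (n + 1)
  b : Fin (n + 1)
  c : Fin (n + 1)
  hab : a ≤ b := by order
  hbc : b ≤ c := by order

/-- The order for which the diagrams are covariant: intervals are ordered by reverse inclusion. -/
instance (n : ℕ) : PartialOrder (DistIdx n) where
  le s t := s.a ≤ t.a ∧ s.b ≤ t.b ∧ t.c ≤ s.c
  le_refl _ := ⟨le_rfl, le_rfl, le_rfl⟩
  le_trans _ _ _ h h' := ⟨h.1.trans h'.1, h.2.1.trans h'.2.1, h'.2.2.trans h.2.2⟩
  le_antisymm _ _ h h' := DistIdx.ext (le_antisymm h.1 h'.1) (le_antisymm h.2.1 h'.2.1)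
    (le_antisymm h'.2.2 h.2.2)

/-- The action of a monotone map on indices. -/
def DistIdx.map {m n : ℕ} (f : Fin (m + 1) →o Fin (n + 1)) (s : DistIdx m) : DistIdx n :=
  ⟨f s.a, f s.b, f s.c, f.monotone s.hab, f.monotone s.hbc⟩

lemma DistIdx.map_le {m n : ℕ} (f : Fin (m + 1) →o Fin (n + 1)) {s t : DistIdx m} (h : s ≤ t) :
    s.map f ≤ t.map f :=
  ⟨f.monotone h.1, f.monotone h.2.1, f.monotone h.2.2⟩

/-- A simplex of `RSpan`, as a diagram of finite sets indexed by the triples `a ≤ b ≤ c`. The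
field `row` says that the diagrams with a fixed `a` are spans; the fields `pull` and `sect`
say that the diagrams of the shape of a pentagon are cromulent: the right-hand square is a
pullback, and the corner is given by a dependent product. -/
structure RSimplex (n : ℕ) : Type 1 where
  obj : DistIdx n → FinSet
  m : ∀ {s : DistIdx n} (t : DistIdx n) (_ : obj s)
    (_ : s ≤ t := by refine ⟨?_, ?_, ?_⟩ <;> dsimp only <;> order), obj t
  m_refl : ∀ s x, m s x (le_refl s) = x
  m_comp : ∀ {s t u : DistIdx n} (h : s ≤ t) (h' : t ≤ u) x, m u (m t x h) h' = m u x (h.trans h')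
  row : ∀ a i k j l (_ : a ≤ i) (_ : i ≤ k) (_ : k ≤ j) (_ : j ≤ l)
    (x : obj (.mk a i j)) (y : obj (.mk a k l)), m (.mk a k j) x = m (.mk a k j) y →
    ∃! w : obj (.mk a i l), m (.mk a i j) w = x ∧ m (.mk a k l) w = y
  pull : ∀ a a' b c (_ : a ≤ a') (_ : a' ≤ b) (_ : b ≤ c) (y : obj (.mk a' b c))
    (β : obj (.mk a c c)), m (.mk a' c c) y = m (.mk a' c c) β →
    ∃! e : obj (.mk a b c), m (.mk a' b c) e = y ∧ m (.mk a c c) e = β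
  sect : ∀ a a' b c (_ : a ≤ a') (_ : a' ≤ b) (_ : b ≤ c) (z : obj (.mk a' c c))
    (k : ∀ y : obj (.mk a' b c), m (.mk a' c c) y = z → obj (.mk a b b)),
    (∀ y h, m (.mk a' b b) (k y h) = m (.mk a' b b) y) →
    ∃! β : obj (.mk a c c), m (.mk a' c c) β = z ∧
        ∀ (e : obj (.mk a b c)) y hy, m (.mk a c c) e = β →
          m (.mk a' b c) e = y → m (.mk a b b) e = k y hy

namespace RSimplex

variable {n : ℕ} (R : RSimplex n)

/-- The restriction of a simplex along a monotone map. -/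
def map {m : ℕ} (f : Fin (m + 1) →o Fin (n + 1)) : RSimplex m where
  obj s := R.obj (s.map f)
  m t x h := R.m (t.map f) x (DistIdx.map_le f h)
  m_refl _ := R.m_refl _
  m_comp _ _ := R.m_comp _ _
  row _ _ _ _ _ h1 h2 h3 h4 := R.row _ _ _ _ _ (f.monotone h1) (f.monotone h2) (f.monotone h3)
    (f.monotone h4)
  pull _ _ _ _ h1 h2 h3 := R.pull _ _ _ _ (f.monotone h1) (f.monotone h2) (f.monotone h3)
  sect _ _ _ _ h1 h2 h3 := R.sect _ _ _ _ (f.monotone h1) (f.monotone h2) (f.monotone h3)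

/-- The edge from `a` to `b`. -/
def bispan (a b : Fin (n + 1)) (h : a ≤ b) :
    Bispan (R.obj (.mk a a a)) (R.obj (.mk b b b)) where
  U := R.obj (.mk a a b)
  V := R.obj (.mk a b b)
  f x := R.m (.mk a a a) x
  r x := R.m (.mk a b b) x
  q x := R.m (.mk b b b) x

lemma bispan_self (a : Fin (n + 1)) : R.bispan a a le_rfl = Bispan.id _ := by
  have : ∀ h, (fun x => R.m (s := .mk a a a) (.mk a a a) x h) = id :=
    fun h => funext fun x => R.m_refl _ x
  unfold bispan Bispan.id
  rw [this]

section dist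

variable (a b c : Fin (n + 1)) (hab : a ≤ b) (hbc : b ≤ c)

lemma exists_mid (w : R.obj (.mk a c c)) (u : R.obj (.mk b b c))
    (h : R.m (.mk b c c) u = R.m (.mk b c c) w) :
    ∃ e : R.obj (.mk a b c), R.m (.mk a c c) e = w ∧ R.m (.mk b b c) e = u :=
  let ⟨e, he, _⟩ := R.pull a b b c hab le_rfl hbc u w h
  ⟨e, he.2, he.1⟩

lemma mid_unique (e e' : R.obj (.mk a b c)) (h : R.m (.mk a c c) e = R.m (.mk a c c) e')
    (h' : R.m (.mk b b c) e = R.m (.mk b b c) e') : e = e' :=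
  (R.pull a b b c hab le_rfl hbc (R.m (.mk b b c) e') (R.m (.mk a c c) e')
    (by rw [R.m_comp, R.m_comp])).unique ⟨h', h⟩ ⟨rfl, rfl⟩

lemma exists_join (e : R.obj (.mk a b c)) (x : R.obj (.mk a a b))
    (h : R.m (.mk a b b) x = R.m (.mk a b b) e) :
    ∃ y : R.obj (.mk a a c), R.m (.mk a b c) y = e ∧ R.m (.mk a a b) y = x :=
  let ⟨y, hy, _⟩ := R.row a a b b c le_rfl hab le_rfl hbc x e h
  ⟨y, hy.2, hy.1⟩

lemma join_unique (y y' : R.obj (.mk a a c)) (h : R.m (.mk b b c) y = R.m (.mk b b c) y')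
    (h' : R.m (.mk a c c) y = R.m (.mk a c c) y')
    (h'' : R.m (.mk a a b) y = R.m (.mk a a b) y') : y = y' := by
  refine (R.row a a b b c le_rfl hab le_rfl hbc (R.m (.mk a a b) y')
    (R.m (.mk a b c) y') (by rw [R.m_comp, R.m_comp])).unique ⟨h'', ?_⟩ ⟨rfl, rfl⟩
  exact R.mid_unique a b c hab hbc _ _ (by rw [R.m_comp, R.m_comp, h'])
    (by rw [R.m_comp, R.m_comp, h])

/-- Elements `w` of the edge `a → c` and `u` of the edge `b → c` over the same element come from a
unique element `e` at the index `(a, [b, c])`; the element `s w u` is the image of `e`. The function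
`j` is obtained in the same way. -/
lemma exists_sj : ∃ (s : ∀ (w : R.obj (.mk a c c)) (u : R.obj (.mk b b c)),
      R.m (.mk b c c) u = R.m (.mk b c c) w → R.obj (.mk a b b))
    (j : ∀ w u h (x : R.obj (.mk a a b)), R.m (.mk a b b) x = s w u h → R.obj (.mk a a c)),
    (∀ w u h (e : R.obj (.mk a b c)), R.m (.mk a c c) e = w →
      R.m (.mk b b c) e = u → s w u h = R.m (.mk a b b) e) ∧
    (∀ w u h x hx y, R.m (.mk a c c) y = w → R.m (.mk b b c) y = u →
      R.m (.mk a a b) y = x → j w u h x hx = y) := by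
  choose e he1 he2 using R.exists_mid a b c hab hbc
  choose y hy1 hy2 using R.exists_join a b c hab hbc
  refine ⟨fun w u h => R.m (.mk a b b) (e w u h), fun w u h x hx => y (e w u h) x hx, ?_, ?_⟩
  · intro w u h e' h1 h2
    change R.m (.mk a b b) (e w u h) = _
    rw [R.mid_unique a b c hab hbc (e w u h) e' ((he1 _ _ _).trans h1.symm)
      ((he2 _ _ _).trans h2.symm)]
  · intro w u h x hx y' h1 h2 h3
    apply R.join_unique a b c hab hbc
    · have : ∀ z : R.obj (.mk a a c), R.m (.mk b b c) z = R.m (.mk b b c) (R.m (.mk a b c) z) :=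
        fun z => (R.m_comp _ _ _).symm
      rw [this, hy1, he2, h2]
    · have : ∀ z : R.obj (.mk a a c), R.m (.mk a c c) z = R.m (.mk a c c) (R.m (.mk a b c) z) :=
        fun z => (R.m_comp _ _ _).symm
      rw [this, hy1, he1, h1]
    · rw [hy2, h3]

/-- The element of the edge from `a` to `b` at the element `u` of the edge from `b` to `c`, for an
element `w` of the edge from `a` to `c`. -/
noncomputable def s : ∀ (w : R.obj (.mk a c c)) (u : R.obj (.mk b b c)),
    R.m (.mk b c c) u = R.m (.mk b c c) w → R.obj (.mk a b b) :=
  (R.exists_sj a b c hab hbc).choose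

/-- The inverse of the map from the edge `a → c` to the edges `b → c` and `a → b`. -/
noncomputable def j : ∀ w u h (x : R.obj (.mk a a b)),
    R.m (.mk a b b) x = R.s a b c hab hbc w u h → R.obj (.mk a a c) :=
  (R.exists_sj a b c hab hbc).choose_spec.choose

lemma s_eq {w u} (h) (e : R.obj (.mk a b c)) (h1 : R.m (.mk a c c) e = w)
    (h2 : R.m (.mk b b c) e = u) : R.s a b c hab hbc w u h = R.m (.mk a b b) e :=
  (R.exists_sj a b c hab hbc).choose_spec.choose_spec.1 w u h e h1 h2

lemma j_eq {w u} (h) {x} (hx) (y : R.obj (.mk a a c)) (h1 : R.m (.mk a c c) y = w)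
    (h2 : R.m (.mk b b c) y = u) (h3 : R.m (.mk a a b) y = x) :
    R.j a b c hab hbc w u h x hx = y :=
  (R.exists_sj a b c hab hbc).choose_spec.choose_spec.2 w u h x hx y h1 h2 h3

lemma exists_join' (w u h x) (hx : R.m (.mk a b b) x = R.s a b c hab hbc w u h) :
    ∃ y : R.obj (.mk a a c), R.m (.mk a c c) y = w ∧
      R.m (.mk b b c) y = u ∧ R.m (.mk a a b) y = x ∧ R.j a b c hab hbc w u h x hx = y := by
  obtain ⟨e, h1, h2⟩ := R.exists_mid a b c hab hbc w u h
  obtain ⟨y, h3, h4⟩ := R.exists_join a b c hab hbc e x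
    (hx.trans (R.s_eq a b c hab hbc h e h1 h2))
  have h5 : R.m (.mk a c c) y = w := by
    rw [← h1, ← h3, R.m_comp]
  have h6 : R.m (.mk b b c) y = u := by
    rw [← h2, ← h3, R.m_comp]
  exact ⟨y, h5, h6, h4, R.j_eq a b c hab hbc h hx y h5 h6 h4⟩

/-- The triangle with vertices `a ≤ b ≤ c`. -/
noncomputable def dist :
    Dist (R.bispan a b hab) (R.bispan b c hbc) (R.bispan a c (hab.trans hbc)) where
  z w := R.m (.mk b c c) w
  s := R.s a b c hab hbc
  j := R.j a b c hab hbc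
  q_z _ := R.m_comp _ _ _
  q_s w u h := by
    obtain ⟨e, rfl, rfl⟩ := R.exists_mid a b c hab hbc w u h
    rw [R.s_eq a b c hab hbc h e rfl rfl]
    exact (R.m_comp _ _ _).trans (R.m_comp _ _ _).symm
  r_j w u h x hx := by
    obtain ⟨y, h1, -, -, h4⟩ := R.exists_join' a b c hab hbc w u h x hx
    exact h4 ▸ h1
  f_j w u h x hx := by
    obtain ⟨y, -, -, rfl, h4⟩ := R.exists_join' a b c hab hbc w u h x hx
    rw [h4]
    exact (R.m_comp _ _ _).symm
  zs_inj w w' hz hs := by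
    refine (R.sect a b b c hab le_rfl hbc (R.m (.mk b c c) w')
      (fun y hy => R.s a b c hab hbc w' y hy) (fun y hy => ?_)).unique ⟨hz, ?_⟩ ⟨rfl, ?_⟩
    · obtain ⟨e, rfl, rfl⟩ := R.exists_mid a b c hab hbc _ _ hy
      rw [R.s_eq a b c hab hbc hy e rfl rfl]
      exact (R.m_comp _ _ _).trans (R.m_comp _ _ _).symm
    · rintro e y hy rfl rfl
      rw [← hs _ (hy.trans hz.symm) hy]
      exact (R.s_eq a b c hab hbc _ e rfl rfl).symm
    · rintro e y hy rfl rfl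
      exact (R.s_eq a b c hab hbc _ e rfl rfl).symm
  zs_surj v k hk := by
    obtain ⟨w, ⟨h1, h2⟩, -⟩ := R.sect a b b c hab le_rfl hbc v k hk
    refine ⟨w, h1, fun u h => ?_⟩
    obtain ⟨e, h3, h4⟩ := R.exists_mid a b c hab hbc _ _ h
    rw [R.s_eq a b c hab hbc h e h3 h4]
    exact h2 e u _ h3 h4
  j_inj w u h x hx u' h' x' hx' e := by
    obtain ⟨y, -, h2, h3, h4⟩ := R.exists_join' a b c hab hbc w u h x hx
    obtain ⟨y', -, h2', h3', h4'⟩ := R.exists_join' a b c hab hbc w u' h' x' hx'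
    obtain rfl : y = y' := h4.symm.trans (e.trans h4')
    exact ⟨h2.symm.trans h2', h3.symm.trans h3'⟩
  j_surj w y hy := by
    have h1 : R.m (.mk b c c) (R.m (.mk b b c) y) = R.m (.mk b c c) w := by
      rw [← hy]
      exact (R.m_comp _ _ _).trans (R.m_comp _ _ _).symm
    have h2 : R.m (.mk a b b) (R.m (.mk a a b) y) = R.s a b c hab hbc w _ h1 := by
      rw [R.s_eq a b c hab hbc h1 (R.m (.mk a b c) y) ((R.m_comp _ _ _).trans hy)
        (R.m_comp _ _ _)]
      exact (R.m_comp _ _ _).trans (R.m_comp _ _ _).symm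
    exact ⟨_, h1, _, h2, R.j_eq a b c hab hbc h1 h2 y hy rfl rfl⟩

end dist

end RSimplex

section coc

variable {X0 X1 X2 X3 : FinSet} {E01 : Bispan X0 X1} {E12 : Bispan X1 X2} {E23 : Bispan X2 X3}
  {E02 : Bispan X0 X2} {E13 : Bispan X1 X3} {E03 : Bispan X0 X3}

/-- The cocycle condition in terms of elements. -/
structure DistCoc (D123 : Dist E12 E23 E13) (D023 : Dist E02 E23 E03) (D013 : Dist E01 E13 E03)
    (D012 : Dist E01 E12 E02) : Prop where
  zz : ∀ w, D123.z (D013.z w) = D023.z w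
  sz : ∀ w u h h', D123.s (D013.z w) u h = D012.z (D023.s w u h')
  ss : ∀ w u h h' x hx hx' hj,
    D013.s w (D123.j (D013.z w) u h x hx) hj = D012.s (D023.s w u h') x hx'
  jj : ∀ w u h h' x hx hx' hj t ht ht' hj',
    D013.j w (D123.j (D013.z w) u h x hx) hj t ht =
      D023.j w u h' (D012.j (D023.s w u h') x hx' t ht') hj'

lemma DistCoc.coc {D123 : Dist E12 E23 E13} {D023 : Dist E02 E23 E03} {D013 : Dist E01 E13 E03}
    {D012 : Dist E01 E12 E02} (H : DistCoc D123 D023 D013 D012) :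
    Coc D123.toTwoCell D023.toTwoCell D013.toTwoCell D012.toTwoCell := by
  intro A y a
  refine Poly.ext' (H.zz _) fun u x2 h h' h2 => ?_
  refine Poly.ext' (H.sz _ _ _ _) fun x x1 hx hx' h1 => ?_
  refine Poly.ext' (H.ss _ _ _ _ _ _ _ _) fun t x0 ht ht' h0 => ?_
  have key : ∀ (p q : E03.U) (_ : p = q) (hp hp' hq hq'), a.g p x0 hp hp' = a.g q x0 hq hq' := by
    rintro p _ rfl _ _ _ _
    rfl
  exact key _ _ (H.jj _ _ _ _ _ _ _ _ _ _ _ (D012.r_j _ _ _ _ _)) _ _ _ _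

lemma Coc.distCoc {D123 : Dist E12 E23 E13} {D023 : Dist E02 E23 E03} {D013 : Dist E01 E13 E03}
    {D012 : Dist E01 E12 E02}
    (H : Coc D123.toTwoCell D023.toTwoCell D013.toTwoCell D012.toTwoCell) :
    DistCoc D123 D023 D013 D012 := by
  have h1 := fun w => Poly.ext_elim (H _ _ (generic w))
  have h2 := fun w u x2 h h' hx => Poly.ext_elim ((h1 w).2 u x2 h h' hx)
  have h3 := fun w u x2 h h' hx t x1 ht ht' hx' =>
    Poly.ext_elim ((h2 w u x2 h h' hx).2 t x1 ht ht' hx')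
  refine ⟨fun w => (h1 w).1, fun w u h h' => (h2 w u _ h h' rfl).1, ?_, ?_⟩
  · intro w u h h' x hx hx' hj
    exact (h3 w u _ h h' rfl x _ hx hx' rfl).1
  · intro w u h h' x hx hx' hj t ht ht' hj'
    exact congrArg Subtype.val ((h3 w u _ h h' rfl x _ hx hx' rfl).2 t _ ht ht' rfl)

end coc

section norm

variable {X Y : FinSet} {E : Bispan X Y}

lemma tri_eq_deg0 {I : Bispan X X} (hI : I = Bispan.id X) (D : Dist I E E) (hz : ∀ w, D.z w = w)
    (hj : ∀ w u h x hx, D.j w u h x hx = u) :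
    (⟨_, _, _, _, _, _, D.toTwoCell⟩ : Tri) = Edge.deg0 ⟨_, _, E⟩ := by
  subst hI
  have : D.toTwoCell = (Dist.unitLeft E).toTwoCell :=
    Dist.toTwoCell_congr _ _ hz (fun w u h h' => D.q_s w u h) fun w u h h' x hx hx' => hj _ _ _ _ _
  rw [this]
  rfl

lemma tri_eq_deg1 {I : Bispan Y Y} (hI : I = Bispan.id Y) (D : Dist E I E)
    (hs : ∀ w u h, D.s w u h = w) (hj : ∀ w u h x hx, D.j w u h x hx = x) :
    (⟨_, _, _, _, _, _, D.toTwoCell⟩ : Tri) = Edge.deg1 ⟨_, _, E⟩ := by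
  subst hI
  have : D.toTwoCell = (Dist.unitRight E).toTwoCell :=
    Dist.toTwoCell_congr _ _ (fun w => D.q_z w) (fun w u h h' => hs _ _ _)
      fun w u h h' x hx hx' => hj _ _ _ _ _
  rw [this]
  rfl

lemma deg0_elim {I : Bispan X X} (hI : I = Bispan.id X) (φ : TwoCell I E E)
    (h : (⟨_, _, _, _, _, _, φ⟩ : Tri) = Edge.deg0 ⟨_, _, E⟩) :
    (∀ w, φ.toDist.z w = w) ∧ ∀ w u h x hx, φ.toDist.j w u h x hx = u := by
  subst hI
  obtain rfl : φ = (Dist.unitLeft E).toTwoCell := eq_of_heq (Tri.mk.inj h).2.2.2.2.2.2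
  exact ⟨fun _ => rfl, fun _ _ _ _ _ => rfl⟩

lemma deg1_elim {I : Bispan Y Y} (hI : I = Bispan.id Y) (φ : TwoCell E I E)
    (h : (⟨_, _, _, _, _, _, φ⟩ : Tri) = Edge.deg1 ⟨_, _, E⟩) :
    (∀ w u h, φ.toDist.s w u h = w) ∧ ∀ w u h x hx, φ.toDist.j w u h x hx = x := by
  subst hI
  obtain rfl : φ = (Dist.unitRight E).toTwoCell := eq_of_heq (Tri.mk.inj h).2.2.2.2.2.2
  exact ⟨fun _ _ _ => rfl, fun _ _ _ _ _ => rfl⟩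

end norm

namespace RSimplex

variable {n : ℕ} (R : RSimplex n)

lemma j_self_left (a b : Fin (n + 1)) (h : a ≤ b) (w u h' x hx) :
    R.j a a b le_rfl h w u h' x hx = u := by
  obtain ⟨y, -, h2, -, h4⟩ := R.exists_join' a a b le_rfl h w u h' x hx
  rw [h4, ← h2, R.m_refl]

lemma s_self_right (a b : Fin (n + 1)) (h : a ≤ b) (w u h') :
    R.s a b b h le_rfl w u h' = w := by
  obtain ⟨e, h1, h2⟩ := R.exists_mid a b b h le_rfl w u h'
  rw [R.s_eq a b b h le_rfl h' e h1 h2, h1]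

lemma j_self_right (a b : Fin (n + 1)) (h : a ≤ b) (w u h' x hx) :
    R.j a b b h le_rfl w u h' x hx = x := by
  obtain ⟨y, -, -, h3, h4⟩ := R.exists_join' a b b h le_rfl w u h' x hx
  rw [h4, ← h3, R.m_refl]

section coc

variable (a b c d : Fin (n + 1)) (hab : a ≤ b) (hbc : b ≤ c) (hcd : c ≤ d)

lemma s_m (w : R.obj (.mk a d d)) (u : R.obj (.mk c c d)) (h h') :
    R.s b c d hbc hcd (R.m (.mk b d d) w) u h =
      R.m (.mk b c c) (R.s a c d (hab.trans hbc) hcd w u h') := by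
  obtain ⟨e, h1, h2⟩ := R.exists_mid a c d (hab.trans hbc) hcd w u h'
  rw [R.s_eq a c d (hab.trans hbc) hcd _ e h1 h2, R.s_eq b c d hbc hcd _ (R.m (.mk b c d) e),
    R.m_comp, R.m_comp]
  · rw [← h1, R.m_comp, R.m_comp]
  · rw [← h2, R.m_comp]

lemma s_j (w : R.obj (.mk a d d)) (u : R.obj (.mk c c d)) (h h') (x : R.obj (.mk b b c))
    (hx hx' hj) :
    R.s a b d hab (hbc.trans hcd) w (R.j b c d hbc hcd (R.m (.mk b d d) w) u h x hx) hj =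
      R.s a b c hab hbc (R.s a c d (hab.trans hbc) hcd w u h') x hx' := by
  obtain ⟨y, h1, h2, h3, h4⟩ := R.exists_join' b c d hbc hcd _ u h x hx
  obtain ⟨e, h5, h6⟩ := R.exists_mid a b d hab (hbc.trans hcd) w y h1
  have e1 := R.s_eq a c d (hab.trans hbc) hcd h' (R.m (.mk a c d) e)
    ((R.m_comp _ _ _).trans h5)
    (by rw [← h2, ← h6, R.m_comp, R.m_comp])
  have e2 := R.s_eq a b c hab hbc hx' (R.m (.mk a b c) e) (by rw [e1, R.m_comp, R.m_comp])
    (by rw [← h3, ← h6, R.m_comp, R.m_comp])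
  rw [e2, R.m_comp]
  exact R.s_eq a b d hab (hbc.trans hcd) hj e h5 (h6.trans h4.symm)

lemma j_j (w : R.obj (.mk a d d)) (u : R.obj (.mk c c d)) (h h') (x : R.obj (.mk b b c))
    (hx hx' hj) (t : R.obj (.mk a a b)) (ht ht' hj') :
    R.j a b d hab (hbc.trans hcd) w (R.j b c d hbc hcd (R.m (.mk b d d) w) u h x hx) hj t ht =
      R.j a c d (hab.trans hbc) hcd w u h'
        (R.j a b c hab hbc (R.s a c d (hab.trans hbc) hcd w u h') x hx' t ht') hj' := by
  obtain ⟨y, h1, h2, h3, h4⟩ := R.exists_join' a b d hab (hbc.trans hcd) w _ hj t ht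
  obtain ⟨y', h1', h2', h3', h4'⟩ := R.exists_join' b c d hbc hcd _ u h x hx
  rw [h4'] at h2
  have e1 : R.m (.mk c c d) y = u := by
    rw [← h2', ← h2, R.m_comp]
  have e2 := R.s_eq a c d (hab.trans hbc) hcd h' (R.m (.mk a c d) y) ((R.m_comp _ _ _).trans h1)
    ((R.m_comp _ _ _).trans e1)
  rw [h4]
  refine (R.j_eq a c d (hab.trans hbc) hcd h' hj' y h1 e1 ?_).symm
  refine (R.j_eq a b c hab hbc hx' ht' (R.m (.mk a a c) y) ?_ ?_ ?_).symm
  · rw [e2, R.m_comp, R.m_comp]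
  · rw [← h3', ← h2, R.m_comp, R.m_comp]
  · rw [← h3, R.m_comp]

lemma distCoc :
    DistCoc (R.dist b c d hbc hcd) (R.dist a c d (hab.trans hbc) hcd)
      (R.dist a b d hab (hbc.trans hcd)) (R.dist a b c hab hbc) where
  zz _ := R.m_comp _ _ _
  sz := R.s_m a b c d hab hbc hcd
  ss := R.s_j a b c d hab hbc hcd
  jj := R.j_j a b c d hab hbc hcd

end coc

/-- The simplex of the nerve of the bicategory of bispans underlying a simplex of `RSpan`. -/
noncomputable def toNerve : NSimplex n where
  x a := R.obj (.mk a a a)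
  E := R.bispan
  φ a b c hab hbc := (R.dist a b c hab hbc).toTwoCell
  deg0 a b h := tri_eq_deg0 (R.bispan_self a) _ (fun w => R.m_refl _ w) (R.j_self_left a b h)
  deg1 a b h := tri_eq_deg1 (R.bispan_self b) _ (R.s_self_right a b h) (R.j_self_right a b h)
  coc a b c d hab hbc hcd := (R.distCoc a b c d hab hbc hcd).coc

end RSimplex

/-- `RSpan`, in terms of diagrams of finite sets. -/
def ringSpans : SSet.{1} where
  obj n := RSimplex n.unop.len
  map f := ↾fun R => R.map f.unop.toOrderHom
  map_id _ := rfl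
  map_comp _ _ := rfl

/-- The projection to the nerve of the bicategory of bispans. -/
noncomputable def ringSpansToNerve : ringSpans ⟶ bispanNerve where
  app _ := ↾fun R => R.toNerve
  naturality _ _ _ := rfl

/-! ### The canonical diagram of a simplex of the nerve -/

/-- The pullback of two maps of finite sets. -/
@[ext]
structure FibProd {U V W : FinSet} (r : U → W) (z : V → W) : Type where
  w : V
  u : U
  h : r u = z w

instance {U V W : FinSet} (r : U → W) (z : V → W) : Finite (FibProd r z) :=
  Finite.of_injective (fun p => (p.w, p.u)) fun _ _ h =>
    FibProd.ext (congrArg Prod.fst h) (congrArg Prod.snd h)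

namespace NSimplex

variable {n : ℕ} (ν : NSimplex n)

/-- The triangles of a simplex, in terms of elements. -/
def D (a b c : Fin (n + 1)) (hab : a ≤ b) (hbc : b ≤ c) :
    Dist (ν.E a b hab) (ν.E b c hbc) (ν.E a c (hab.trans hbc)) :=
  (ν.φ a b c hab hbc).toDist

lemma distCoc (a b c d : Fin (n + 1)) (hab : a ≤ b) (hbc : b ≤ c) (hcd : c ≤ d) :
    DistCoc (ν.D b c d hbc hcd) (ν.D a c d (hab.trans hbc) hcd)
      (ν.D a b d hab (hbc.trans hcd)) (ν.D a b c hab hbc) := by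
  apply Coc.distCoc
  unfold D
  simp only [TwoCell.toTwoCell_toDist]
  exact ν.coc a b c d hab hbc hcd

lemma E_self (a : Fin (n + 1)) : ν.E a a le_rfl = Bispan.id (ν.x a) :=
  eq_of_heq (Edge.mk.inj (ν.edge_self a)).2.2

lemma r_self_bijective (a : Fin (n + 1)) : Function.Bijective (ν.E a a le_rfl).r := by
  rw [E_self]
  exact Function.bijective_id

lemma z_self (a b : Fin (n + 1)) (h : a ≤ b) (w) : (ν.D a a b le_rfl h).z w = w :=
  (deg0_elim (ν.E_self a) _ (ν.deg0 a b h)).1 w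

lemma s_self (a b : Fin (n + 1)) (h : a ≤ b) (w u h') : (ν.D a b b h le_rfl).s w u h' = w :=
  (deg1_elim (ν.E_self b) _ (ν.deg1 a b h)).1 w u h'

section abc

variable (a b c : Fin (n + 1)) (hab : a ≤ b) (hbc : b ≤ c)

lemma exists_lm : ∃ (l : (ν.E a c (hab.trans hbc)).U → (ν.E b c hbc).U)
    (m : (ν.E a c (hab.trans hbc)).U → (ν.E a b hab).U)
    (h : ∀ u, (ν.E b c hbc).r (l u) = (ν.D a b c hab hbc).z ((ν.E a c (hab.trans hbc)).r u))
    (h' : ∀ u, (ν.E a b hab).r (m u) =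
      (ν.D a b c hab hbc).s ((ν.E a c (hab.trans hbc)).r u) (l u) (h u)),
    ∀ u, (ν.D a b c hab hbc).j _ _ (h u) _ (h' u) = u := by
  choose l hl m hm h using fun u => (ν.D a b c hab hbc).j_surj _ u rfl
  exact ⟨l, m, hl, hm, h⟩

/-- The component in `b → c` of an element of `a → c`. -/
noncomputable def l : (ν.E a c (hab.trans hbc)).U → (ν.E b c hbc).U :=
  (ν.exists_lm a b c hab hbc).choose

/-- The component in `a → b` of an element of `a → c`. -/
noncomputable def m : (ν.E a c (hab.trans hbc)).U → (ν.E a b hab).U :=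
  (ν.exists_lm a b c hab hbc).choose_spec.choose

lemma r_l (u) : (ν.E b c hbc).r (ν.l a b c hab hbc u) =
    (ν.D a b c hab hbc).z ((ν.E a c (hab.trans hbc)).r u) :=
  (ν.exists_lm a b c hab hbc).choose_spec.choose_spec.choose u

lemma r_m (u) : (ν.E a b hab).r (ν.m a b c hab hbc u) =
    (ν.D a b c hab hbc).s ((ν.E a c (hab.trans hbc)).r u) _ (ν.r_l a b c hab hbc u) :=
  (ν.exists_lm a b c hab hbc).choose_spec.choose_spec.choose_spec.choose u

lemma j_lm (u) : (ν.D a b c hab hbc).j _ _ (ν.r_l a b c hab hbc u) _ (ν.r_m a b c hab hbc u) = u :=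
  (ν.exists_lm a b c hab hbc).choose_spec.choose_spec.choose_spec.choose_spec u

lemma s_congr {w w' u u'} (hw : w = w') (hu : u = u') (h h') :
    (ν.D a b c hab hbc).s w u h = (ν.D a b c hab hbc).s w' u' h' := by
  subst hw hu
  rfl

lemma j_congr {w w' u u' x x'} (hw : w = w') (hu : u = u') (hx : x = x') (h1 h1' h2 h2') :
    (ν.D a b c hab hbc).j w u h1 x h2 = (ν.D a b c hab hbc).j w' u' h1' x' h2' := by
  subst hw hu hx
  rfl

lemma lm_eq {U w u h x hx} (hj : (ν.D a b c hab hbc).j w u h x hx = U) :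
    ν.l a b c hab hbc U = u ∧ ν.m a b c hab hbc U = x := by
  obtain rfl : (ν.E a c (hab.trans hbc)).r U = w := by
    rw [← hj, (ν.D a b c hab hbc).r_j]
  have := (ν.D a b c hab hbc).j_inj _ _ _ _ _ _ _ _ _ (hj.trans (ν.j_lm a b c hab hbc U).symm)
  exact ⟨this.1.symm, this.2.symm⟩

lemma U_ext {u u' : (ν.E a c (hab.trans hbc)).U}
    (hr : (ν.E a c (hab.trans hbc)).r u = (ν.E a c (hab.trans hbc)).r u')
    (hl : ν.l a b c hab hbc u = ν.l a b c hab hbc u')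
    (hm : ν.m a b c hab hbc u = ν.m a b c hab hbc u') : u = u' := by
  rw [← ν.j_lm a b c hab hbc u, ← ν.j_lm a b c hab hbc u']
  exact ν.j_congr a b c hab hbc hr hl hm _ _ _ _

lemma exists_U (w : (ν.E a c (hab.trans hbc)).V) (y : (ν.E b c hbc).U) (h)
    (x : (ν.E a b hab).U) (hx : (ν.E a b hab).r x = (ν.D a b c hab hbc).s w y h) :
    ∃ u, (ν.E a c (hab.trans hbc)).r u = w ∧ ν.l a b c hab hbc u = y ∧
      ν.m a b c hab hbc u = x :=
  ⟨(ν.D a b c hab hbc).j w y h x hx, (ν.D a b c hab hbc).r_j _ _ _ _ _,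
    ν.lm_eq a b c hab hbc rfl⟩

end abc

lemma l_self (a b : Fin (n + 1)) (h : a ≤ b) (u) : ν.l a a b le_rfl h u = u :=
  ((deg0_elim (ν.E_self a) _ (ν.deg0 a b h)).2 _ _ _ _ _).symm.trans (ν.j_lm a a b le_rfl h u)

lemma m_self (a b : Fin (n + 1)) (h : a ≤ b) (u) : ν.m a b b h le_rfl u = u :=
  ((deg1_elim (ν.E_self b) _ (ν.deg1 a b h)).2 _ _ _ _ _).symm.trans (ν.j_lm a b b h le_rfl u)

section abcd

variable (a b c d : Fin (n + 1)) (hab : a ≤ b) (hbc : b ≤ c) (hcd : c ≤ d)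

lemma z_z (w) : (ν.D b c d hbc hcd).z ((ν.D a b d hab (hbc.trans hcd)).z w) =
    (ν.D a c d (hab.trans hbc) hcd).z w :=
  (ν.distCoc a b c d hab hbc hcd).zz w

lemma s_z (w u h h') : (ν.D b c d hbc hcd).s ((ν.D a b d hab (hbc.trans hcd)).z w) u h =
    (ν.D a b c hab hbc).z ((ν.D a c d (hab.trans hbc) hcd).s w u h') :=
  (ν.distCoc a b c d hab hbc hcd).sz w u h h'

lemma s_s (w u h h' h'') : (ν.D a b d hab (hbc.trans hcd)).s w u h =
    (ν.D a b c hab hbc).s ((ν.D a c d (hab.trans hbc) hcd).s w (ν.l b c d hbc hcd u) h')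
      (ν.m b c d hbc hcd u) h'' := by
  have e1 := ν.r_l b c d hbc hcd u
  have e2 := ν.r_m b c d hbc hcd u
  have e3 := ν.j_lm b c d hbc hcd u
  have h1 : (ν.E c d hcd).r (ν.l b c d hbc hcd u) =
      (ν.D b c d hbc hcd).z ((ν.D a b d hab (hbc.trans hcd)).z w) := e1.trans (by rw [h])
  have h2 := e2.trans (ν.s_congr b c d hbc hcd h rfl _ h1)
  have h3 := (ν.j_congr b c d hbc hcd h rfl rfl _ h1 _ h2).symm.trans e3
  have := (ν.distCoc a b c d hab hbc hcd).ss w _ h1 h' _ h2 h'' ((ν.D b c d hbc hcd).r_j _ _ _ _ _)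
  exact (ν.s_congr a b d hab (hbc.trans hcd) rfl h3.symm _ _).trans this

/-- An element of `a → d` is determined by its components in `a → b`, `b → c` and `c → d`, which can
be computed in two ways. -/
lemma lm_lm (u) : ν.l a c d (hab.trans hbc) hcd u =
      ν.l b c d hbc hcd (ν.l a b d hab (hbc.trans hcd) u) ∧
    ν.l a b c hab hbc (ν.m a c d (hab.trans hbc) hcd u) =
      ν.m b c d hbc hcd (ν.l a b d hab (hbc.trans hcd) u) ∧
    ν.m a b c hab hbc (ν.m a c d (hab.trans hbc) hcd u) = ν.m a b d hab (hbc.trans hcd) u := by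
  obtain ⟨w, v, e2, t, e2', e1⟩ :
      ∃ w v h t ht, (ν.D a b d hab (hbc.trans hcd)).j w v h t ht = u :=
    ⟨_, _, _, _, _, ν.j_lm a b d hab (hbc.trans hcd) u⟩
  obtain ⟨W, y, e4, x, e4', e3⟩ : ∃ W y h x hx, (ν.D b c d hbc hcd).j W y h x hx = v :=
    ⟨_, _, _, _, _, ν.j_lm b c d hbc hcd v⟩
  obtain ⟨h5, h6⟩ := ν.lm_eq a b d hab (hbc.trans hcd) e1
  obtain ⟨h7, h8⟩ := ν.lm_eq b c d hbc hcd e3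
  rw [h5, h6, h7, h8]
  subst e3
  have hW := (ν.D b c d hbc hcd).r_j W y e4 x e4'
  obtain rfl : W = _ := hW.symm.trans e2
  have H := ν.distCoc a b c d hab hbc hcd
  have h' := e4.trans (H.zz w)
  have hx' := e4'.trans (H.sz w y e4 h')
  have ht' := e2'.trans (H.ss w y e4 h' x e4' hx' hW)
  have hj' := (ν.D a b c hab hbc).r_j _ _ hx' _ ht'
  obtain ⟨h1, h2⟩ := ν.lm_eq a c d (hab.trans hbc) hcd
    ((H.jj w y e4 h' x e4' hx' hW t e2' ht' hj').symm.trans e1)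
  obtain ⟨h3, h4⟩ := ν.lm_eq a b c hab hbc h2.symm
  exact ⟨h1, h3, h4⟩

lemma l_l (u) : ν.l b c d hbc hcd (ν.l a b d hab (hbc.trans hcd) u) =
    ν.l a c d (hab.trans hbc) hcd u :=
  (ν.lm_lm a b c d hab hbc hcd u).1.symm

lemma l_m (u) : ν.l a b c hab hbc (ν.m a c d (hab.trans hbc) hcd u) =
    ν.m b c d hbc hcd (ν.l a b d hab (hbc.trans hcd) u) :=
  (ν.lm_lm a b c d hab hbc hcd u).2.1

lemma m_m (u) : ν.m a b c hab hbc (ν.m a c d (hab.trans hbc) hcd u) =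
    ν.m a b d hab (hbc.trans hcd) u :=
  (ν.lm_lm a b c d hab hbc hcd u).2.2

end abcd

/-- The value of the canonical diagram of a simplex of the nerve at the index `(a, [b, c])`: the
pairs of an element `w` of `V` for the edge `a → c` and an element `u` of `U` for the edge `b → c`
which lie over the same element of `V` for the edge `b → c`. -/
abbrev K (t : DistIdx n) : Type :=
  FibProd (ν.E t.b t.c t.hbc).r (ν.D t.a t.b t.c t.hab t.hbc).z

variable {ν} in
/-- The transition maps of the canonical diagram. -/
noncomputable def Kmap {s : DistIdx n} (t : DistIdx n) (p : ν.K s) (h : s ≤ t) : ν.K t :=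
  have hac : s.a ≤ t.c := h.1.trans (t.hab.trans t.hbc)
  have hbc : s.b ≤ t.c := h.2.1.trans t.hbc
  have h1 : (ν.E t.c s.c h.2.2).r (ν.l s.b t.c s.c hbc h.2.2 p.u) =
      (ν.D s.a t.c s.c hac h.2.2).z p.w := by
    rw [r_l, p.h, z_z]
  ⟨(ν.D s.a t.a t.c h.1 (t.hab.trans t.hbc)).z
      ((ν.D s.a t.c s.c hac h.2.2).s p.w (ν.l s.b t.c s.c hbc h.2.2 p.u) h1),
    ν.l s.b t.b t.c h.2.1 t.hbc (ν.m s.b t.c s.c hbc h.2.2 p.u), by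
    have h2 : (ν.E t.c s.c h.2.2).r (ν.l s.b t.c s.c hbc h.2.2 p.u) =
        (ν.D s.b t.c s.c hbc h.2.2).z ((ν.D s.a s.b s.c s.hab s.hbc).z p.w) := by
      rw [h1, z_z]
    change (ν.E t.b t.c t.hbc).r (ν.l s.b t.b t.c h.2.1 t.hbc _) = (ν.D t.a t.b t.c _ _).z _
    rw [r_l, r_m, z_z, ν.s_congr _ _ _ _ _ p.h rfl _ h2,
      ν.s_z _ _ _ _ s.hab hbc h.2.2 _ _ _ h1, z_z]⟩

end NSimplex

namespace NSimplex

variable {n : ℕ} (ν : NSimplex n)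

lemma Kmap_refl (s : DistIdx n) (p : ν.K s) : Kmap s p le_rfl = p := by
  refine FibProd.ext ?_ ?_
  · exact (ν.z_self _ _ _ _).trans (ν.s_self _ _ _ _ _ _)
  · exact (ν.l_self _ _ _ _).trans (ν.m_self _ _ _ _)

lemma Kmap_comp {s t u : DistIdx n} (h : s ≤ t) (h' : t ≤ u) (p : ν.K s) :
    Kmap u (Kmap t p h) h' = Kmap u p (h.trans h') := by
  obtain ⟨a, b, c, hab, hbc⟩ := s
  obtain ⟨a', b', c', hab', hbc'⟩ := t
  obtain ⟨a'', b'', c'', hab'', hbc''⟩ := u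
  obtain ⟨h1, h2, h3⟩ := h
  obtain ⟨h1', h2', h3'⟩ := h'
  dsimp only at h1 h2 h3 h1' h2' h3'
  obtain ⟨w, u, hp⟩ := p
  dsimp only at w u hp
  have hl : ν.l b' c'' c' (h2'.trans hbc'') h3' (ν.l b b' c' h2 hbc'
      (ν.m b c' c (h2.trans hbc') h3 u)) =
      ν.m c'' c' c h3' h3 (ν.l b c'' c (h2.trans (h2'.trans hbc'')) (h3'.trans h3) u) := by
    rw [l_l, l_m]
  have e0 : (ν.E c'' c (h3'.trans h3)).r
      (ν.l b c'' c (h2.trans (h2'.trans hbc'')) (h3'.trans h3) u) =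
      (ν.D a c'' c (h1.trans (h1'.trans (hab''.trans hbc''))) (h3'.trans h3)).z w := by
    rw [r_l, hp, z_z]
  have e1 : (ν.E c' c h3).r (ν.l b c' c (h2.trans hbc') h3 u) =
      (ν.D a c' c (h1.trans (hab'.trans hbc')) h3).z w := by
    rw [r_l, hp, z_z]
  have e3 : (ν.E c'' c' h3').r
      (ν.m c'' c' c h3' h3 (ν.l b c'' c (h2.trans (h2'.trans hbc'')) (h3'.trans h3) u)) =
      (ν.D a c'' c' (h1.trans (h1'.trans (hab''.trans hbc''))) h3').z
        ((ν.D a c' c (h1.trans (hab'.trans hbc')) h3).s w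
          (ν.l b c' c (h2.trans hbc') h3 u) e1) := by
    rw [r_m, ← ν.s_z a c'' c' c _ h3' h3 w _ (by rw [e1, z_z]) e1]
    exact ν.s_congr _ _ _ _ _ e0 (by rw [l_l]) _ _
  refine FibProd.ext ?_ ?_
  · have main : ∀ hE, (ν.D a' a'' c'' h1' (hab''.trans hbc'')).z
        ((ν.D a' c'' c' (h1'.trans (hab''.trans hbc'')) h3').s
        ((ν.D a a' c' h1 (hab'.trans hbc')).z ((ν.D a c' c (h1.trans (hab'.trans hbc')) h3).s w
          (ν.l b c' c (h2.trans hbc') h3 u) e1)) (ν.l b' c'' c' (h2'.trans hbc'') h3'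
            (ν.l b b' c' h2 hbc' (ν.m b c' c (h2.trans hbc') h3 u))) hE) =
      (ν.D a a'' c'' (h1.trans h1') (hab''.trans hbc'')).z
        ((ν.D a c'' c (h1.trans (h1'.trans (hab''.trans hbc''))) (h3'.trans h3)).s w
        (ν.l b c'' c (h2.trans (h2'.trans hbc'')) (h3'.trans h3) u) e0) := by
      intro hE
      rw [ν.s_congr _ _ _ _ _ rfl hl _ (by rw [e3, z_z]),
        ν.s_z a a' c'' c' h1 (h1'.trans (hab''.trans hbc'')) h3' _ _ _ e3, z_z,
        ν.s_s a c'' c' c _ h3' h3 w _ e0 (by rw [l_l, e1])]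
      · congr 1
        exact ν.s_congr _ _ _ _ _ (ν.s_congr _ _ _ _ _ rfl (by rw [l_l]) _ _) rfl _ _
      · rw [e3]
        congr 1
        exact ν.s_congr _ _ _ _ _ rfl (by rw [l_l]) _ _
    exact main _
  · change ν.l b' b'' c'' h2' hbc'' (ν.m b' c'' c' _ h3' (ν.l b b' c' h2 hbc'
      (ν.m b c' c (h2.trans hbc') h3 u))) = ν.l b b'' c'' (h2.trans h2') hbc''
        (ν.m b c'' c (h2.trans (h2'.trans hbc'')) (h3'.trans h3) u)
    rw [← ν.l_m b b' c'' c' h2 (h2'.trans hbc'') h3', l_l, m_m]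

section

variable {a b c a' b' c' : Fin (n + 1)} {hab : a ≤ b} {hbc : b ≤ c} {hab' : a' ≤ b'}
  {hbc' : b' ≤ c} {hbc'' : b ≤ c'} (p : ν.K ⟨a, b, c, hab, hbc⟩)

lemma Kmap_left_w (h) : (Kmap ⟨a', b', c, hab', hbc'⟩ p h).w =
    (ν.D a a' c h.1 (hab'.trans hbc')).z p.w :=
  congrArg (ν.D a a' c h.1 (hab'.trans hbc')).z (ν.s_self _ _ _ _ _ _)

lemma Kmap_left_u (h) : (Kmap ⟨a', b', c, hab', hbc'⟩ p h).u = ν.l b b' c h.2.1 hbc' p.u :=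
  congrArg (ν.l b b' c h.2.1 hbc') (ν.m_self _ _ _ _)

lemma Kmap_right_w (h) : (Kmap ⟨a, b, c', hab, hbc''⟩ p h).w =
    (ν.D a c' c (hab.trans hbc'') h.2.2).s p.w (ν.l b c' c hbc'' h.2.2 p.u)
      (by rw [r_l, p.h, z_z]) :=
  ν.z_self _ _ _ _

lemma Kmap_right_u (h) : (Kmap ⟨a, b, c', hab, hbc''⟩ p h).u = ν.m b c' c hbc'' h.2.2 p.u :=
  ν.l_self _ _ _ _

lemma Kmap_right_self_w (h) : (Kmap ⟨a, b, b, hab, le_rfl⟩ p h).w =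
    (ν.D a b c hab hbc).s p.w p.u p.h := by
  rw [Kmap_right_w]
  exact ν.s_congr _ _ _ _ _ rfl (ν.l_self _ _ _ _) _ _

end

lemma K_row (a i k j l : Fin (n + 1)) (hai : a ≤ i) (hik : i ≤ k) (hkj : k ≤ j) (hjl : j ≤ l)
    (x : ν.K (.mk a i j)) (y : ν.K (.mk a k l)) (h1 h2)
    (hxy : Kmap (.mk a k j) x h1 = Kmap (.mk a k j) y h2) (h3 h4) :
    ∃! w : ν.K (.mk a i l), Kmap (.mk a i j) w h3 = x ∧ Kmap (.mk a k l) w h4 = y := by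
  have hxy1 := congrArg FibProd.w hxy
  have hxy2 := congrArg FibProd.u hxy
  rw [Kmap_left_w, Kmap_right_w, z_self] at hxy1
  rw [Kmap_left_u, Kmap_right_u] at hxy2
  obtain ⟨w1, u1, hu1⟩ := x
  obtain ⟨w2, u2, hu2⟩ := y
  dsimp only at hxy1 hxy2 w1 w2 u1 u2 hu1 hu2
  have e1 : (ν.E k l (hkj.trans hjl)).r u2 = (ν.D i k l hik (hkj.trans hjl)).z
      ((ν.D a i l hai (hik.trans (hkj.trans hjl))).z w2) := by rw [hu2, z_z]
  have e2 : (ν.E j l hjl).r (ν.l k j l hkj hjl u2) = (ν.D i j l (hik.trans hkj) hjl).z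
      ((ν.D a i l hai (hik.trans (hkj.trans hjl))).z w2) := by rw [r_l, hu2, z_z, z_z]
  have e3 : (ν.D i j l (hik.trans hkj) hjl).s
      ((ν.D a i l hai (hik.trans (hkj.trans hjl))).z w2) (ν.l k j l hkj hjl u2) e2 =
      (ν.D a i j hai (hik.trans hkj)).z w1 := by
    rw [hxy1, ν.s_z]
  obtain ⟨u, hr, hl, hm⟩ := ν.exists_U i k l hik (hkj.trans hjl)
    ((ν.D a i l hai (hik.trans (hkj.trans hjl))).z w2) u2 e1 (ν.m i k j hik hkj u1) (by
      have e4 : (ν.E k j hkj).r (ν.m k j l hkj hjl u2) =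
          (ν.D i k j hik hkj).z ((ν.D i j l (hik.trans hkj) hjl).s
            ((ν.D a i l hai (hik.trans (hkj.trans hjl))).z w2) (ν.l k j l hkj hjl u2) e2) := by
        rw [← hxy2, e3, r_l, hu1]
      rw [r_m, ν.s_s _ _ _ _ _ _ _ _ _ _ e2 e4]
      exact ν.s_congr _ _ _ _ _ (hu1.trans e3.symm) hxy2 _ _)
  have hu : ν.m i j l (hik.trans hkj) hjl u = u1 := by
    refine ν.U_ext i k j hik hkj ?_ ?_ ?_
    · rw [r_m, hu1, ← e3]
      exact ν.s_congr _ _ _ _ _ hr (by rw [← hl, l_l]) _ _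
    · rw [l_m, hl, hxy2]
    · rw [m_m, hm]
  refine ⟨⟨w2, u, hr⟩, ⟨FibProd.ext ?_ ?_, FibProd.ext ?_ ?_⟩, ?_⟩
  · rw [Kmap_right_w]
    refine Eq.trans ?_ hxy1.symm
    exact ν.s_congr _ _ _ _ _ rfl (by rw [← hl, l_l]) _ _
  · rw [Kmap_right_u]
    exact hu
  · rw [Kmap_left_w, z_self]
  · rw [Kmap_left_u]
    exact hl
  · rintro ⟨w', u', hu'⟩ ⟨h5, h6⟩
    have h7 := congrArg FibProd.u h6
    have h6 := congrArg FibProd.w h6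
    have h5 := congrArg FibProd.u h5
    rw [Kmap_right_u] at h5
    rw [Kmap_left_w, z_self] at h6
    rw [Kmap_left_u] at h7
    dsimp only at h5 h6 h7 hu' w' u'
    subst h6
    refine FibProd.ext rfl ?_
    refine ν.U_ext i k l hik (hkj.trans hjl) (hu'.trans hr.symm) (h7.trans hl.symm) ?_
    rw [hm, ← h5, m_m]

lemma K_pull (a a' b c : Fin (n + 1)) (ha : a ≤ a') (hab : a' ≤ b) (hbc : b ≤ c)
    (y : ν.K (.mk a' b c)) (β : ν.K (.mk a c c)) (h1 h2)
    (hy : Kmap (.mk a' c c) y h1 = Kmap (.mk a' c c) β h2) (h3 h4) :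
    ∃! e : ν.K (.mk a b c), Kmap (.mk a' b c) e h3 = y ∧ Kmap (.mk a c c) e h4 = β := by
  have hy1 := congrArg FibProd.w hy
  have hy2 := congrArg FibProd.u hy
  rw [Kmap_left_w, Kmap_left_w, z_self] at hy1
  rw [Kmap_left_u, Kmap_left_u, l_self] at hy2
  obtain ⟨w1, u1, hu1⟩ := y
  obtain ⟨w2, u2, hu2⟩ := β
  dsimp only at hy1 hy2 hu1 hu2 w1 w2 u1 u2
  refine ⟨⟨w2, u1, by rw [hu1, hy1, z_z]⟩, ⟨FibProd.ext ?_ ?_, FibProd.ext ?_ ?_⟩, ?_⟩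
  · rw [Kmap_left_w]
    exact hy1.symm
  · rw [Kmap_left_u, l_self]
  · rw [Kmap_left_w, z_self]
  · rw [Kmap_left_u]
    exact hy2
  · rintro ⟨w, u, hu⟩ ⟨h5, h6⟩
    have h5 := congrArg FibProd.u h5
    have h6 := congrArg FibProd.w h6
    rw [Kmap_left_u, l_self] at h5
    rw [Kmap_left_w, z_self] at h6
    exact FibProd.ext h6 h5

lemma K_sect (a a' b c : Fin (n + 1)) (ha : a ≤ a') (hab : a' ≤ b) (hbc : b ≤ c)
    (z : ν.K (.mk a' c c)) (h1 h2 h3 h4 h5 h6 h7)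
    (k : ∀ y : ν.K (.mk a' b c), Kmap (.mk a' c c) y h1 = z → ν.K (.mk a b b))
    (hk : ∀ y h, Kmap (.mk a' b b) (k y h) h2 = Kmap (.mk a' b b) y h3) :
    ∃! β : ν.K (.mk a c c), Kmap (.mk a' c c) β h4 = z ∧
        ∀ (e : ν.K (.mk a b c)) y hy, Kmap (.mk a c c) e h5 = β →
          Kmap (.mk a' b c) e h6 = y → Kmap (.mk a b b) e h7 = k y hy := by
  obtain ⟨w1, u1, hu1⟩ := z
  dsimp only at hu1 w1 u1
  -- an element of the fibre over `z` is given by an element of the edge from `b` to `c`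
  have hz : ∀ (u : (ν.E b c hbc).U) (hu : (ν.E b c hbc).r u = (ν.D a' b c hab hbc).z w1),
      Kmap (.mk a' c c) (⟨w1, u, hu⟩ : ν.K (.mk a' b c)) h1 = ⟨w1, u1, hu1⟩ := by
    intro u hu
    refine FibProd.ext ?_ ((ν.r_self_bijective c).1 ?_)
    · rw [Kmap_left_w, z_self]
    · rw [Kmap_left_u, r_l, hu1, hu, z_z]
  have hk' : ∀ u hu, (ν.D a a' b ha hab).z (k ⟨w1, u, hu⟩ (hz u hu)).w =
      (ν.D a' b c hab hbc).s w1 u hu := by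
    intro u hu
    have := congrArg FibProd.w (hk ⟨w1, u, hu⟩ (hz u hu))
    rw [Kmap_left_w, Kmap_right_self_w] at this
    exact this
  have key : ∀ w, (ν.D a b c (ha.trans hab) hbc).z w = (ν.D a' b c hab hbc).z w1 →
      (∀ u hu hu', (ν.D a b c (ha.trans hab) hbc).s w u hu =
        (k ⟨w1, u, hu'⟩ (hz u hu')).w) →
      (ν.D a a' c ha (hab.trans hbc)).z w = w1 := by
    intro w hw hs
    refine (ν.D a' b c hab hbc).zs_inj _ _ (by rw [z_z, hw]) fun u h h' => ?_
    rw [ν.s_z _ _ _ _ _ _ _ _ _ _ (by rw [h', hw]), hs u _ h', hk']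
  obtain ⟨w, hw, hs⟩ := (ν.D a b c (ha.trans hab) hbc).zs_surj ((ν.D a' b c hab hbc).z w1)
    (fun u hu => (k ⟨w1, u, hu⟩ (hz u hu)).w) fun u hu => by
      rw [← (ν.D a a' b ha hab).q_z, hk', (ν.D a' b c hab hbc).q_s]
  have hw' : (ν.D a a' c ha (hab.trans hbc)).z w = w1 := key w hw fun u hu hu' => hs u hu
  refine ⟨⟨w, u1, by rw [hu1, ← hw', z_z]⟩, ⟨FibProd.ext ?_ ?_, ?_⟩, ?_⟩
  · rw [Kmap_left_w]
    exact hw'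
  · rw [Kmap_left_u, l_self]
  · rintro ⟨w2, u2, hu2⟩ y hy h8 rfl
    have h8 := congrArg FibProd.w h8
    rw [Kmap_left_w, z_self] at h8
    dsimp only at h8 w2 u2 hu2
    subst h8
    have hu2' : (ν.E b c hbc).r u2 = (ν.D a' b c hab hbc).z w1 := hu2.trans hw
    have e1 : Kmap (.mk a' b c) (⟨w2, u2, hu2⟩ : ν.K (.mk a b c)) h6 = ⟨w1, u2, hu2'⟩ := by
      refine FibProd.ext ?_ ?_
      · rw [Kmap_left_w]
        exact hw'
      · rw [Kmap_left_u, l_self]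
    have e2 : k _ hy = k ⟨w1, u2, hu2'⟩ (hz u2 hu2') := by
      congr 1
    rw [e2]
    have e3 : (Kmap (.mk a b b) (⟨w2, u2, hu2⟩ : ν.K (.mk a b c)) h7).w =
        (k ⟨w1, u2, hu2'⟩ (hz u2 hu2')).w := by
      rw [Kmap_right_self_w]
      exact hs u2 hu2
    refine FibProd.ext e3 ((ν.r_self_bijective b).1 ?_)
    exact (Kmap _ _ _).h.trans ((congrArg _ e3).trans (k _ _).h.symm)
  · rintro ⟨w2, u2, hu2⟩ ⟨h8, h9⟩
    have h10 := congrArg FibProd.u h8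
    have h8 := congrArg FibProd.w h8
    rw [Kmap_left_u, l_self] at h10
    rw [Kmap_left_w] at h8
    refine FibProd.ext ?_ h10
    dsimp only at h8 w2 u2 hu2
    have e1 : (ν.D a b c (ha.trans hab) hbc).z w2 = (ν.D a' b c hab hbc).z w1 := by
      rw [← h8, z_z]
    refine (ν.D a b c (ha.trans hab) hbc).zs_inj _ _ (e1.trans hw.symm) fun u h h' => ?_
    rw [hs u h']
    have := h9 ⟨w2, u, h⟩ ⟨w1, u, h.trans e1⟩ (hz _ _) ?_ ?_
    · have := congrArg FibProd.w this
      rw [Kmap_right_self_w] at this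
      exact this
    · refine FibProd.ext ?_ ((ν.r_self_bijective c).1 ?_)
      · rw [Kmap_left_w, z_self]
      · rw [Kmap_left_u, hu2, r_l, h, z_z]
    · refine FibProd.ext ?_ ?_
      · rw [Kmap_left_w]
        exact h8
      · rw [Kmap_left_u, l_self]

/-- The canonical simplex of `RSpan` over a simplex of the nerve. -/
noncomputable def canonical : RSimplex n where
  obj t := FintypeCat.of (ν.K t)
  m t x h := Kmap t x h
  m_refl := ν.Kmap_refl
  m_comp := ν.Kmap_comp
  row a i k j l h1 h2 h3 h4 x y h := ν.K_row a i k j l h1 h2 h3 h4 x y _ _ h _ _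
  pull a a' b c h1 h2 h3 y β h := ν.K_pull a a' b c h1 h2 h3 y β _ _ h _ _
  sect a a' b c h1 h2 h3 z k hk := ν.K_sect a a' b c h1 h2 h3 z _ _ _ _ _ _ _ k hk

end NSimplex

/-! ### Lifting simplices along the projection to the nerve -/

namespace RSimplex

variable {n : ℕ}

/-- Transport of a simplex of `RSpan` along bijections. -/
def transport (R : RSimplex n) (P : ∀ t, Σ Y : FinSet, Y ≃ R.obj t) : RSimplex n where
  obj t := (P t).1
  m t x h := (P t).2.symm (R.m t ((P _).2 x) h)
  m_refl s x := by rw [R.m_refl, Equiv.symm_apply_apply]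
  m_comp h h' x := by rw [Equiv.apply_symm_apply, R.m_comp]
  row a i k j l h1 h2 h3 h4 x y hxy := by
    obtain ⟨w, ⟨hw1, hw2⟩, hw⟩ := R.row a i k j l h1 h2 h3 h4 _ _
      ((P (.mk a k j)).2.symm.injective hxy)
    refine ⟨(P _).2.symm w, ⟨?_, ?_⟩, ?_⟩
    · simp only [Equiv.apply_symm_apply, hw1, Equiv.symm_apply_apply]
    · simp only [Equiv.apply_symm_apply, hw2, Equiv.symm_apply_apply]
    · rintro w' ⟨h5, h6⟩
      rw [Equiv.eq_symm_apply]
      exact hw _ ⟨(Equiv.symm_apply_eq _).mp h5, (Equiv.symm_apply_eq _).mp h6⟩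
  pull a a' b c h1 h2 h3 y β h := by
    obtain ⟨e, ⟨he1, he2⟩, he⟩ := R.pull a a' b c h1 h2 h3 _ _
      ((P (.mk a' c c)).2.symm.injective h)
    refine ⟨(P _).2.symm e, ⟨?_, ?_⟩, ?_⟩
    · simp only [Equiv.apply_symm_apply, he1, Equiv.symm_apply_apply]
    · simp only [Equiv.apply_symm_apply, he2, Equiv.symm_apply_apply]
    · rintro e' ⟨h5, h6⟩
      rw [Equiv.eq_symm_apply]
      exact he _ ⟨(Equiv.symm_apply_eq _).mp h5, (Equiv.symm_apply_eq _).mp h6⟩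
  sect a a' b c h1 h2 h3 z k hk := by
    obtain ⟨β, ⟨hβ1, hβ2⟩, hβ⟩ := R.sect a a' b c h1 h2 h3 ((P _).2 z)
      (fun y hy => (P _).2 (k ((P _).2.symm y) ((Equiv.symm_apply_eq _).mpr (by
        rw [Equiv.apply_symm_apply]
        exact hy)))) (by
      intro y hy
      have := hk ((P _).2.symm y) ((Equiv.symm_apply_eq _).mpr (by
        rw [Equiv.apply_symm_apply]
        exact hy))
      rw [Equiv.symm_apply_eq] at this
      exact this.trans (by rw [Equiv.apply_symm_apply, Equiv.apply_symm_apply]))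
    refine ⟨(P _).2.symm β, ⟨?_, ?_⟩, ?_⟩
    · simp only [Equiv.apply_symm_apply, hβ1, Equiv.symm_apply_apply]
    · intro e y hy h4 h5
      have h4' := (P _).2.symm.injective h4
      have := hβ2 _ ((P _).2 y) ((Equiv.symm_apply_eq _).mp hy) h4' ((Equiv.symm_apply_eq _).mp h5)
      rw [Equiv.symm_apply_eq, this]
      simp only [Equiv.symm_apply_apply]
    · rintro β' ⟨h4, h5⟩
      rw [Equiv.eq_symm_apply]
      refine hβ _ ⟨(Equiv.symm_apply_eq _).mp h4, fun e y hy h6 h7 => ?_⟩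
      have := h5 ((P _).2.symm e) ((P _).2.symm y) ((Equiv.symm_apply_eq _).mpr (by
        rw [Equiv.apply_symm_apply]
        exact hy)) ((Equiv.symm_apply_eq _).mpr (by
        rw [Equiv.apply_symm_apply]
        exact h6)) (by rw [Equiv.apply_symm_apply, h7])
      rw [Equiv.symm_apply_eq, Equiv.apply_symm_apply] at this
      exact this

lemma ext_m {R R' : RSimplex n} (ho : R.obj = R'.obj)
    (hm : ∀ s t (h : s ≤ t) x x', HEq x x' → HEq (R.m (s := s) t x h) (R'.m (s := s) t x' h)) :
    R = R' := by
  obtain ⟨obj, m, _, _, _, _, _⟩ := R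
  obtain ⟨obj', m', _, _, _, _, _⟩ := R'
  obtain rfl : obj = obj' := ho
  obtain rfl : @m = @m' := by
    funext s t x h
    exact eq_of_heq (hm s t h x x HEq.rfl)
  rfl

variable (R : RSimplex n)

lemma toNerve_lm (a b c : Fin (n + 1)) (hab : a ≤ b) (hbc : b ≤ c) (u : R.obj (.mk a a c)) :
    R.toNerve.l a b c hab hbc u = R.m (.mk b b c) u ∧
      R.toNerve.m a b c hab hbc u = R.m (.mk a a b) u := by
  have h1 : R.m (.mk b c c) (R.m (.mk b b c) u) = R.m (.mk b c c) (R.m (.mk a c c) u) := by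
    rw [R.m_comp, R.m_comp]
  have h2 := R.s_eq a b c hab hbc h1 (R.m (.mk a b c) u) (R.m_comp _ _ _) (R.m_comp _ _ _)
  exact R.toNerve.lm_eq a b c hab hbc (R.j_eq a b c hab hbc h1 (by rw [h2, R.m_comp, R.m_comp])
    u rfl rfl rfl)

/-- The comparison of a simplex of `RSpan` with the canonical one over the same simplex of the
nerve. -/
def toK (t : DistIdx n) (x : R.obj t) : R.toNerve.K t where
  w := R.m ⟨t.a, t.c, t.c, t.hab.trans t.hbc, le_rfl⟩ x ⟨le_rfl, t.hbc, le_rfl⟩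
  u := R.m ⟨t.b, t.b, t.c, le_rfl, t.hbc⟩ x ⟨t.hab, le_rfl, le_rfl⟩
  h := (R.m_comp _ _ _).trans (R.m_comp _ _ _).symm

lemma toK_bijective (t : DistIdx n) : Function.Bijective (R.toK t) := by
  obtain ⟨a, b, c, hab, hbc⟩ := t
  constructor
  · intro x y h
    exact R.mid_unique a b c hab hbc x y (congrArg FibProd.w h) (congrArg FibProd.u h)
  · rintro ⟨w, u, h⟩
    obtain ⟨e, h1, h2⟩ := R.exists_mid a b c hab hbc w u h
    exact ⟨e, FibProd.ext h1 h2⟩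

lemma Kmap_toK {s : DistIdx n} (t : DistIdx n) (x : R.obj s) (h : s ≤ t) :
    NSimplex.Kmap t (R.toK s x) h = R.toK t (R.m t x h) := by
  obtain ⟨a, b, c, hab, hbc⟩ := s
  obtain ⟨a', b', c', hab', hbc'⟩ := t
  obtain ⟨h1, h2, h3⟩ := h
  dsimp only at h1 h2 h3
  refine FibProd.ext ?_ ?_
  · have e1 := (R.toNerve_lm b c' c (h2.trans hbc') h3 (R.m (.mk b b c) x)).1
    have e2 : ∀ u (hu : u = R.m (.mk c' c' c) (R.m (.mk b b c) x)) h',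
        R.m (.mk a' c' c') (R.s a c' c (h1.trans (hab'.trans hbc')) h3 (R.m (.mk a c c) x) u h') =
          R.m (.mk a' c' c') (R.m (.mk a' b' c') x) := by
      rintro _ rfl h'
      rw [R.s_eq a c' c _ h3 h' (R.m (.mk a c' c) x) (R.m_comp _ _ _)
        (by rw [R.m_comp, R.m_comp]), R.m_comp, R.m_comp, R.m_comp]
    exact e2 _ e1 _
  · have e1 := (R.toNerve_lm b c' c (h2.trans hbc') h3 (R.m (.mk b b c) x)).2
    have e2 := (R.toNerve_lm b b' c' h2 hbc' (R.m (.mk b b c') (R.m (.mk b b c) x))).1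
    refine (congrArg (R.toNerve.l b b' c' h2 hbc') e1).trans (e2.trans ?_)
    refine (R.m_comp _ _ _).trans ((R.m_comp _ _ _).trans (R.m_comp _ _ _).symm)

/-- The values of a simplex of `RSpan`, seen as sets in bijection with the values of the canonical
simplex. -/
noncomputable def pair {ν : NSimplex n} (h : R.toNerve = ν) (t : DistIdx n) :
    Σ Y : FinSet, Y ≃ ν.canonical.obj t :=
  h ▸ ⟨R.obj t, Equiv.ofBijective (R.toK t) (R.toK_bijective t)⟩

lemma transport_pair {ν : NSimplex n} (h : R.toNerve = ν) :
    ν.canonical.transport (R.pair h) = R := by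
  subst h
  refine ext_m rfl ?_
  intro s t h x x' hx
  obtain rfl := eq_of_heq hx
  apply heq_of_eq
  refine (congrArg (Equiv.ofBijective (R.toK t) (R.toK_bijective t)).symm
    (R.Kmap_toK t x h)).trans ?_
  exact Equiv.symm_apply_apply (Equiv.ofBijective (R.toK t) (R.toK_bijective t)) _

lemma pair_map {m : ℕ} {ν : NSimplex n} (h : R.toNerve = ν) (f : Fin (m + 1) →o Fin (n + 1))
    {ν' : NSimplex m} (h' : (R.map f).toNerve = ν') (t : DistIdx m) :
    HEq ((R.map f).pair h' t) (R.pair h (t.map f)) := by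
  subst h
  subst h'
  rfl

end RSimplex

/-- An identity map. In contrast to an equation with `id`, this makes sense for a map between
sets which are not known to be equal. -/
inductive IsId : ∀ {Y Z : FinSet}, (Y → Z) → Prop where
  | refl (Z : FinSet) : IsId (id : Z → Z)

lemma IsId.of_eq {Z : FinSet} {f : Z → Z} (h : ∀ z, f z = z) : IsId f := by
  obtain rfl : f = id := funext h
  exact IsId.refl Z

/-- Two triangles are equal if there is an isomorphism between them whose components are
identities. -/
lemma Tri.eq_of_isId {X0 X1 X2 X0' X1' X2' : FinSet} {E01 : Bispan X0 X1} {E12 : Bispan X1 X2}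
    {E02 : Bispan X0 X2} {E01' : Bispan X0' X1'} {E12' : Bispan X1' X2'} {E02' : Bispan X0' X2'}
    (D : Dist E01 E12 E02) (D' : Dist E01' E12' E02')
    (x0 : X0 → X0') (x1 : X1 → X1') (x2 : X2 → X2')
    (u01 : E01.U → E01'.U) (u12 : E12.U → E12'.U) (u02 : E02.U → E02'.U)
    (v01 : E01.V → E01'.V) (v12 : E12.V → E12'.V) (v02 : E02.V → E02'.V)
    (hx0 : IsId x0) (hx1 : IsId x1) (hx2 : IsId x2) (hu01 : IsId u01) (hu12 : IsId u12)
    (hu02 : IsId u02) (hv01 : IsId v01) (hv12 : IsId v12) (hv02 : IsId v02)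
    (f01 : ∀ u, x0 (E01.f u) = E01'.f (u01 u)) (f12 : ∀ u, x1 (E12.f u) = E12'.f (u12 u))
    (f02 : ∀ u, x0 (E02.f u) = E02'.f (u02 u))
    (r01 : ∀ u, v01 (E01.r u) = E01'.r (u01 u)) (r12 : ∀ u, v12 (E12.r u) = E12'.r (u12 u))
    (r02 : ∀ u, v02 (E02.r u) = E02'.r (u02 u))
    (q01 : ∀ u, x1 (E01.q u) = E01'.q (v01 u)) (q12 : ∀ u, x2 (E12.q u) = E12'.q (v12 u))
    (q02 : ∀ u, x2 (E02.q u) = E02'.q (v02 u))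
    (hz : ∀ w, v12 (D.z w) = D'.z (v02 w))
    (hs : ∀ w u h h', v01 (D.s w u h) = D'.s (v02 w) (u12 u) h')
    (hj : ∀ w u h x hx h' hx',
      u02 (D.j w u h x hx) = D'.j (v02 w) (u12 u) h' (u01 x) hx') :
    (⟨_, _, _, _, _, _, D.toTwoCell⟩ : Tri) = ⟨_, _, _, _, _, _, D'.toTwoCell⟩ := by
  obtain ⟨U01, V01, f01_, r01_, q01_⟩ := E01
  obtain ⟨U12, V12, f12_, r12_, q12_⟩ := E12
  obtain ⟨U02, V02, f02_, r02_, q02_⟩ := E02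
  obtain ⟨U01', V01', f01', r01', q01'⟩ := E01'
  obtain ⟨U12', V12', f12', r12', q12'⟩ := E12'
  obtain ⟨U02', V02', f02', r02', q02'⟩ := E02'
  dsimp only at *
  cases hx0
  cases hx1
  cases hx2
  cases hu01
  cases hu12
  cases hu02
  cases hv01
  cases hv12
  cases hv02
  obtain rfl : f01_ = f01' := funext f01
  obtain rfl : f12_ = f12' := funext f12
  obtain rfl : f02_ = f02' := funext f02
  obtain rfl : r01_ = r01' := funext r01
  obtain rfl : r12_ = r12' := funext r12
  obtain rfl : r02_ = r02' := funext r02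
  obtain rfl : q01_ = q01' := funext q01
  obtain rfl : q12_ = q12' := funext q12
  obtain rfl : q02_ = q02' := funext q02
  have : D.toTwoCell = D'.toTwoCell := Dist.toTwoCell_congr _ _ hz hs
    fun w u h h' x hx hx' => hj w u h x hx h' hx'
  rw [this]

lemma IsId.comp_q {X Y : FinSet} {E : Bispan X X} (hE : E = Bispan.id X) {f : Y → E.V}
    (hf : IsId f) : IsId fun y => E.q (f y) := by
  subst hE
  exact hf

lemma IsId.of_r {X : FinSet} {E : Bispan X X} (hE : E = Bispan.id X) {k : E.V → E.U}
    (hk : ∀ y, E.r (k y) = y) : IsId k := by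
  subst hE
  exact IsId.of_eq hk

namespace RSimplex

variable {n : ℕ}

section

variable (R : RSimplex n) (ν : NSimplex n) (e : ∀ t, R.obj t → ν.K t)
  (he : ∀ {s} (t) (x : R.obj s) (h : s ≤ t), e t (R.m t x h) = NSimplex.Kmap t (e s x) h)

include he in
/-- If the comparison of a simplex of `RSpan` with the canonical one is the identity on the
components of the edges, then the simplex lies over the given simplex of the nerve. -/
lemma toNerve_eq_of_isId
    (hV : ∀ t : DistIdx n, t.b = t.c →
      IsId (Z := (ν.E t.a t.c (t.hab.trans t.hbc)).V) fun y => (e t y).w)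
    (hU : ∀ t : DistIdx n, t.a = t.b →
      IsId (Z := (ν.E t.b t.c t.hbc).U) fun y => (e t y).u) :
    R.toNerve = ν := by
  have ht : ∀ a b c hab hbc, R.toNerve.tri a b c hab hbc = ν.tri a b c hab hbc := by
    intro a b c hab hbc
    have hx : ∀ a, IsId fun y : R.obj (.mk a a a) => (ν.E a a le_rfl).q (e (.mk a a a) y).w :=
      fun a => IsId.comp_q (ν.E_self a) (hV (.mk a a a) rfl)
    have hf : ∀ a b hab (u : R.obj (.mk a a b)), (ν.E a a le_rfl).q
        (e (.mk a a a) (R.m (.mk a a a) u)).w = (ν.E a b hab).f (e (.mk a a b) u).u := by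
      intro a b hab u
      rw [he, NSimplex.Kmap_right_self_w, (ν.D a a b le_rfl hab).q_s]
    have hr : ∀ a b hab (u : R.obj (.mk a a b)), (e (.mk a b b) (R.m (.mk a b b) u)).w =
        (ν.E a b hab).r (e (.mk a a b) u).u := by
      intro a b hab u
      rw [he, NSimplex.Kmap_left_w, (e (.mk a a b) u).h]
    have hq : ∀ a b hab (w : R.obj (.mk a b b)), (ν.E b b le_rfl).q
        (e (.mk b b b) (R.m (.mk b b b) w)).w = (ν.E a b hab).q (e (.mk a b b) w).w := by
      intro a b hab w
      rw [he, NSimplex.Kmap_left_w, (ν.D a b b hab le_rfl).q_z]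
    have := Tri.eq_of_isId (R.dist a b c hab hbc) (ν.D a b c hab hbc) _ _ _ _ _ _ _ _ _
      (hx a) (hx b) (hx c) (hU (.mk a a b) rfl) (hU (.mk b b c) rfl) (hU (.mk a a c) rfl)
      (hV (.mk a b b) rfl) (hV (.mk b c c) rfl) (hV (.mk a c c) rfl)
      (hf a b hab) (hf b c hbc) (hf a c _) (hr a b hab) (hr b c hbc) (hr a c _)
      (hq a b hab) (hq b c hbc) (hq a c _) ?_ ?_ ?_
    · refine this.trans ?_
      unfold NSimplex.D NSimplex.tri
      rw [TwoCell.toTwoCell_toDist]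
    · intro (w : R.obj (.mk a c c))
      change (e (.mk b c c) (R.m (.mk b c c) w)).w = _
      rw [he, NSimplex.Kmap_left_w]
    · intro w u h h'
      obtain ⟨x, h1, h2⟩ := R.exists_mid a b c hab hbc w u h
      change (e (.mk a b b) (R.s a b c hab hbc w u h)).w = _
      rw [R.s_eq a b c hab hbc h x h1 h2, he, NSimplex.Kmap_right_self_w]
      refine ν.s_congr a b c hab hbc ?_ ?_ _ _
      · rw [← h1, he, NSimplex.Kmap_left_w, NSimplex.z_self]
      · rw [← h2, he, NSimplex.Kmap_left_u, NSimplex.l_self]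
    · intro w u h x hx h' hx'
      obtain ⟨y, h1, h2, h3, h4⟩ := R.exists_join' a b c hab hbc w u h x hx
      change (e (.mk a a c) (R.j a b c hab hbc w u h x hx)).u = _
      rw [h4, ← ν.j_lm a b c hab hbc (e (.mk a a c) y).u]
      refine ν.j_congr a b c hab hbc ?_ ?_ ?_ _ _ _ _
      · rw [← h1, he, NSimplex.Kmap_left_w, (e (.mk a a c) y).h]
      · rw [← h2, he, NSimplex.Kmap_left_u]
      · rw [← h3, he, NSimplex.Kmap_right_u]
  exact NSimplex.ext_strict (fun a b h => congrArg Tri.d1 (ht a a b le_rfl h))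
    fun a b c hab hbc => ht a b c hab.le hbc.le

end

lemma isId_pair_w (R : RSimplex n) {ν : NSimplex n} (h : R.toNerve = ν) (t : DistIdx n)
    (ht : t.b = t.c) : IsId (Z := (ν.E t.a t.c (t.hab.trans t.hbc)).V)
      fun y => ((R.pair h t).2 y).w := by
  subst h
  obtain ⟨a, b, c, hab, hbc⟩ := t
  obtain rfl : b = c := ht
  exact IsId.of_eq fun y => R.m_refl _ y

lemma isId_pair_u (R : RSimplex n) {ν : NSimplex n} (h : R.toNerve = ν) (t : DistIdx n)
    (ht : t.a = t.b) : IsId (Z := (ν.E t.b t.c t.hbc).U) fun y => ((R.pair h t).2 y).u := by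
  subst h
  obtain ⟨a, b, c, hab, hbc⟩ := t
  obtain rfl : a = b := ht
  exact IsId.of_eq fun y => R.m_refl _ y

end RSimplex

lemma NSimplex.K_w_bijective {n : ℕ} (ν : NSimplex n) (t : DistIdx n) (h : t.b = t.c) :
    Function.Bijective fun p : ν.K t => p.w := by
  obtain ⟨a, b, c, hab, hbc⟩ := t
  obtain rfl : b = c := h
  constructor
  · rintro ⟨w, u, h⟩ ⟨w', u', h'⟩ hw
    obtain rfl : w = w' := hw
    exact FibProd.ext rfl ((ν.r_self_bijective b).1 (h.trans h'.symm))
  · intro w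
    obtain ⟨u, hu⟩ := (ν.r_self_bijective b).2 ((ν.D a b b hab hbc).z w)
    exact ⟨⟨w, u, hu⟩, rfl⟩

lemma NSimplex.K_u_bijective {n : ℕ} (ν : NSimplex n) (t : DistIdx n) (h : t.a = t.b) :
    Function.Bijective fun p : ν.K t => p.u := by
  obtain ⟨a, b, c, hab, hbc⟩ := t
  obtain rfl : a = b := h
  constructor
  · rintro ⟨w, u, h⟩ ⟨w', u', h'⟩ hu
    obtain rfl : u = u' := hu
    refine FibProd.ext ?_ rfl
    have := h.symm.trans h'
    dsimp only at this
    rwa [ν.z_self, ν.z_self] at this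
  · intro u
    exact ⟨⟨(ν.E a c hbc).r u, u, (ν.z_self _ _ _ _).symm⟩, rfl⟩

/-- The values of a simplex of `RSpan` over a given simplex of the nerve can be chosen freely up to
bijection, except at the components of the edges. -/
lemma NSimplex.exists_pair {n : ℕ} (ν : NSimplex n) (t : DistIdx n) :
    ∃ p : Σ Y : FinSet, Y ≃ ν.canonical.obj t,
      (t.b = t.c → IsId (Z := (ν.E t.a t.c (t.hab.trans t.hbc)).V) fun y => (p.2 y).w) ∧
      (t.a = t.b → IsId (Z := (ν.E t.b t.c t.hbc).U) fun y => (p.2 y).u) := by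
  by_cases h : t.b = t.c
  · let e := Equiv.ofBijective _ (ν.K_w_bijective t h)
    refine ⟨⟨(ν.E t.a t.c (t.hab.trans t.hbc)).V, e.symm⟩, fun _ =>
      IsId.of_eq fun y => e.apply_symm_apply y, fun h' => ?_⟩
    have : ∀ y, (e.symm y).w = y := e.apply_symm_apply
    generalize e.symm = e' at *
    obtain ⟨a, b, c, hab, hbc⟩ := t
    dsimp only at h h'
    subst h'
    subst h
    refine IsId.of_r (ν.E_self a) fun y => ?_
    have e1 := (e' y).h.trans (ν.z_self _ _ _ _)
    exact e1.trans (this y)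
  by_cases h' : t.a = t.b
  · let e := Equiv.ofBijective _ (ν.K_u_bijective t h')
    exact ⟨⟨(ν.E t.b t.c t.hbc).U, e.symm⟩, fun h'' => absurd h'' h, fun _ =>
      IsId.of_eq fun y => e.apply_symm_apply y⟩
  · exact ⟨⟨FintypeCat.of (ν.K t), Equiv.refl _⟩, fun h'' => absurd h'' h,
      fun h'' => absurd h'' h'⟩

/-- The index `(0, [1, 2])`. -/
def DistIdx.top : DistIdx 2 := ⟨0, 1, 2, by decide, by decide⟩

lemma DistIdx.exists_map_top {n : ℕ} (t : DistIdx n) :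
    ∃ g : Fin 3 →o Fin (n + 1), DistIdx.top.map g = t := by
  obtain ⟨a, b, c, hab, hbc⟩ := t
  refine ⟨⟨![a, b, c], ?_⟩, rfl⟩
  intro i j hij
  have := hab.trans hbc
  fin_cases i <;> fin_cases j <;> simp_all

lemma DistIdx.ext_hom {n : ℕ} {g h : Fin 3 →o Fin (n + 1)}
    (H : DistIdx.top.map g = DistIdx.top.map h) : g = h := by
  refine OrderHom.ext _ _ (funext fun i => ?_)
  fin_cases i
  · exact congrArg DistIdx.a H
  · exact congrArg DistIdx.b H
  · exact congrArg DistIdx.c H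

/-- A simplex of the nerve together with compatible lifts of some of its faces to `RSpan` can be
lifted to `RSpan`. The lift is a transport of the canonical diagram. Its values at the indices in
one of the given faces are forced, and those at the other indices can be chosen, subject only to
giving the right edges. -/
theorem RSimplex.exists_lift {n : ℕ} (ν : NSimplex n) {ι : Type w} (m : ι → ℕ)
    (f : ∀ i, Fin (m i + 1) →o Fin (n + 1)) (σ : ∀ i, RSimplex (m i))
    (hσ : ∀ i, (σ i).toNerve = ν.map (f i))
    (compat : ∀ i j (g : Fin 3 →o Fin (m i + 1)) (h : Fin 3 →o Fin (m j + 1)),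
      (f i).comp g = (f j).comp h → (σ i).map g = (σ j).map h) :
    ∃ R : RSimplex n, R.toNerve = ν ∧ ∀ i, R.map (f i) = σ i := by
  have hA : ∀ i j (t' : DistIdx (m i)) (t'' : DistIdx (m j)), t'.map (f i) = t''.map (f j) →
      HEq ((σ i).pair (hσ i) t') ((σ j).pair (hσ j) t'') := by
    intro i j t' t'' h
    obtain ⟨g, rfl⟩ := t'.exists_map_top
    obtain ⟨g', rfl⟩ := t''.exists_map_top
    have e1 := compat i j g g' (DistIdx.ext_hom h)
    have e2 := (σ i).pair_map (hσ i) g rfl DistIdx.top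
    have e3 := (σ j).pair_map (hσ j) g' rfl DistIdx.top
    refine e2.symm.trans (HEq.trans ?_ e3)
    rw [e1]
  -- The components of the edges at an index in one of the faces belong to the same face, where they
  -- are prescribed by the simplex of the nerve.
  have key : ∀ t : DistIdx n, ∃ p : Σ Y : FinSet, Y ≃ ν.canonical.obj t,
      (∀ i (t' : DistIdx (m i)), t'.map (f i) = t → HEq ((σ i).pair (hσ i) t') p) ∧
      (t.b = t.c → IsId (Z := (ν.E t.a t.c (t.hab.trans t.hbc)).V) fun y => (p.2 y).w) ∧
      (t.a = t.b → IsId (Z := (ν.E t.b t.c t.hbc).U) fun y => (p.2 y).u) := by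
    intro t
    by_cases ht : ∃ (i : ι) (t' : DistIdx (m i)), t'.map (f i) = t
    · obtain ⟨i, t', rfl⟩ := ht
      have hV : ∀ (t : DistIdx n) (p : Σ Y : FinSet, Y ≃ ν.canonical.obj t) (t'' : DistIdx (m i))
          (_ : t''.b = t''.c) (_ : t''.map (f i) = t) (_ : HEq ((σ i).pair (hσ i) t'') p),
          IsId (Z := (ν.E t.a t.c (t.hab.trans t.hbc)).V) fun y => (p.2 y).w := by
        rintro _ _ t'' h rfl hp
        obtain rfl := eq_of_heq hp
        exact RSimplex.isId_pair_w _ _ _ h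
      have hU : ∀ (t : DistIdx n) (p : Σ Y : FinSet, Y ≃ ν.canonical.obj t) (t'' : DistIdx (m i))
          (_ : t''.a = t''.b) (_ : t''.map (f i) = t) (_ : HEq ((σ i).pair (hσ i) t'') p),
          IsId (Z := (ν.E t.b t.c t.hbc).U) fun y => (p.2 y).u := by
        rintro _ _ t'' h rfl hp
        obtain rfl := eq_of_heq hp
        exact RSimplex.isId_pair_u _ _ _ h
      refine ⟨(σ i).pair (hσ i) t', fun j t'' h => hA _ _ _ _ h, fun h => ?_, fun h => ?_⟩
      · have e : DistIdx.map (f i) ⟨t'.a, t'.c, t'.c, t'.hab.trans t'.hbc, le_rfl⟩ =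
            t'.map (f i) := DistIdx.ext rfl h.symm rfl
        exact hV _ _ _ rfl e (hA _ _ _ _ e)
      · have e : DistIdx.map (f i) ⟨t'.a, t'.a, t'.c, le_rfl, t'.hab.trans t'.hbc⟩ =
            t'.map (f i) := DistIdx.ext rfl h rfl
        exact hU _ _ _ rfl e (hA _ _ _ _ e)
    · obtain ⟨p, h1, h2⟩ := ν.exists_pair t
      exact ⟨p, fun i t' h => absurd ⟨i, t', h⟩ ht, h1, h2⟩
  choose P hP hV hU using key
  refine ⟨ν.canonical.transport P, ?_, fun i => ?_⟩
  · refine RSimplex.toNerve_eq_of_isId _ ν (fun t => (P t).2) ?_ hV hU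
    intro s t x h
    exact Equiv.apply_symm_apply _ _
  · rw [← (σ i).transport_pair (hσ i)]
    have : (σ i).pair (hσ i) = fun t : DistIdx (m i) => P (t.map (f i)) := by
      funext t
      exact eq_of_heq (hP _ i t rfl)
    rw [this]
    rfl

/-! ### Matching families of faces -/

/-- A family of simplices of `X`, indexed by some simplices `f i` of `Δ[n]`, any two of which agree
on the common faces of dimension `2`. -/
structure Matching (X : SSet.{1}) (n : ℕ) : Type 2 where
  ι : Type
  m : ι → ℕ
  f : ∀ i, ⦋m i⦌ ⟶ ⦋n⦌
  σ : ∀ i, X _⦋m i⦌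
  compat : ∀ i j (g : ⦋2⦌ ⟶ ⦋m i⦌) (h : ⦋2⦌ ⟶ ⦋m j⦌), g ≫ f i = h ≫ f j →
    X.map g.op (σ i) = X.map h.op (σ j)

namespace Matching

variable {X Y : SSet.{1}} {n : ℕ}

/-- A simplex with the given faces. -/
def IsFiller (F : Matching X n) (x : X _⦋n⦌) : Prop :=
  ∀ i, X.map (F.f i).op x = F.σ i

/-- The image of a family of faces under a map of simplicial sets. -/
def map (F : Matching X n) (p : X ⟶ Y) : Matching Y n where
  ι := F.ι
  m := F.m
  f := F.f
  σ i := p.app _ (F.σ i)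
  compat i j g h e := by
    rw [← NatTrans.naturality_apply, ← NatTrans.naturality_apply, F.compat i j g h e]

/-- The family of faces given by a map from a subcomplex of `Δ[n]`. -/
def ofSubcomplex (A : (Δ[n] : SSet.{1}).Subcomplex) (s : (A : SSet.{1}) ⟶ X) : Matching X n where
  ι := Σ m : ℕ, { f : ⦋m⦌ ⟶ ⦋n⦌ // SSet.stdSimplex.objEquiv.symm f ∈ A.obj (op ⦋m⦌) }
  m i := i.1
  f i := i.2.1
  σ i := s.app (op ⦋i.1⦌) ⟨SSet.stdSimplex.objEquiv.symm i.2.1, i.2.2⟩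
  compat i j g h e := by
    refine (NatTrans.naturality_apply s g.op _).symm.trans
      (Eq.trans ?_ (NatTrans.naturality_apply s h.op _))
    exact congrArg (s.app _) (Subtype.ext (congrArg SSet.stdSimplex.objEquiv.symm e))

lemma isFiller_ofSubcomplex_iff {A : (Δ[n] : SSet.{1}).Subcomplex} {s : (A : SSet.{1}) ⟶ X}
    {x : X _⦋n⦌} : (ofSubcomplex A s).IsFiller x ↔ A.ι ≫ SSet.yonedaEquiv.symm x = s := by
  constructor
  · intro h
    ext ⟨⟨m⟩⟩ ⟨y, hy⟩
    exact h ⟨m, SSet.stdSimplex.objEquiv y, hy⟩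
  · rintro rfl i
    rfl

lemma isFiller_ofSubcomplex_yonedaEquiv {A : (Δ[n] : SSet.{1}).Subcomplex}
    {s : (A : SSet.{1}) ⟶ X} {t : Δ[n] ⟶ X} :
    (ofSubcomplex A s).IsFiller (SSet.yonedaEquiv t) ↔ A.ι ≫ t = s := by
  rw [isFiller_ofSubcomplex_iff, Equiv.symm_apply_apply]

end Matching

/-- The lifting property against all families of faces. The families need not come from
subcomplexes, and their members need only agree on common faces of dimension `2`; this makes the
property easy to apply to the legs of cones. -/
def HasMatchingLift {X Y : SSet.{1}} (p : X ⟶ Y) : Prop :=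
  ∀ (n : ℕ) (F : Matching X n) (y : Y _⦋n⦌), (F.map p).IsFiller y →
    ∃ x, p.app _ x = y ∧ F.IsFiller x

lemma hasMatchingLift_ringSpansToNerve : HasMatchingLift ringSpansToNerve := by
  intro n F y hy
  obtain ⟨R, h1, h2⟩ := RSimplex.exists_lift y F.m (fun i => (F.f i).toOrderHom) F.σ
    (fun i => (hy i).symm) fun i j g h e =>
      F.compat i j (SimplexCategory.Hom.mk g) (SimplexCategory.Hom.mk h)
        (congrArg SimplexCategory.Hom.mk e)
  exact ⟨R, h1, h2⟩

lemma HasMatchingLift.hasLiftingProperty {X Y : SSet.{1}} {p : X ⟶ Y} (hp : HasMatchingLift p)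
    {n : ℕ} (A : (Δ[n] : SSet.{1}).Subcomplex) : HasLiftingProperty A.ι p where
  sq_hasLift {s t} sq := by
    obtain ⟨x, h1, h2⟩ := hp n (Matching.ofSubcomplex A s) (SSet.yonedaEquiv t)
      ((Matching.isFiller_ofSubcomplex_yonedaEquiv (s := s ≫ p)).mpr sq.w.symm)
    refine ⟨⟨⟨SSet.yonedaEquiv.symm x, Matching.isFiller_ofSubcomplex_iff.mp h2, ?_⟩⟩⟩
    rw [SSet.yonedaEquiv_symm_comp, h1, Equiv.symm_apply_apply]

lemma HasMatchingLift.isAcyclicKan {X Y : SSet.{1}} {p : X ⟶ Y} (hp : HasMatchingLift p) :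
    IsAcyclicKan p :=
  fun _ => hp.hasLiftingProperty _

lemma HasMatchingLift.quasicategory {X Y : SSet.{1}} {p : X ⟶ Y} (hp : HasMatchingLift p)
    [hY : SSet.Quasicategory Y] : SSet.Quasicategory X where
  hornFilling' n i s h0 hn := by
    obtain ⟨t, ht⟩ := hY.hornFilling' (s ≫ p) h0 hn
    have := hp.hasLiftingProperty (Λ[n + 2, i] : (Δ[n + 2] : SSet.{1}).Subcomplex)
    have sq : CommSq s Λ[n + 2, i].ι p t := ⟨ht⟩
    exact ⟨sq.lift, sq.fac_left.symm⟩

/-! ### Simplices of the nerve with given faces -/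

/-- The ordered map with the given values. -/
def hom3 {n : ℕ} (a b c : Fin (n + 1)) (hab : a ≤ b) (hbc : b ≤ c) : ⦋2⦌ ⟶ ⦋n⦌ :=
  SimplexCategory.Hom.mk ⟨![a, b, c], by
    have := hab.trans hbc
    intro i j hij
    fin_cases i <;> fin_cases j <;> simp_all⟩

lemma hom3_comp {m n : ℕ} (f : ⦋m⦌ ⟶ ⦋n⦌) (a b c : Fin (m + 1)) (hab : a ≤ b) (hbc : b ≤ c) :
    hom3 a b c hab hbc ≫ f = hom3 (f.toOrderHom a) (f.toOrderHom b) (f.toOrderHom c)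
      (f.toOrderHom.monotone hab) (f.toOrderHom.monotone hbc) := by
  refine SimplexCategory.Hom.ext _ _ (OrderHom.ext _ _ (funext fun i => ?_))
  fin_cases i <;> rfl

lemma NSimplex.tri_congr {n : ℕ} (ν : NSimplex n) {a b c a' b' c' : Fin (n + 1)} (ha : a = a')
    (hb : b = b') (hc : c = c') (h1 h2 h1' h2') : ν.tri a b c h1 h2 = ν.tri a' b' c' h1' h2' := by
  subst ha hb hc
  rfl

namespace Matching

variable {n : ℕ} (F : Matching bispanNerve n)

/-- A member of a family of faces of the nerve, as a simplex of the nerve. -/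
def simplex (i : F.ι) : NSimplex (F.m i) := F.σ i

lemma tri_eq {i j : F.ι} {a b c : Fin (F.m i + 1)} {a' b' c' : Fin (F.m j + 1)}
    (ha : (F.f i).toOrderHom a = (F.f j).toOrderHom a')
    (hb : (F.f i).toOrderHom b = (F.f j).toOrderHom b')
    (hc : (F.f i).toOrderHom c = (F.f j).toOrderHom c') (hab hbc hab' hbc') :
    (F.simplex i).tri a b c hab hbc = (F.simplex j).tri a' b' c' hab' hbc' := by
  have := F.compat i j (hom3 a b c hab hbc) (hom3 a' b' c' hab' hbc') (by
    rw [hom3_comp, hom3_comp]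
    congr 1)
  exact congrArg (fun ν : NSimplex 2 => ν.tri 0 1 2 (by decide) (by decide)) this

lemma edge_eq {i j : F.ι} {a b : Fin (F.m i + 1)} {a' b' : Fin (F.m j + 1)}
    (ha : (F.f i).toOrderHom a = (F.f j).toOrderHom a')
    (hb : (F.f i).toOrderHom b = (F.f j).toOrderHom b') (hab hab') :
    (F.simplex i).edge a b hab = (F.simplex j).edge a' b' hab' :=
  congrArg Tri.d0 (F.tri_eq ha ha hb le_rfl hab le_rfl hab')

lemma edge_eq_id {i : F.ι} {a b : Fin (F.m i + 1)}
    (h : (F.f i).toOrderHom a = (F.f i).toOrderHom b) (hab) :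
    (F.simplex i).edge a b hab = Edge.id ((F.simplex i).x a) :=
  (F.edge_eq (j := i) (a' := a) (b' := a) rfl h.symm hab le_rfl).trans (NSimplex.edge_self _ _)

theorem exists_isFiller_of_edges (x : Fin (n + 1) → FinSet)
    (e : ∀ a b : Fin (n + 1), a ≤ b → Edge)
    (t : ∀ a b c : Fin (n + 1), a < b → b < c → Tri)
    (hself : ∀ a, e a a le_rfl = Edge.id (x a))
    (hX : ∀ a b h, (e a b h).X = x a) (hY : ∀ a b h, (e a b h).Y = x b)
    (he : ∀ i a b h, (F.simplex i).edge a b h =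
      e ((F.f i).toOrderHom a) ((F.f i).toOrderHom b) ((F.f i).toOrderHom.monotone h))
    (ht : ∀ i a b c hab hbc hab' hbc', t ((F.f i).toOrderHom a) ((F.f i).toOrderHom b)
      ((F.f i).toOrderHom c) hab hbc = (F.simplex i).tri a b c hab' hbc')
    (h2 : ∀ a b c hab hbc, (t a b c hab hbc).d2 = e a b hab.le)
    (h0 : ∀ a b c hab hbc, (t a b c hab hbc).d0 = e b c hbc.le)
    (h1 : ∀ a b c hab hbc, (t a b c hab hbc).d1 = e a c (hab.trans hbc).le)
    (h3 : ∀ a b c d (hab : a < b) (hbc : b < c) (hcd : c < d),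
      Tetra (t b c d hbc hcd) (t a c d (hab.trans hbc) hcd) (t a b d hab (hbc.trans hcd))
        (t a b c hab hbc)) :
    ∃ ν : NSimplex n, F.IsFiller ν ∧ (∀ a b h, ν.edge a b h = e a b h) ∧
      ∀ a b c (hab : a < b) (hbc : b < c), ν.tri a b c hab.le hbc.le = t a b c hab hbc := by
  obtain ⟨ν, hν, hνt⟩ := NSimplex.exists_of_strict x e t hself hX hY h2 h0 h1 h3
  refine ⟨ν, fun k => ?_, hν, hνt⟩
  change ν.map (F.f k).toOrderHom = F.simplex k
  refine NSimplex.ext_strict (fun a b h => (hν _ _ _).trans (he _ _ _ _).symm) ?_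
  intro a b c hab hbc
  rcases ((F.f k).toOrderHom.monotone hab.le).eq_or_lt with h | h
  · rw [F.tri_eq (j := k) (a' := a) (b' := a) (c' := c) rfl h.symm rfl _ _ le_rfl
      (hab.trans hbc).le]
    refine (ν.tri_congr rfl h.symm rfl _ _ le_rfl
      ((F.f k).toOrderHom.monotone (hab.trans hbc).le)).trans ?_
    refine (ν.deg0 _ _ _).trans (Eq.trans ?_ ((F.simplex k).deg0 _ _ _).symm)
    exact congrArg Edge.deg0 ((hν _ _ _).trans (he _ _ _ _).symm)
  rcases ((F.f k).toOrderHom.monotone hbc.le).eq_or_lt with h' | h'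
  · rw [F.tri_eq (j := k) (a' := a) (b' := b) (c' := b) rfl rfl h'.symm _ _ hab.le le_rfl]
    refine (ν.tri_congr rfl rfl h'.symm _ _ ((F.f k).toOrderHom.monotone hab.le) le_rfl).trans ?_
    refine (ν.deg1 _ _ _).trans (Eq.trans ?_ ((F.simplex k).deg1 _ _ _).symm)
    exact congrArg Edge.deg1 ((hν _ _ _).trans (he _ _ _ _).symm)
  exact (hνt _ _ _ h h').trans (ht _ _ _ _ _ _ _ _)

/-- Every edge of `Δ[n]` lies in one of the faces of the family. -/
def CoversEdges : Prop :=
  ∀ a b : Fin (n + 1), a ≤ b → ∃ i a' b', ∃ _ : a' ≤ b', (F.f i).toOrderHom a' = a ∧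
    (F.f i).toOrderHom b' = b

/-- The triangle `a b c` of `Δ[n]` lies in one of the faces of the family. -/
def CoversTri (a b c : Fin (n + 1)) : Prop :=
  ∃ i a' b' c', ∃ (_ : a' ≤ b') (_ : b' ≤ c'), (F.f i).toOrderHom a' = a ∧
    (F.f i).toOrderHom b' = b ∧ (F.f i).toOrderHom c' = c

/-- The tetrahedron `a b c d` of `Δ[n]` lies in one of the faces of the family. -/
def CoversTetra (a b c d : Fin (n + 1)) : Prop :=
  ∃ i a' b' c' d', ∃ (_ : a' ≤ b') (_ : b' ≤ c') (_ : c' ≤ d'), (F.f i).toOrderHom a' = a ∧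
    (F.f i).toOrderHom b' = b ∧ (F.f i).toOrderHom c' = c ∧ (F.f i).toOrderHom d' = d

/-- The triangles `t` extend those of the faces of the family. -/
def Extends (t : ∀ a b c : Fin (n + 1), a < b → b < c → Tri) : Prop :=
  ∀ i a b c hab hbc hab' hbc', t ((F.f i).toOrderHom a) ((F.f i).toOrderHom b)
    ((F.f i).toOrderHom c) hab hbc = (F.simplex i).tri a b c hab' hbc'

/-- The edges `e` extend those of the faces of the family. -/
def ExtendsEdges (e : ∀ a b : Fin (n + 1), a ≤ b → Edge) : Prop :=
  ∀ i a b h, (F.simplex i).edge a b h =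
    e ((F.f i).toOrderHom a) ((F.f i).toOrderHom b) ((F.f i).toOrderHom.monotone h)

/-- The triangles `t` have the edges `e`. -/
def FitsEdges (e : ∀ a b : Fin (n + 1), a ≤ b → Edge) (a b c : Fin (n + 1)) (hab : a < b)
    (hbc : b < c) (T : Tri) : Prop :=
  T.d2 = e a b hab.le ∧ T.d1 = e a c (hab.trans hbc).le ∧ T.d0 = e b c hbc.le

lemma exists_extendsEdges (he : F.CoversEdges) : ∃ e, F.ExtendsEdges e := by
  choose i a' b' hab' ha' hb' using he
  exact ⟨fun a b h => (F.simplex (i a b h)).edge (a' a b h) (b' a b h) (hab' a b h),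
    fun _ _ _ _ => F.edge_eq (ha' _ _ _).symm (hb' _ _ _).symm _ _⟩

variable {F} in
lemma ExtendsEdges.X_eq {e : ∀ a b : Fin (n + 1), a ≤ b → Edge} (he : F.ExtendsEdges e)
    (hc : F.CoversEdges) (a b : Fin (n + 1)) (h : a ≤ b) : (e a b h).X = (e a a le_rfl).X := by
  obtain ⟨i, a', b', h1, rfl, rfl⟩ := hc a b h
  rw [← he i a' a' le_rfl, ← he i a' b' h1]
  rfl

variable {F} in
lemma ExtendsEdges.Y_eq {e : ∀ a b : Fin (n + 1), a ≤ b → Edge} (he : F.ExtendsEdges e)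
    (hc : F.CoversEdges) (a b : Fin (n + 1)) (h : a ≤ b) : (e a b h).Y = (e b b le_rfl).X := by
  obtain ⟨i, a', b', h1, rfl, rfl⟩ := hc a b h
  rw [← he i b' b' le_rfl, ← he i a' b' h1]
  rfl

/-- The triangles of the faces can be extended by `T` to the triangles not contained in any face. -/
lemma exists_extends (T : Tri) : ∃ t, F.Extends t ∧
    ∀ a b c hab hbc, ¬ F.CoversTri a b c → t a b c hab hbc = T := by
  have : ∀ a b c : Fin (n + 1), a < b → b < c → ∃ T', (¬ F.CoversTri a b c → T' = T) ∧
      ∀ i a' b' c' hab hbc, (F.f i).toOrderHom a' = a → (F.f i).toOrderHom b' = b →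
        (F.f i).toOrderHom c' = c → T' = (F.simplex i).tri a' b' c' hab hbc := by
    intro a b c _ _
    by_cases h : F.CoversTri a b c
    · obtain ⟨i, a', b', c', h1, h2, rfl, rfl, rfl⟩ := id h
      exact ⟨(F.simplex i).tri a' b' c' h1 h2, fun h' => absurd h h', fun j x y z _ _ hx hy hz =>
        F.tri_eq hx.symm hy.symm hz.symm _ _ _ _⟩
    · exact ⟨T, fun _ => rfl, fun i a' b' c' h1 h2 hx hy hz =>
        absurd ⟨i, a', b', c', h1, h2, hx, hy, hz⟩ h⟩
  choose t h h' using this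
  exact ⟨t, fun i a b c _ _ _ _ => h' _ _ _ _ _ i a b c _ _ rfl rfl rfl, h⟩

/-- A simplex of the nerve with given faces exists, provided that the given faces contain all
edges and that the missing triangles are chosen so as to satisfy the cocycle condition. -/
theorem exists_isFiller (hc : F.CoversEdges) {e : ∀ a b : Fin (n + 1), a ≤ b → Edge}
    (he : F.ExtendsEdges e) (t : ∀ a b c : Fin (n + 1), a < b → b < c → Tri) (ht : F.Extends t)
    (hf : ∀ a b c hab hbc, FitsEdges e a b c hab hbc (t a b c hab hbc))
    (h3 : ∀ a b c d (hab : a < b) (hbc : b < c) (hcd : c < d),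
      Tetra (t b c d hbc hcd) (t a c d (hab.trans hbc) hcd) (t a b d hab (hbc.trans hcd))
        (t a b c hab hbc)) :
    ∃ ν : NSimplex n, F.IsFiller ν ∧
      ∀ a b c (hab : a < b) (hbc : b < c), ν.tri a b c hab.le hbc.le = t a b c hab hbc := by
  obtain ⟨ν, h, -, h'⟩ := F.exists_isFiller_of_edges (fun a => (e a a le_rfl).X) e t
    (fun a => by
      obtain ⟨i, a', b', h1, rfl, h2⟩ := hc a a le_rfl
      rw [← he i a' a' le_rfl, NSimplex.edge_self]
      rfl)
    (he.X_eq hc) (he.Y_eq hc) he ht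
    (fun a b c _ _ => (hf a b c _ _).1) (fun a b c _ _ => (hf a b c _ _).2.2)
    (fun a b c _ _ => (hf a b c _ _).2.1) h3
  exact ⟨ν, h, h'⟩

variable {F}

lemma Extends.tetra {t : ∀ a b c : Fin (n + 1), a < b → b < c → Tri} (ht : F.Extends t)
    {a b c d : Fin (n + 1)} (h : F.CoversTetra a b c d) (hab : a < b) (hbc : b < c) (hcd : c < d) :
    Tetra (t b c d hbc hcd) (t a c d (hab.trans hbc) hcd) (t a b d hab (hbc.trans hcd))
      (t a b c hab hbc) := by
  obtain ⟨i, a', b', c', d', h1, h2, h3, rfl, rfl, rfl, rfl⟩ := h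
  rw [ht i a' b' c' hab hbc h1 h2, ht i a' b' d' _ _ h1 (h2.trans h3),
    ht i a' c' d' _ _ (h1.trans h2) h3, ht i b' c' d' _ _ h2 h3]
  exact (F.simplex i).tetra _ _ _ _ _ _ _

lemma Extends.fitsEdges {t : ∀ a b c : Fin (n + 1), a < b → b < c → Tri} (ht : F.Extends t)
    {e : ∀ a b : Fin (n + 1), a ≤ b → Edge} (he : F.ExtendsEdges e)
    {a b c : Fin (n + 1)} (h : F.CoversTri a b c) (hab : a < b) (hbc : b < c) :
    FitsEdges e a b c hab hbc (t a b c hab hbc) := by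
  obtain ⟨i, a', b', c', h1, h2, rfl, rfl, rfl⟩ := h
  rw [ht i a' b' c' hab hbc h1 h2]
  exact ⟨he _ _ _ _, he _ _ _ _, he _ _ _ _⟩

/-- A simplex of the nerve with given faces exists, provided that the given faces contain all
edges and all triangles, and satisfy the cocycle condition also for the tetrahedra which they do
not contain. -/
theorem exists_isFiller_of_coversTri (hc : F.CoversEdges)
    (hc' : ∀ a b c, a < b → b < c → F.CoversTri a b c)
    (h3 : ∀ t, F.Extends t → ∀ a b c d (hab : a < b) (hbc : b < c) (hcd : c < d),
      F.CoversTetra a b c d ∨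
      Tetra (t b c d hbc hcd) (t a c d (hab.trans hbc) hcd) (t a b d hab (hbc.trans hcd))
        (t a b c hab hbc)) :
    ∃ ν : NSimplex n, F.IsFiller ν := by
  obtain ⟨e, he⟩ := F.exists_extendsEdges hc
  obtain ⟨t, ht, -⟩ := F.exists_extends (e 0 0 le_rfl).deg0
  obtain ⟨ν, h, -⟩ := F.exists_isFiller hc he t ht
    (fun a b c hab hbc => ht.fitsEdges he (hc' a b c hab hbc) hab hbc)
    fun a b c d hab hbc hcd => (h3 _ ht a b c d hab hbc hcd).elim
      (fun h => ht.tetra h hab hbc hcd) id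
  exact ⟨ν, h⟩

lemma IsFiller.tri {ν : NSimplex n} (h : F.IsFiller ν) (i : F.ι) (a b c : Fin (F.m i + 1))
    (hab : a ≤ b) (hbc : b ≤ c) :
    ν.tri ((F.f i).toOrderHom a) ((F.f i).toOrderHom b) ((F.f i).toOrderHom c)
      ((F.f i).toOrderHom.monotone hab) ((F.f i).toOrderHom.monotone hbc) =
      (F.simplex i).tri a b c hab hbc :=
  congrArg (fun ν : NSimplex (F.m i) => ν.tri a b c hab hbc) (h i)

lemma IsFiller.edge {ν : NSimplex n} (h : F.IsFiller ν) (i : F.ι) (a b : Fin (F.m i + 1))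
    (hab : a ≤ b) :
    ν.edge ((F.f i).toOrderHom a) ((F.f i).toOrderHom b) ((F.f i).toOrderHom.monotone hab) =
      (F.simplex i).edge a b hab :=
  congrArg (fun ν : NSimplex (F.m i) => ν.edge a b hab) (h i)

lemma IsFiller.tri_eq {ν ν' : NSimplex n} (h : F.IsFiller ν) (h' : F.IsFiller ν')
    {a b c : Fin (n + 1)} (hc : F.CoversTri a b c) (hab : a ≤ b) (hbc : b ≤ c) :
    ν.tri a b c hab hbc = ν'.tri a b c hab hbc := by
  obtain ⟨i, a', b', c', h1, h2, rfl, rfl, rfl⟩ := hc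
  exact (h.tri i _ _ _ h1 h2).trans (h'.tri i _ _ _ h1 h2).symm

lemma IsFiller.eq {ν ν' : NSimplex n} (h : F.IsFiller ν) (h' : F.IsFiller ν')
    (he : F.CoversEdges)
    (ht : ∀ a b c (hab : a < b) (hbc : b < c), F.CoversTri a b c ∨
      ν.tri a b c hab.le hbc.le = ν'.tri a b c hab.le hbc.le) : ν = ν' := by
  refine NSimplex.ext_strict (fun a b hab => ?_) fun a b c hab hbc =>
    (ht a b c hab hbc).elim (fun hc => h.tri_eq h' hc _ _) id
  obtain ⟨i, a', b', h1, rfl, rfl⟩ := he a b hab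
  exact (h.edge i _ _ h1).trans (h'.edge i _ _ h1).symm

variable (F) in
/-- The `j`-th face of `Δ[n]` belongs to the family. -/
def HasFace (j : Fin (n + 1)) : Prop :=
  ∃ i, StrictMono (F.f i).toOrderHom ∧ ∀ a, a ≠ j → ∃ a', (F.f i).toOrderHom a' = a

lemma HasFace.coversTetra {j : Fin (n + 1)} (h : F.HasFace j) {a b c d : Fin (n + 1)}
    (hab : a ≤ b) (hbc : b ≤ c) (hcd : c ≤ d) (ha : j ≠ a) (hb : j ≠ b) (hc : j ≠ c)
    (hd : j ≠ d) : F.CoversTetra a b c d := by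
  obtain ⟨i, hi, h⟩ := h
  obtain ⟨a', rfl⟩ := h a ha.symm
  obtain ⟨b', rfl⟩ := h b hb.symm
  obtain ⟨c', rfl⟩ := h c hc.symm
  obtain ⟨d', rfl⟩ := h d hd.symm
  exact ⟨i, a', b', c', d', hi.le_iff_le.mp hab, hi.le_iff_le.mp hbc, hi.le_iff_le.mp hcd, rfl, rfl,
    rfl, rfl⟩

lemma HasFace.coversTri {j : Fin (n + 1)} (h : F.HasFace j) {a b c : Fin (n + 1)}
    (hab : a ≤ b) (hbc : b ≤ c) (ha : j ≠ a) (hb : j ≠ b) (hc : j ≠ c) : F.CoversTri a b c := by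
  obtain ⟨i, a', b', c', -, h1, h2, -, h3, h4, h5, -⟩ :=
    h.coversTetra hab hbc le_rfl ha hb hc hc
  exact ⟨i, a', b', c', h1, h2, h3, h4, h5⟩

lemma coversEdges_of_hasFace (h : ∀ a b : Fin (n + 1), ∃ j, F.HasFace j ∧ j ≠ a ∧ j ≠ b) :
    F.CoversEdges := by
  intro a b hab
  obtain ⟨j, h, ha, hb⟩ := h a b
  obtain ⟨i, a', b', -, h1, h2, h3, h4, -⟩ := h.coversTri hab le_rfl ha hb hb
  exact ⟨i, a', b', h1, h3, h4⟩

end Matching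

/-! ### The nerve is a `(2,1)`-category -/

namespace Tetra

variable {T123 T023 T013 T012 : Tri}

lemma d1_012 (h : Tetra T123 T023 T013 T012) : T012.d1 = T023.d2 := by
  cases h
  rfl

lemma d0_123 (h : Tetra T123 T023 T013 T012) : T123.d0 = T023.d0 := by
  cases h
  rfl

lemma d1_013 (h : Tetra T123 T023 T013 T012) : T013.d1 = T023.d1 := by
  cases h
  rfl

lemma d2_012 (h : Tetra T123 T023 T013 T012) : T012.d2 = T013.d2 := by
  cases h
  rfl

lemma d1_123 (h : Tetra T123 T023 T013 T012) : T123.d1 = T013.d0 := by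
  cases h
  rfl

end Tetra

lemma exists_ne_of_card_lt {n : ℕ} (s : Finset (Fin n)) (h : s.card < n) : ∃ j, j ∉ s := by
  by_contra! h'
  have := Finset.card_le_card (s := Finset.univ) (t := s) fun j _ => h' j
  rw [Finset.card_univ, Fintype.card_fin] at this
  lia

lemma exists_ne_of_lt {n : ℕ} (hn : 3 < n) (a b c : Fin n) : ∃ j, j ≠ a ∧ j ≠ b ∧ j ≠ c := by
  obtain ⟨j, hj⟩ := exists_ne_of_card_lt {a, b, c} (Finset.card_le_three.trans_lt hn)
  exact ⟨j, by simpa using hj⟩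

lemma exists_ne_of_lt' {n : ℕ} (hn : 4 < n) (a b c d : Fin n) :
    ∃ j, j ≠ a ∧ j ≠ b ∧ j ≠ c ∧ j ≠ d := by
  obtain ⟨j, hj⟩ := exists_ne_of_card_lt {a, b, c, d} (Finset.card_le_four.trans_lt hn)
  exact ⟨j, by simpa using hj⟩

lemma exists_ne_of_lt'' {n : ℕ} (hn : 5 < n) (a b c d e : Fin n) :
    ∃ j, j ≠ a ∧ j ≠ b ∧ j ≠ c ∧ j ≠ d ∧ j ≠ e := by
  obtain ⟨j, hj⟩ := exists_ne_of_card_lt {a, b, c, d, e} (Finset.card_le_five.trans_lt hn)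
  exact ⟨j, by simpa using hj⟩

namespace Matching

/-- The faces of a family cover the horn `Λ[n, i]`. -/
structure IsHorn {n : ℕ} (F : Matching bispanNerve n) (i : Fin (n + 1)) : Prop where
  hasFace : ∀ j, j ≠ i → F.HasFace j
  ne : ∀ k, ∃ j, j ≠ i ∧ ∀ a, (F.f k).toOrderHom a ≠ j

lemma isHorn_ofSubcomplex {n : ℕ} (i : Fin (n + 2))
    (s : (Λ[n + 1, i] : SSet.{1}) ⟶ bispanNerve) :
    IsHorn (ofSubcomplex Λ[n + 1, i] s) i where
  hasFace j hj := by
    refine ⟨⟨n, SimplexCategory.δ j, ?_⟩, Fin.strictMono_succAbove j, fun a ha =>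
      Fin.exists_succAbove_eq ha⟩
    rw [SSet.mem_horn_iff_notMem_range]
    refine ⟨j, hj, ?_⟩
    rintro ⟨a, ha⟩
    exact Fin.succAbove_ne j a ha
  ne k := by
    obtain ⟨m, f, hf⟩ := k
    rw [SSet.mem_horn_iff_notMem_range] at hf
    obtain ⟨j, hj, hf⟩ := hf
    exact ⟨j, hj, fun a ha => hf ⟨a, ha⟩⟩

section

variable {n : ℕ} {i : Fin (n + 1)} {F : Matching bispanNerve n}

lemma IsHorn.coversEdges (hF : F.IsHorn i) (hn : 2 < n) : F.CoversEdges :=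
  coversEdges_of_hasFace fun a b => by
    obtain ⟨j, hi, ha, hb⟩ := exists_ne_of_lt (Nat.succ_lt_succ hn) i a b
    exact ⟨j, hF.hasFace j hi, ha, hb⟩

end

lemma IsHorn.not_coversTri {F : Matching bispanNerve 3} {i : Fin 4} (hF : F.IsHorn i)
    {a b c : Fin 4} (h : ∀ j, j ≠ i → j = a ∨ j = b ∨ j = c) : ¬ F.CoversTri a b c := by
  rintro ⟨k, a', b', c', -, -, rfl, rfl, rfl⟩
  obtain ⟨j, hj, hk⟩ := hF.ne k
  rcases h j hj with h | h | h <;> exact hk _ h.symm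

/-- In dimension `2`, a filler is given by the composition of bispans. -/
lemma exists_isFiller_of_isHorn_two {F : Matching bispanNerve 2} (hF : F.IsHorn 1) :
    ∃ ν : NSimplex 2, F.IsFiller ν := by
  obtain ⟨k, hk, h⟩ := hF.hasFace 2 (by decide)
  obtain ⟨p0, h0⟩ := h 0 (by decide)
  obtain ⟨p1, h1⟩ := h 1 (by decide)
  obtain ⟨l, hl, h⟩ := hF.hasFace 0 (by decide)
  obtain ⟨q1, h1'⟩ := h 1 (by decide)
  obtain ⟨q2, h2⟩ := h 2 (by decide)
  have hp : p0 ≤ p1 := hk.le_iff_le.mp (by rw [h0, h1]; decide)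
  have hq : q1 ≤ q2 := hl.le_iff_le.mp (by rw [h1', h2]; decide)
  have hx : (F.simplex k).x p1 = (F.simplex l).x q1 := congrArg Edge.X
    (F.edge_eq (h1.trans h1'.symm) (h1.trans h1'.symm) le_rfl le_rfl)
  obtain ⟨T, hT2, hT0⟩ := exists_tri ((F.simplex k).edge p0 p1 hp)
    ((F.simplex l).edge q1 q2 hq) hx
  let x : Fin 3 → FinSet := ![(F.simplex k).x p0, (F.simplex k).x p1, (F.simplex l).x q2]
  let e : ∀ a b : Fin 3, a ≤ b → Edge := fun a b _ =>
    if a = b then Edge.id (x a) else if b = 1 then (F.simplex k).edge p0 p1 hp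
      else if a = 1 then (F.simplex l).edge q1 q2 hq else T.d1
  have hT : T.d1.X = (F.simplex k).x p0 := congrArg Edge.X hT2
  have hT' : T.d1.Y = (F.simplex l).x q2 := congrArg Edge.Y hT0
  have h012 : ∀ a b c : Fin 3, a < b → b < c → a = 0 ∧ b = 1 ∧ c = 2 := by decide
  have hlt : ∀ a b : Fin 3, a < b → a = 0 ∧ b = 1 ∨ a = 0 ∧ b = 2 ∨ a = 1 ∧ b = 2 := by decide
  have hne : ∀ a : Fin 3, a ≠ 1 → a = 0 ∨ a = 2 := by decide
  have hxe : ∀ i a, (F.simplex i).x a = x ((F.f i).toOrderHom a) := by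
    intro i a
    have h : (F.f i).toOrderHom a = 0 ∨ (F.f i).toOrderHom a = 1 ∨ (F.f i).toOrderHom a = 2 := by
      generalize (F.f i).toOrderHom a = b
      revert b
      decide
    rcases h with h | h | h <;> rw [h]
    · exact congrArg Edge.X (F.edge_eq (j := k) (a' := p0) (b' := p0) (h.trans h0.symm)
        (h.trans h0.symm) (le_refl a) le_rfl)
    · exact congrArg Edge.X (F.edge_eq (j := k) (a' := p1) (b' := p1) (h.trans h1.symm)
        (h.trans h1.symm) (le_refl a) le_rfl)
    · exact congrArg Edge.X (F.edge_eq (j := l) (a' := q2) (b' := q2) (h.trans h2.symm)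
        (h.trans h2.symm) (le_refl a) le_rfl)
  obtain ⟨ν, h, -⟩ := F.exists_isFiller_of_edges x e (fun _ _ _ _ _ => T)
    (fun a => if_pos rfl)
    (by
      intro a b h
      fin_cases a <;> fin_cases b <;> try exact (not_le_of_gt (by decide) h).elim
      exacts [rfl, rfl, hT, rfl, hx.symm, rfl])
    (by
      intro a b h
      fin_cases a <;> fin_cases b <;> try exact (not_le_of_gt (by decide) h).elim
      exacts [rfl, rfl, hT', rfl, rfl, rfl])
    (by
      intro i a b h
      have key : ∀ c d : Fin 3, (F.f i).toOrderHom a = c → (F.f i).toOrderHom b = d → ∀ h',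
          (F.simplex i).edge a b h = e c d h' := by
        intro c d hc hd h'
        by_cases hcd : c = d
        · subst hcd
          rw [F.edge_eq_id (hc.trans hd.symm), hxe, hc]
          exact (if_pos rfl).symm
        rcases hlt c d (lt_of_le_of_ne h' hcd) with ⟨rfl, rfl⟩ | ⟨rfl, rfl⟩ | ⟨rfl, rfl⟩
        · exact F.edge_eq (hc.trans h0.symm) (hd.trans h1.symm) _ _
        · obtain ⟨j, hj, hij⟩ := hF.ne i
          rcases hne j hj with rfl | rfl
          exacts [absurd hc (hij _), absurd hd (hij _)]
        · exact F.edge_eq (hc.trans h1'.symm) (hd.trans h2.symm) _ _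
      exact key ((F.f i).toOrderHom a) ((F.f i).toOrderHom b) rfl rfl
        ((F.f i).toOrderHom.monotone h))
    (by
      intro i a b c hab hbc
      obtain ⟨ha, -, hc⟩ := h012 _ _ _ hab hbc
      obtain ⟨j, hj, hij⟩ := hF.ne i
      rcases hne j hj with rfl | rfl
      exacts [absurd ha (hij _), absurd hc (hij _)])
    (by
      intro a b c hab hbc
      obtain ⟨rfl, rfl, rfl⟩ := h012 a b c hab hbc
      exact hT2)
    (by
      intro a b c hab hbc
      obtain ⟨rfl, rfl, rfl⟩ := h012 a b c hab hbc
      exact hT0)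
    (by
      intro a b c hab hbc
      obtain ⟨rfl, rfl, rfl⟩ := h012 a b c hab hbc
      rfl)
    (by
      intro a b c d hab hbc hcd
      have := h012 a b c hab hbc
      have := h012 b c d hbc hcd
      simp_all)
  exact ⟨ν, h⟩

lemma Extends.eq {n : ℕ} {F : Matching bispanNerve n}
    {t t' : ∀ a b c : Fin (n + 1), a < b → b < c → Tri} (ht : F.Extends t) (ht' : F.Extends t')
    {a b c : Fin (n + 1)} (h : F.CoversTri a b c) (hab : a < b) (hbc : b < c) :
    t a b c hab hbc = t' a b c hab hbc := by
  obtain ⟨i, a', b', c', h1, h2, rfl, rfl, rfl⟩ := h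
  rw [ht i a' b' c' hab hbc h1 h2, ht' i a' b' c' hab hbc h1 h2]

/-- In dimension `3`, a filler is obtained from a missing triangle which forms a tetrahedron with
the given ones. -/
lemma exists_isFiller_three {F : Matching bispanNerve 3} (hc : F.CoversEdges)
    {a b c : Fin 4} (hab : a < b) (hbc : b < c) (h : ¬ F.CoversTri a b c)
    (h' : ∀ a' b' c', a' < b' → b' < c' →
      a' = a ∧ b' = b ∧ c' = c ∨ F.CoversTri a' b' c')
    (hT : ∀ e t, F.ExtendsEdges e → F.Extends t → ∃ T, FitsEdges e a b c hab hbc T ∧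
      ∀ t' : ∀ a b c : Fin 4, a < b → b < c → Tri,
        (∀ a b c hab hbc, F.CoversTri a b c → t' a b c hab hbc = t a b c hab hbc) →
        t' a b c hab hbc = T →
        Tetra (t' 1 2 3 (by decide) (by decide)) (t' 0 2 3 (by decide) (by decide))
          (t' 0 1 3 (by decide) (by decide)) (t' 0 1 2 (by decide) (by decide))) :
    ∃ ν : NSimplex 3, F.IsFiller ν := by
  obtain ⟨e, he⟩ := F.exists_extendsEdges hc
  obtain ⟨t, ht, -⟩ := F.exists_extends (e 0 0 le_rfl).deg0
  obtain ⟨T, hTe, hT⟩ := hT e t he ht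
  obtain ⟨t', ht', h0⟩ := F.exists_extends T
  obtain ⟨ν, hν, -⟩ := F.exists_isFiller hc he t' ht'
    (by
      intro a' b' c' hab' hbc'
      rcases h' a' b' c' hab' hbc' with ⟨rfl, rfl, rfl⟩ | h'
      · rwa [h0 _ _ _ _ _ h]
      · exact ht'.fitsEdges he h' _ _)
    (by
      intro a' b' c' d' hab' hbc' hcd'
      obtain ⟨rfl, rfl, rfl, rfl⟩ : a' = 0 ∧ b' = 1 ∧ c' = 2 ∧ d' = 3 := by lia
      exact hT t' (fun _ _ _ _ _ hc => ht'.eq ht hc _ _) (h0 _ _ _ _ _ h))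
  exact ⟨ν, hν⟩

/-- In dimension `3`, three faces of a tetrahedron determine the missing one. -/
lemma exists_isFiller_of_isHorn_three {F : Matching bispanNerve 3} {i : Fin 4} (h0 : 0 < i)
    (h3 : i < 3) (hF : F.IsHorn i) : ∃ ν : NSimplex 3, F.IsFiller ν := by
  have hi : i = 1 ∨ i = 2 := by lia
  have hc := hF.coversEdges (by decide)
  have c1 : F.CoversTri 1 2 3 := (hF.hasFace 0 h0.ne).coversTri (by decide) (by decide)
    (by decide) (by decide) (by decide)
  have c0 : F.CoversTri 0 1 2 := (hF.hasFace 3 h3.ne').coversTri (by decide) (by decide)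
    (by decide) (by decide) (by decide)
  rcases hi with rfl | rfl
  · have c2 : F.CoversTri 0 1 3 := (hF.hasFace 2 (by decide)).coversTri (by decide) (by decide)
      (by decide) (by decide) (by decide)
    refine exists_isFiller_three (a := 0) (b := 2) (c := 3) hc (by decide) (by decide)
      (hF.not_coversTri (by decide)) (fun a b c hab hbc => ?_) fun e t he ht => ?_
    · have : a = 0 ∧ b = 2 ∧ c = 3 ∨ a = 1 ∧ b = 2 ∧ c = 3 ∨ a = 0 ∧ b = 1 ∧ c = 2 ∨
        a = 0 ∧ b = 1 ∧ c = 3 := by lia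
      rcases this with h | ⟨rfl, rfl, rfl⟩ | ⟨rfl, rfl, rfl⟩ | ⟨rfl, rfl, rfl⟩
      exacts [.inl h, .inr c1, .inr c0, .inr c2]
    obtain ⟨e12, e02, e01⟩ := ht.fitsEdges he c0 (by decide) (by decide)
    obtain ⟨e12', e02', e01'⟩ := ht.fitsEdges he c1 (by decide) (by decide)
    obtain ⟨e12'', e02'', e01''⟩ := ht.fitsEdges he c2 (by decide) (by decide)
    obtain ⟨T, hT⟩ := Tri.exists_tetra_023 (e01.trans e12'.symm) (e12.trans e12''.symm)
      (e02'.trans e01''.symm)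
    refine ⟨T, ⟨hT.d1_012.symm.trans e02, hT.d1_013.symm.trans e02'', hT.d0_123.symm.trans e01'⟩,
      fun t' h h' => ?_⟩
    rwa [h', h _ _ _ _ _ c0, h _ _ _ _ _ c1, h _ _ _ _ _ c2]
  · have c2 : F.CoversTri 0 2 3 := (hF.hasFace 1 (by decide)).coversTri (by decide) (by decide)
      (by decide) (by decide) (by decide)
    refine exists_isFiller_three (a := 0) (b := 1) (c := 3) hc (by decide) (by decide)
      (hF.not_coversTri (by decide)) (fun a b c hab hbc => ?_) fun e t he ht => ?_
    · have : a = 0 ∧ b = 1 ∧ c = 3 ∨ a = 1 ∧ b = 2 ∧ c = 3 ∨ a = 0 ∧ b = 1 ∧ c = 2 ∨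
        a = 0 ∧ b = 2 ∧ c = 3 := by lia
      rcases this with h | ⟨rfl, rfl, rfl⟩ | ⟨rfl, rfl, rfl⟩ | ⟨rfl, rfl, rfl⟩
      exacts [.inl h, .inr c1, .inr c0, .inr c2]
    obtain ⟨e12, e02, e01⟩ := ht.fitsEdges he c0 (by decide) (by decide)
    obtain ⟨e12', e02', e01'⟩ := ht.fitsEdges he c1 (by decide) (by decide)
    obtain ⟨e12'', e02'', e01''⟩ := ht.fitsEdges he c2 (by decide) (by decide)
    obtain ⟨T, hT⟩ := Tri.exists_tetra_013 (e01.trans e12'.symm) (e02.trans e12''.symm)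
      (e01'.trans e01''.symm)
    refine ⟨T, ⟨hT.d2_012.symm.trans e12, hT.d1_013.trans e02'', hT.d1_123.symm.trans e02'⟩,
      fun t' h h' => ?_⟩
    rwa [h', h _ _ _ _ _ c0, h _ _ _ _ _ c1, h _ _ _ _ _ c2]

/-- In dimension `4`, the horn contains all triangles, and the missing tetrahedron is given by the
pentagon identity. -/
lemma exists_isFiller_of_isHorn_four {F : Matching bispanNerve 4} {i : Fin 5} (h0 : 0 < i)
    (h4 : i < 4) (hF : F.IsHorn i) : ∃ ν : NSimplex 4, F.IsFiller ν := by
  have c (j : Fin 5) (hj : j ≠ i) (a b c d : Fin 5) (h : a < b ∧ b < c ∧ c < d ∧ j ≠ a ∧ j ≠ b ∧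
      j ≠ c ∧ j ≠ d) : F.CoversTetra a b c d := by
    obtain ⟨h1, h2, h3, h4, h5, h6, h7⟩ := h
    exact (hF.hasFace j hj).coversTetra h1.le h2.le h3.le h4 h5 h6 h7
  refine exists_isFiller_of_coversTri (hF.coversEdges (by decide)) (fun a b c hab hbc => ?_)
    fun t ht a b c' d hab hbc hcd => ?_
  · obtain ⟨j, h, h1, h2, h3⟩ := exists_ne_of_lt' (n := 5) (by decide) i a b c
    exact (hF.hasFace j h).coversTri hab.le hbc.le h1 h2 h3
  by_cases h : ∃ j, j ≠ i ∧ j ≠ a ∧ j ≠ b ∧ j ≠ c' ∧ j ≠ d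
  · obtain ⟨j, hj, h⟩ := h
    exact .inl (c j hj _ _ _ _ ⟨hab, hbc, hcd, h⟩)
  right
  have T1234 := ht.tetra (c 0 (by lia) 1 2 3 4 (by decide)) (by decide) (by decide) (by decide)
  have T0123 := ht.tetra (c 4 (by lia) 0 1 2 3 (by decide)) (by decide) (by decide) (by decide)
  have hi : i = 1 ∨ i = 2 ∨ i = 3 := by lia
  rcases hi with rfl | rfl | rfl
  · have T0134 := ht.tetra (c 2 (by lia) 0 1 3 4 (by decide)) (by decide) (by decide) (by decide)
    have T0124 := ht.tetra (c 3 (by lia) 0 1 2 4 (by decide)) (by decide) (by decide) (by decide)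
    obtain ⟨rfl, rfl, rfl, rfl⟩ : a = 0 ∧ b = 2 ∧ c' = 3 ∧ d = 4 := by
      clear T1234 T0123 T0134 T0124 c hF ht
      revert a b c' d
      decide
    exact Tetra.pentagon_0234 T1234 T0134 T0124 T0123
  · have T0234 := ht.tetra (c 1 (by lia) 0 2 3 4 (by decide)) (by decide) (by decide) (by decide)
    have T0124 := ht.tetra (c 3 (by lia) 0 1 2 4 (by decide)) (by decide) (by decide) (by decide)
    obtain ⟨rfl, rfl, rfl, rfl⟩ : a = 0 ∧ b = 1 ∧ c' = 3 ∧ d = 4 := by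
      clear T1234 T0123 T0234 T0124 c hF ht
      revert a b c' d
      decide
    exact Tetra.pentagon_0134 T1234 T0234 T0124 T0123
  · have T0234 := ht.tetra (c 1 (by lia) 0 2 3 4 (by decide)) (by decide) (by decide) (by decide)
    have T0134 := ht.tetra (c 2 (by lia) 0 1 3 4 (by decide)) (by decide) (by decide) (by decide)
    obtain ⟨rfl, rfl, rfl, rfl⟩ : a = 0 ∧ b = 1 ∧ c' = 2 ∧ d = 4 := by
      clear T1234 T0123 T0234 T0134 c hF ht
      revert a b c' d
      decide
    exact Tetra.pentagon_0124 T1234 T0234 T0134 T0123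

/-- In dimension at least `5`, the horn contains all tetrahedra. -/
lemma exists_isFiller_of_isHorn {n : ℕ} {i : Fin (n + 3)} {F : Matching bispanNerve (n + 2)}
    (h0 : 0 < i) (hn : i < Fin.last (n + 2)) (hF : F.IsHorn i) :
    ∃ ν : NSimplex (n + 2), F.IsFiller ν := by
  match n with
  | 0 =>
    obtain rfl : i = 1 := by lia
    exact exists_isFiller_of_isHorn_two hF
  | 1 => exact exists_isFiller_of_isHorn_three h0 hn hF
  | 2 => exact exists_isFiller_of_isHorn_four h0 hn hF
  | n + 3 =>
    refine exists_isFiller_of_coversTri (hF.coversEdges (by lia)) (fun a b c hab hbc => ?_)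
      fun t ht a b c d hab hbc hcd => .inl ?_
    · obtain ⟨j, hj, h1, h2, h3⟩ := exists_ne_of_lt' (by lia) i a b c
      exact (hF.hasFace j hj).coversTri hab.le hbc.le h1 h2 h3
    · obtain ⟨j, hj, h1, h2, h3, h4⟩ := exists_ne_of_lt'' (by lia) i a b c d
      exact (hF.hasFace j hj).coversTetra hab.le hbc.le hcd.le h1 h2 h3 h4

/-- Above dimension `3`, a horn contains all triangles; in dimension `3`, the missing triangle is
determined by the other ones. -/
lemma IsHorn.isFiller_unique {n : ℕ} {i : Fin (n + 4)} {F : Matching bispanNerve (n + 3)}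
    (h0 : 0 < i) (hn : i < Fin.last (n + 3)) (hF : F.IsHorn i) {ν ν' : NSimplex (n + 3)}
    (h : F.IsFiller ν) (h' : F.IsFiller ν') : ν = ν' := by
  refine h.eq h' (hF.coversEdges (by lia)) fun a b c hab hbc => ?_
  match n with
  | 0 =>
    by_cases hj : ∃ j, j ≠ i ∧ j ≠ a ∧ j ≠ b ∧ j ≠ c
    · obtain ⟨j, hj, h1, h2, h3⟩ := hj
      exact .inl ((hF.hasFace j hj).coversTri hab.le hbc.le h1 h2 h3)
    right
    have e (j : Fin 4) (hj : j ≠ i) (a b c : Fin 4) (hab hbc) (h1 : j ≠ a ∧ j ≠ b ∧ j ≠ c) :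
        ν.tri a b c hab hbc = ν'.tri a b c hab hbc :=
      h.tri_eq h' ((hF.hasFace j hj).coversTri hab hbc h1.1 h1.2.1 h1.2.2) _ _
    have T := ν.tetra 0 1 2 3 (by decide) (by decide) (by decide)
    have T' := ν'.tetra 0 1 2 3 (by decide) (by decide) (by decide)
    rw [e 0 (by lia) 1 2 3 (by decide) (by decide) (by decide),
      e 3 (by lia) 0 1 2 (by decide) (by decide) (by decide)] at T
    have hi : i = 1 ∨ i = 2 := by lia
    rcases hi with rfl | rfl
    · obtain ⟨rfl, rfl, rfl⟩ : a = 0 ∧ b = 2 ∧ c = 3 := by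
        clear h h' hF T T' e
        revert a b c
        decide
      rw [e 2 (by decide) 0 1 3 (by decide) (by decide) (by decide)] at T
      exact T.unique_023 T'
    · obtain ⟨rfl, rfl, rfl⟩ : a = 0 ∧ b = 1 ∧ c = 3 := by
        clear h h' hF T T' e
        revert a b c
        decide
      rw [e 1 (by decide) 0 2 3 (by decide) (by decide) (by decide)] at T
      exact T.unique_013 T'
  | n + 1 =>
    obtain ⟨j, hj, h1, h2, h3⟩ := exists_ne_of_lt' (by lia) i a b c
    exact .inl ((hF.hasFace j hj).coversTri hab.le hbc.le h1 h2 h3)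

end Matching

theorem isTwoOneCategory_bispanNerve : IsTwoOneCategory bispanNerve := by
  refine ⟨⟨fun n i s h0 hn => ?_⟩, fun n i hn h0 hi s => ?_⟩
  · obtain ⟨ν, h⟩ := Matching.exists_isFiller_of_isHorn h0 hn (Matching.isHorn_ofSubcomplex i s)
    exact ⟨SSet.yonedaEquiv.symm ν, (Matching.isFiller_ofSubcomplex_iff.mp h).symm⟩
  · obtain ⟨n, rfl⟩ : ∃ m, n = m + 3 := ⟨n - 3, by lia⟩
    have hF := Matching.isHorn_ofSubcomplex i s
    obtain ⟨ν, h⟩ := Matching.exists_isFiller_of_isHorn h0 hi hF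
    refine ⟨SSet.yonedaEquiv.symm ν, Matching.isFiller_ofSubcomplex_iff.mp h, fun t ht => ?_⟩
    exact (Equiv.eq_symm_apply _).mpr (hF.isFiller_unique h0 hi
      (Matching.isFiller_ofSubcomplex_yonedaEquiv.mpr ht) h)

/-! ### Extending maps to overcategories -/

lemma map_comp_op (X : SSet.{u}) {a b c : SimplexCategory} (f : a ⟶ b) (g : b ⟶ c)
    (x : X.obj (op c)) : X.map (f ≫ g).op x = X.map f.op (X.map g.op x) :=
  Functor.map_comp_apply X g.op f.op x

/-- The projection of the overcategory. -/
def overFamilyForget {X : SSet.{u}} {ι : Type} (A : ι → X _⦋0⦌) : overFamily A ⟶ X where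
  app n := ↾fun x => x.base

/-- The map `[k] → [k] ⋆ [0]` which is the identity up to `x₀` and sends the other elements to the
last vertex. -/
def truncate {k : ℕ} (x₀ : Fin (k + 1)) : ⦋k⦌ ⟶ ⦋k + 1⦌ :=
  SimplexCategory.Hom.mk
    { toFun := fun x => if x ≤ x₀ then x.castSucc else Fin.last _
      monotone' := fun x y h => by
        dsimp only
        split_ifs with h1 h2
        · exact h
        · exact Fin.le_last _
        · exact absurd (h.trans ‹_›) h1
        · exact le_rfl }

lemma exists_eq_truncate_comp {k m : ℕ} (g : ⦋k⦌ ⟶ ⦋m + 1⦌) (x₀ : Fin (k + 1))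
    (h : g.toOrderHom x₀ ≠ Fin.last _) (h' : ∀ x, x₀ < x → g.toOrderHom x = Fin.last _) :
    ∃ γ : ⦋k⦌ ⟶ ⦋m⦌, g = truncate x₀ ≫ joinPoint.map γ ∧
      ∀ x, (γ.toOrderHom x).castSucc = g.toOrderHom (min x x₀) := by
  have hlt : ∀ x, g.toOrderHom (min x x₀) ≠ Fin.last _ := fun x hx =>
    h (le_antisymm (Fin.le_last _) (hx.ge.trans (g.toOrderHom.monotone (min_le_right x x₀))))
  refine ⟨SimplexCategory.Hom.mk ⟨fun x => (g.toOrderHom (min x x₀)).castPred (hlt x),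
    fun x y hxy => ?_⟩, ?_, fun x => Fin.castSucc_castPred _ (hlt x)⟩
  · exact Fin.castPred_le_castPred (g.toOrderHom.monotone (min_le_min_right _ hxy)) _
  · refine SimplexCategory.Hom.ext _ _ (OrderHom.ext _ _ (funext fun x => ?_))
    change _ = joinPointMap _ (if x ≤ x₀ then x.castSucc else Fin.last _)
    split_ifs with hx
    · refine Eq.trans ?_ (joinPointMap_castSucc _ _).symm
      refine Eq.trans ?_ (Fin.castSucc_castPred _ (hlt x)).symm
      rw [min_eq_left hx]
    · rw [joinPointMap_last]
      exact h' x (not_le.mp hx)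

lemma exists_toJoinPoint_comp {k m : ℕ} (g : ⦋k⦌ ⟶ ⦋m + 1⦌)
    (h : ∀ x, g.toOrderHom x ≠ Fin.last _) :
    ∃ γ : ⦋k⦌ ⟶ ⦋m⦌, g = γ ≫ toJoinPoint.app ⦋m⦌ :=
  ⟨SimplexCategory.Hom.mk ⟨fun x => (g.toOrderHom x).castPred (h x),
    fun _ _ hxy => Fin.castPred_le_castPred (g.toOrderHom.monotone hxy) _⟩,
    SimplexCategory.Hom.ext _ _ (OrderHom.ext _ _ (funext fun _ =>
      (Fin.castSucc_castPred _ (h _)).symm))⟩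

lemma joinPoint_map_eq_last_iff {m n : ℕ} (f : ⦋m⦌ ⟶ ⦋n⦌) (x : Fin (m + 2)) :
    (joinPoint.map f).toOrderHom x = Fin.last (n + 1) ↔ x = Fin.last (m + 1) := by
  change joinPointMap f.toOrderHom x = _ ↔ _
  induction x using Fin.lastCases with
  | last => simp [joinPointMap_last]
  | cast x =>
    rw [joinPointMap_castSucc]
    exact iff_of_false (Fin.castSucc_ne_last _) (Fin.castSucc_ne_last _)

namespace OverSimplex

variable {X : SSet.{u}} {ι : Type} {A : ι → X _⦋0⦌}

/-- The values of a map on the faces which lie in both of two simplices of the overcategory agree,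
if the simplices agree on their common faces. -/
lemma map_leg_eq {m m' n : ℕ} (x : OverSimplex A ⦋m⦌) (x' : OverSimplex A ⦋m'⦌)
    (f : ⦋m⦌ ⟶ ⦋n⦌) (f' : ⦋m'⦌ ⟶ ⦋n⦌) {k : ℕ}
    (hx : ∀ (g : ⦋k⦌ ⟶ ⦋m⦌) (h : ⦋k⦌ ⟶ ⦋m'⦌), g ≫ f = h ≫ f' →
      (overFamily A).map g.op x = (overFamily A).map h.op x') (i : ι)
    (g : ⦋k⦌ ⟶ ⦋m + 1⦌) (h : ⦋k⦌ ⟶ ⦋m' + 1⦌)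
    (e : g ≫ joinPoint.map f = h ≫ joinPoint.map f') :
    X.map g.op (x.leg i) = X.map h.op (x'.leg i) := by
  have he : ∀ y, (joinPoint.map f).toOrderHom (g.toOrderHom y) =
      (joinPoint.map f').toOrderHom (h.toOrderHom y) := fun y =>
    DFunLike.congr_fun (congrArg SimplexCategory.Hom.toOrderHom e) y
  have hl : ∀ y, g.toOrderHom y = Fin.last _ ↔ h.toOrderHom y = Fin.last _ := fun y => by
    rw [← joinPoint_map_eq_last_iff f, ← joinPoint_map_eq_last_iff f', he]
  by_cases hg : ∃ y, g.toOrderHom y ≠ Fin.last _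
  · obtain ⟨x₀, h1, h2⟩ := (Set.toFinite {y | g.toOrderHom y ≠ Fin.last _}).exists_maximal hg
    have h3 : ∀ y, x₀ < y → g.toOrderHom y = Fin.last _ := fun y hy => by
      by_contra hy'
      exact absurd (h2 hy' hy.le) (not_le.mpr hy)
    obtain ⟨γ, hγ, hγ'⟩ := exists_eq_truncate_comp g x₀ h1 h3
    obtain ⟨δ, hδ, hδ'⟩ := exists_eq_truncate_comp h x₀ (fun hh => h1 ((hl _).mpr hh))
      fun y hy => (hl y).mp (h3 y hy)
    have key : (overFamily A).map γ.op x = (overFamily A).map δ.op x' := by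
      refine hx γ δ (SimplexCategory.Hom.ext _ _ (OrderHom.ext _ _ (funext fun y => ?_)))
      refine Fin.castSucc_injective _ ?_
      refine (joinPointMap_castSucc f.toOrderHom (γ.toOrderHom y)).symm.trans
        (Eq.trans ?_ (joinPointMap_castSucc f'.toOrderHom (δ.toOrderHom y)))
      rw [hγ', hδ']
      exact he _
    have := congrArg (fun z : OverSimplex A ⦋k⦌ => X.map (truncate x₀).op (z.leg i)) key
    rw [hγ, hδ]
    exact (map_comp_op X _ _ _).trans (this.trans (map_comp_op X _ _ _).symm)
  · push Not at hg
    have hconst : ∀ {r : ℕ} (g : ⦋k⦌ ⟶ ⦋r + 1⦌), (∀ y, g.toOrderHom y = Fin.last _) →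
        g = SimplexCategory.const ⦋k⦌ ⦋0⦌ 0 ≫ SimplexCategory.const ⦋0⦌ ⦋r + 1⦌ (Fin.last _) :=
      fun g hg => SimplexCategory.Hom.ext _ _ (OrderHom.ext _ _ (funext fun y => hg y))
    rw [hconst g hg, hconst h fun y => (hl y).mp (hg y)]
    refine (map_comp_op X _ _ _).trans (Eq.trans ?_ (map_comp_op X _ _ _).symm)
    exact congrArg (X.map _) ((x.last i).trans (x'.last i).symm)

end OverSimplex

namespace Matching

variable {X : SSet.{1}} {ι : Type} {A : ι → X _⦋0⦌} {d : ℕ}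
  (f : (∂Δ[d] : SSet.{1}) ⟶ overFamily A)

/-- The faces of the base of a boundary in an overcategory. -/
abbrev base : Matching X d := ofSubcomplex ∂Δ[d] (f ≫ overFamilyForget A)

/-- The simplices of the boundary. -/
abbrev boundaryFace (k : (base f).ι) : OverSimplex A ⦋(base f).m k⦌ :=
  (ofSubcomplex ∂Δ[d] f).σ k

/-- The faces of the legs of a boundary in an overcategory. -/
def sides (i : ι) : Matching X (d + 1) where
  ι := (base f).ι
  m k := (base f).m k + 1
  f k := joinPoint.map ((base f).f k)
  σ k := (boundaryFace f k).leg i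
  compat k l g h e := OverSimplex.map_leg_eq (boundaryFace f k) (boundaryFace f l)
    ((base f).f k) ((base f).f l) ((ofSubcomplex ∂Δ[d] f).compat k l) i g h e

variable {f}

/-- The faces of the legs of a boundary in an overcategory, completed by a base. -/
def legs {b : X _⦋d⦌} (hb : (base f).IsFiller b) (i : ι) : Matching X (d + 1) where
  ι := Option (base f).ι
  m k := k.elim d fun k => (base f).m k + 1
  f k := match k with
    | none => toJoinPoint.app ⦋d⦌
    | some k => joinPoint.map ((base f).f k)
  σ k := match k with
    | none => b
    | some k => (boundaryFace f k).leg i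
  compat := by
    have h1 : ∀ (k : (base f).ι) (g : ⦋2⦌ ⟶ ⦋(base f).m k + 1⦌) (h : ⦋2⦌ ⟶ ⦋d⦌),
        g ≫ joinPoint.map ((base f).f k) = h ≫ toJoinPoint.app ⦋d⦌ →
        X.map g.op ((boundaryFace f k).leg i) = X.map h.op b := by
      intro k g h e
      have he : ∀ y, (joinPoint.map ((base f).f k)).toOrderHom (g.toOrderHom y) =
        (h.toOrderHom y).castSucc := fun y =>
          DFunLike.congr_fun (congrArg SimplexCategory.Hom.toOrderHom e) y
      obtain ⟨γ, rfl⟩ := exists_toJoinPoint_comp g fun y hy =>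
        Fin.castSucc_ne_last _ ((he y).symm.trans ((joinPoint_map_eq_last_iff _ _).mpr hy))
      have hγ : γ ≫ (base f).f k = h := by
        refine SimplexCategory.Hom.ext _ _ (OrderHom.ext _ _ (funext fun y => ?_))
        exact Fin.castSucc_injective _
          ((joinPointMap_castSucc ((base f).f k).toOrderHom (γ.toOrderHom y)).symm.trans (he y))
      rw [← hγ]
      refine (map_comp_op X _ _ _).trans (Eq.trans ?_ (map_comp_op X _ _ _).symm)
      exact congrArg (X.map γ.op) (((boundaryFace f k).restrict i).trans (hb k).symm)
    rintro (_ | k) (_ | l) g h e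
    · have : g = h := by
        refine SimplexCategory.Hom.ext _ _ (OrderHom.ext _ _ (funext fun y => ?_))
        exact Fin.castSucc_injective _
          (DFunLike.congr_fun (congrArg SimplexCategory.Hom.toOrderHom e) y)
      rw [this]
    · exact (h1 l h g e.symm).symm
    · exact h1 k g h e
    · exact (sides f i).compat k l g h e

/-- A boundary in the overcategory can be filled if its base and its legs can be filled. -/
lemma exists_extension {n : ℕ} {f : (∂Δ[n + 1] : SSet.{1}) ⟶ overFamily A} {b : X _⦋n + 1⦌}
    (hb : (base f).IsFiller b) (h : ∀ i, ∃ l, (legs hb i).IsFiller l) :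
    ∃ g : Δ[n + 1] ⟶ overFamily A,
      (∂Δ[n + 1] : (Δ[n + 1] : SSet.{1}).Subcomplex).ι ≫ g = f := by
  choose l hl using h
  have h0 : SSet.stdSimplex.objEquiv.symm (SimplexCategory.const ⦋0⦌ ⦋n + 1⦌ 0) ∈
      (∂Δ[n + 1] : (Δ[n + 1] : SSet.{1}).Subcomplex).obj (op ⦋0⦌) := by
    rw [SSet.boundary_obj_eq_univ 0 (n + 1)]
    trivial
  let x : OverSimplex A ⦋n + 1⦌ :=
    { base := b
      leg := l
      restrict := fun i => hl i none
      last := fun i => by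
        have h1 := hl i (some ⟨0, SimplexCategory.const ⦋0⦌ ⦋n + 1⦌ 0, h0⟩)
        have h2 := (boundaryFace f ⟨0, SimplexCategory.const ⦋0⦌ ⦋n + 1⦌ 0, h0⟩).last i
        refine Eq.trans ?_ ((congrArg (X.map (SimplexCategory.const ⦋0⦌ ⦋1⦌ (Fin.last 1)).op)
          h1).trans h2)
        refine Eq.trans ?_ (map_comp_op X _ _ _)
        refine congrArg (fun g : ⦋0⦌ ⟶ ⦋n + 2⦌ => X.map g.op (l i)) ?_
        exact (const_last_comp_joinPoint (SimplexCategory.const ⦋0⦌ ⦋n + 1⦌ 0)).symm }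
  refine ⟨(SSet.yonedaEquiv (X := overFamily A)).symm x, isFiller_ofSubcomplex_iff.mp fun k => ?_⟩
  exact OverSimplex.ext (hb k) (funext fun i => hl i (some k))

end Matching

/-- Product cones are reflected by maps with the lifting property against families of faces. -/
lemma HasMatchingLift.isProductCone {X Y : SSet.{1}} {p : X ⟶ Y} (hp : HasMatchingLift p)
    {ι : Type} {A : ι → X _⦋0⦌} {c : (overFamily A) _⦋0⦌}
    (h : IsProductCone _ ((overFamilyMap p A).app (op ⦋0⦌) c)) : IsProductCone A c := by
  intro n f hf
  obtain ⟨g, hg⟩ := h n (f ≫ overFamilyMap p A) fun z hz =>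
    congrArg ((overFamilyMap p A).app (op ⦋0⦌)) (hf z hz)
  have hx := Matching.isFiller_ofSubcomplex_yonedaEquiv.mpr hg
  generalize SSet.yonedaEquiv g = x at hx
  change OverSimplex _ ⦋n + 1⦌ at x
  obtain ⟨b, hb, hb'⟩ := hp (n + 1) (Matching.base f) x.base fun k =>
    congrArg OverSimplex.base (hx k)
  refine Matching.exists_extension hb' fun i => ?_
  obtain ⟨l, -, hl⟩ := hp (n + 2) (Matching.legs hb' i) (x.leg i) fun k => by
    rcases k with _ | k
    · exact (x.restrict i).trans hb.symm
    · exact congrArg (fun y : OverSimplex (fun i => p.app (op ⦋0⦌) (A i)) _ => y.leg i) (hx k)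
  exact ⟨l, hl⟩

/-! ### Product cones in the nerve -/

lemma Tri.exists_eq {X Y Z : FinSet} {E : Bispan X Y} {E' : Bispan Y Z} {T : Tri}
    (h2 : T.d2 = ⟨X, Y, E⟩) (h0 : T.d0 = ⟨Y, Z, E'⟩) :
    ∃ (E'' : Bispan X Z) (φ : TwoCell E E' E''), T = ⟨_, _, _, _, _, _, φ⟩ := by
  obtain ⟨_, _, _, _, _, _, φ⟩ := T
  cases h2
  cases h0
  exact ⟨_, φ, rfl⟩

/-- The edges `ε` form a product cone with vertex `P`. -/
def IsProjEdges {ι : Type} (P : FinSet) (ε : ι → Edge) : Prop :=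
  ∃ (B : ι → FinSet) (L : ∀ i, Bispan P (B i)), IsProj L ∧ ∀ i, ε i = ⟨P, B i, L i⟩

namespace IsProjEdges

variable {ι : Type} {P : FinSet} {ε : ι → Edge}

/-- Bispans to the factors of a product induce a bispan to the product. -/
lemma exists_tri [Finite ι] (h : IsProjEdges P ε) {X : FinSet} {E : ι → Edge}
    (hX : ∀ i, (E i).X = X) (hY : ∀ i, (E i).Y = (ε i).Y) :
    ∃ e : Edge, e.X = X ∧ e.Y = P ∧ ∀ i, ∃ T : Tri, T.d2 = e ∧ T.d1 = E i ∧ T.d0 = ε i := by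
  obtain ⟨B, L, hL, h⟩ := h
  have : ∀ i, ∃ E' : Bispan X (B i), E i = ⟨X, B i, E'⟩ := by
    intro i
    have h1 := hX i
    have h2 := (hY i).trans (congrArg Edge.Y (h i))
    generalize E i = e at h1 h2
    obtain ⟨X', Y', e⟩ := e
    cases h1
    cases h2
    exact ⟨e, rfl⟩
  choose E' hE' using this
  obtain ⟨e, he⟩ := hL.exists_dist E'
  refine ⟨⟨X, P, e⟩, rfl, rfl, fun i => ?_⟩
  obtain ⟨D⟩ := he i
  exact ⟨⟨_, _, _, _, _, _, D.toTwoCell⟩, rfl, (hE' i).symm, (h i).symm⟩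

/-- Two-cells to the factors of a product induce a two-cell to the product. -/
lemma exists_tetra (h : IsProjEdges P ε) {T123 T023 T013 : ι → Tri} {e01 e12 e02 : Edge}
    (h0 : e02.X = e01.X) (h1 : e01.Y = e12.X) (h2 : e12.Y = P) (h2' : e02.Y = P)
    (d2_123 : ∀ i, (T123 i).d2 = e12) (d0_123 : ∀ i, (T123 i).d0 = ε i)
    (d2_023 : ∀ i, (T023 i).d2 = e02) (d0_023 : ∀ i, (T023 i).d0 = ε i)
    (d2_013 : ∀ i, (T013 i).d2 = e01) (d0_013 : ∀ i, (T013 i).d0 = (T123 i).d1)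
    (d1_013 : ∀ i, (T013 i).d1 = (T023 i).d1) :
    ∃ T012 : Tri, T012.d2 = e01 ∧ T012.d1 = e02 ∧ T012.d0 = e12 ∧
      ∀ i, Tetra (T123 i) (T023 i) (T013 i) T012 := by
  obtain ⟨B, L, hL, h⟩ := h
  obtain ⟨X0, X1, E01⟩ := e01
  obtain ⟨_, _, E12⟩ := e12
  obtain ⟨_, _, E02⟩ := e02
  cases h0
  cases h1
  cases h2
  cases h2'
  have : ∀ i, ∃ (E13 : Bispan X1 (B i)) (E03 : Bispan X0 (B i)) (φ123 : TwoCell E12 (L i) E13)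
      (φ023 : TwoCell E02 (L i) E03) (φ013 : TwoCell E01 E13 E03),
      T123 i = ⟨_, _, _, _, _, _, φ123⟩ ∧ T023 i = ⟨_, _, _, _, _, _, φ023⟩ ∧
      T013 i = ⟨_, _, _, _, _, _, φ013⟩ := by
    intro i
    have d1 := d2_123 i
    have d2 := (d0_123 i).trans (h i)
    have d3 := d2_023 i
    have d4 := (d0_023 i).trans (h i)
    have d5 := d2_013 i
    have d6 := d0_013 i
    have d7 := d1_013 i
    obtain ⟨E13, φ123, h123⟩ := Tri.exists_eq d1 d2
    obtain ⟨E03, φ023, h023⟩ := Tri.exists_eq d3 d4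
    rw [h123] at d6
    rw [h023] at d7
    obtain ⟨E03', φ013, h013⟩ := Tri.exists_eq d5 d6
    rw [h013] at d7
    cases d7
    exact ⟨E13, E03, φ123, φ023, φ013, h123, h023, h013⟩
  choose E13 E03 φ123 φ023 φ013 h1 h2 h3 using this
  obtain ⟨φ012, hφ⟩ := hL.exists_coc φ123 φ023 φ013
  refine ⟨⟨_, _, _, _, _, _, φ012⟩, rfl, rfl, rfl, fun i => ?_⟩
  rw [h1, h2, h3]
  exact Tetra.mk _ _ _ _ _ _ _ _ _ _ _ _ _ _ (hφ i)

/-- The cocycle condition for triangles to a product can be checked on the factors. -/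
lemma tetra_of_forall (h : IsProjEdges P ε) {T012 T013 T023 T123 : Tri}
    (h1 : T012.d0 = T123.d2) (h2 : T012.d2 = T013.d2) (h3 : T012.d1 = T023.d2)
    (h4 : T123.d1 = T013.d0) (h5 : T123.d0 = T023.d0) (h6 : T013.d1 = T023.d1)
    (hP : T123.d0.Y = P) {T234 T134 T034 T124 T024 T014 : ι → Tri}
    (d0_234 : ∀ i, (T234 i).d0 = ε i)
    (h1234 : ∀ i, Tetra (T234 i) (T134 i) (T124 i) T123)
    (h0234 : ∀ i, Tetra (T234 i) (T034 i) (T024 i) T023)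
    (h0134 : ∀ i, Tetra (T134 i) (T034 i) (T014 i) T013)
    (h0124 : ∀ i, Tetra (T124 i) (T024 i) (T014 i) T012) :
    Tetra T123 T023 T013 T012 := by
  obtain ⟨B, L, hL, h⟩ := h
  obtain ⟨X0, X1, X2, E01, E12, E02, φ012⟩ := T012
  obtain ⟨_, _, X3, _, E23, E13, φ123⟩ := T123
  cases h1
  cases hP
  obtain ⟨_, _, _, _, _, E03, φ013⟩ := T013
  cases h2
  cases h4
  obtain ⟨_, _, _, _, _, _, φ023⟩ := T023
  cases h3
  cases h5
  cases h6
  have : ∀ i, ∃ (E04 : Bispan X0 (B i)) (E14 : Bispan X1 (B i)) (E24 : Bispan X2 (B i))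
      (φ014 : TwoCell E01 E14 E04) (φ024 : TwoCell E02 E24 E04) (φ034 : TwoCell E03 (L i) E04)
      (φ124 : TwoCell E12 E24 E14) (φ134 : TwoCell E13 (L i) E14) (φ234 : TwoCell E23 (L i) E24),
      Coc φ234 φ134 φ124 φ123 ∧ Coc φ234 φ034 φ024 φ023 ∧ Coc φ134 φ034 φ014 φ013 ∧
        Coc φ124 φ024 φ014 φ012 := by
    intro i
    have d := (d0_234 i).trans (h i)
    have c1 := h1234 i
    have c2 := h0234 i
    have c3 := h0134 i
    have c4 := h0124 i
    generalize T234 i = T234, T134 i = T134, T034 i = T034, T124 i = T124, T024 i = T024,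
      T014 i = T014 at *
    cases c1 with
    | mk _ _ _ _ _ _ _ _ _ _ _ _ _ _ c1 =>
    cases c2 with
    | mk _ _ _ _ _ _ _ _ _ _ _ _ _ _ c2 =>
    cases c3 with
    | mk _ _ _ _ _ _ _ _ _ _ _ _ _ _ c3 =>
    cases c4 with
    | mk _ _ _ _ _ _ _ _ _ _ _ _ _ _ c4 =>
    cases d
    exact ⟨_, _, _, _, _, _, _, _, _, c1, c2, c3, c4⟩
  choose E04 E14 E24 φ014 φ024 φ034 φ124 φ134 φ234 c1 c2 c3 c4 using this
  exact Tetra.mk _ _ _ _ _ _ _ _ _ _ _ _ _ _ (hL.coc_of_forall c1 c2 c3 c4)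

end IsProjEdges

namespace Matching

section

variable {ι : Type} {A : ι → bispanNerve _⦋0⦌} {d : ℕ}
  {f : (∂Δ[d] : SSet.{1}) ⟶ overFamily A}

lemma sides_edge (i : ι) (k : (base f).ι) (a b : Fin ((base f).m k + 1)) (h : a ≤ b) :
    ((sides f i).simplex k).edge a.castSucc b.castSucc h = ((base f).simplex k).edge a b h :=
  congrArg (fun ν : NSimplex ((base f).m k) => ν.edge a b h) ((boundaryFace f k).restrict i)

lemma sides_tri (i : ι) (k : (base f).ι) (a b c : Fin ((base f).m k + 1)) (h : a ≤ b)
    (h' : b ≤ c) : ((sides f i).simplex k).tri a.castSucc b.castSucc c.castSucc h h' =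
      ((base f).simplex k).tri a b c h h' :=
  congrArg (fun ν : NSimplex ((base f).m k) => ν.tri a b c h h') ((boundaryFace f k).restrict i)

lemma base_ne (k : (base f).ι) : ∃ j, ∀ a, ((base f).f k).toOrderHom a ≠ j := by
  obtain ⟨m, g, hg⟩ := k
  rw [SSet.mem_boundary_iff_notMem_range] at hg
  obtain ⟨j, hj⟩ := hg
  exact ⟨j, fun a ha => hj ⟨a, ha⟩⟩

lemma legs_hasFace_last {b : bispanNerve _⦋d⦌} (hb : (base f).IsFiller b) (i : ι) :
    (legs hb i).HasFace (Fin.last (d + 1)) :=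
  ⟨none, Fin.strictMono_castSucc, fun a ha => ⟨a.castPred ha, Fin.castSucc_castPred a ha⟩⟩

lemma HasFace.legs {b : bispanNerve _⦋d⦌} (hb : (base f).IsFiller b) {i : ι} {j : Fin (d + 2)}
    (h : (sides f i).HasFace j) : (legs hb i).HasFace j := by
  obtain ⟨k, hk, h⟩ := h
  exact ⟨some k, hk, h⟩

lemma sides_castSucc (i : ι) (k : (base f).ι) (a : Fin ((base f).m k + 1)) :
    ((sides f i).f k).toOrderHom a.castSucc = (((base f).f k).toOrderHom a).castSucc :=
  joinPointMap_castSucc _ _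

lemma sides_last (i : ι) (k : (base f).ι) :
    ((sides f i).f k).toOrderHom (Fin.last _) = Fin.last (d + 1) :=
  joinPointMap_last _

lemma HasFace.sides {j : Fin (d + 1)} (h : (base f).HasFace j) (i : ι) :
    (sides f i).HasFace j.castSucc := by
  obtain ⟨k, hk, h⟩ := h
  refine ⟨k, fun x y hxy => ?_, fun a ha => ?_⟩
  · change Fin ((base f).m k + 1 + 1) at x y
    induction x using Fin.lastCases with
    | last => exact absurd hxy (not_lt_of_ge (Fin.le_last y))
    | cast x =>
      rw [sides_castSucc]
      induction y using Fin.lastCases with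
      | last =>
        exact (Fin.castSucc_lt_last _).trans_eq (sides_last i k).symm
      | cast y =>
        rw [sides_castSucc]
        exact hk hxy
  · induction a using Fin.lastCases with
    | last => exact ⟨_, sides_last i k⟩
    | cast a =>
      obtain ⟨a', rfl⟩ := h a fun e => ha (congrArg _ e)
      exact ⟨_, sides_castSucc i k a'⟩

lemma ExtendsEdges.sides_eq {e : ∀ a b : Fin (d + 1), a ≤ b → Edge} (he : (base f).ExtendsEdges e)
    (hc : (base f).CoversEdges) {i : ι}
    {e' : ∀ a b : Fin (d + 2), a ≤ b → Edge} (he' : (sides f i).ExtendsEdges e')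
    (a b : Fin (d + 1)) (h : a ≤ b) : e' a.castSucc b.castSucc h = e a b h := by
  obtain ⟨k, a', b', h1, rfl, rfl⟩ := hc a b h
  refine Eq.trans ?_ ((he' k a'.castSucc b'.castSucc h1).symm.trans
    ((sides_edge i k a' b' h1).trans (he k a' b' h1)))
  congr 1 <;> exact (sides_castSucc i k _).symm

lemma Extends.sides_eq {t : ∀ a b c : Fin (d + 1), a < b → b < c → Tri} (ht : (base f).Extends t)
    {i : ι} {t' : ∀ a b c : Fin (d + 2), a < b → b < c → Tri} (ht' : (sides f i).Extends t')
    {a b c : Fin (d + 1)} (h : a < b) (h' : b < c) (hc : (base f).CoversTri a b c) :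
    t' a.castSucc b.castSucc c.castSucc h h' = t a b c h h' := by
  obtain ⟨k, a', b', c', h1, h2, rfl, rfl, rfl⟩ := hc
  refine Eq.trans ?_ ((ht' k a'.castSucc b'.castSucc c'.castSucc ?_ ?_ h1 h2).trans
    ((sides_tri i k a' b' c' h1 h2).trans (ht k a' b' c' h h' h1 h2).symm))
  rotate_left
  · exact (sides_castSucc i k a').trans_lt (lt_of_lt_of_eq h (sides_castSucc i k b').symm)
  · exact (sides_castSucc i k b').trans_lt (lt_of_lt_of_eq h' (sides_castSucc i k c').symm)
  congr 1 <;> exact (sides_castSucc i k _).symm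

end

end Matching

namespace Matching

section

variable {ι : Type} {A : ι → bispanNerve _⦋0⦌} {n : ℕ}
  (f : (∂Δ[n + 1] : SSet.{1}) ⟶ overFamily A)

/-- The `j`-th vertex of the boundary. -/
def vertexIdx (j : Fin (n + 2)) : (base f).ι :=
  ⟨0, SimplexCategory.const ⦋0⦌ ⦋n + 1⦌ j, by
    rw [SSet.boundary_obj_eq_univ 0 (n + 1)]
    trivial⟩

/-- The `j`-th face of the boundary. -/
def faceIdx (j : Fin (n + 2)) : (base f).ι :=
  ⟨n, SimplexCategory.δ j, by
    rw [SSet.mem_boundary_iff_notMem_range]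
    exact ⟨j, fun ⟨a, ha⟩ => Fin.succAbove_ne j a ha⟩⟩

variable {f}

lemma hasFace_base (j : Fin (n + 2)) : (base f).HasFace j :=
  ⟨faceIdx f j, Fin.strictMono_succAbove j, fun _ ha => Fin.exists_succAbove_eq ha⟩

lemma hasFace_sides (i : ι) (j : Fin (n + 2)) : (sides f i).HasFace j.castSucc :=
  (hasFace_base j).sides i

lemma hasFace_legs {b : bispanNerve _⦋n + 1⦌} (hb : (base f).IsFiller b) (i : ι)
    (j : Fin (n + 3)) : (legs hb i).HasFace j := by
  induction j using Fin.lastCases with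
  | last => exact legs_hasFace_last hb i
  | cast j => exact (hasFace_sides i j).legs hb

/-- Once the base has been filled, the legs of a boundary contain all triangles, and also all
tetrahedra unless the boundary has dimension `2`. -/
lemma exists_isFiller_legs {b : bispanNerve _⦋n + 2⦌} {f : (∂Δ[n + 2] : SSet.{1}) ⟶ overFamily A}
    (hb : (base f).IsFiller b) (i : ι)
    (h : ∀ t, (legs hb i).Extends t → ∀ a b c d (hab : a < b) (hbc : b < c) (hcd : c < d),
      n = 0 → Tetra (t b c d hbc hcd) (t a c d (hab.trans hbc) hcd) (t a b d hab (hbc.trans hcd))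
        (t a b c hab hbc)) : ∃ l, (legs hb i).IsFiller l := by
  refine exists_isFiller_of_coversTri (coversEdges_of_hasFace fun a b => ?_)
    (fun a b c hab hbc => ?_) fun t ht a b c d hab hbc hcd => ?_
  · obtain ⟨j, h1, h2, -⟩ := exists_ne_of_lt (n := n + 2 + 2) (by lia) a b b
    exact ⟨j, hasFace_legs hb i j, h1, h2⟩
  · obtain ⟨j, h1, h2, h3⟩ := exists_ne_of_lt (n := n + 2 + 2) (by lia) a b c
    exact (hasFace_legs hb i j).coversTri hab.le hbc.le h1 h2 h3
  · by_cases hn : n = 0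
    · exact .inr (h t ht a b c d hab hbc hcd hn)
    obtain ⟨j, h1, h2, h3, h4⟩ := exists_ne_of_lt' (n := n + 2 + 2) (by lia) a b c d
    exact .inl ((hasFace_legs hb i j).coversTetra hab.le hbc.le hcd.le h1 h2 h3 h4)

lemma coversEdges_base {f : (∂Δ[n + 2] : SSet.{1}) ⟶ overFamily A} : (base f).CoversEdges := by
  refine coversEdges_of_hasFace fun a b => ?_
  obtain ⟨j, hj⟩ := exists_ne_of_card_lt (n := n + 3) {a, b}
    (Finset.card_le_two.trans_lt (by lia))
  have : j ≠ a ∧ j ≠ b := by simpa using hj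
  exact ⟨j, hasFace_base j, this⟩

lemma coversEdges_sides {f : (∂Δ[n + 2] : SSet.{1}) ⟶ overFamily A} (i : ι) :
    (sides f i).CoversEdges := by
  refine coversEdges_of_hasFace fun a b => ?_
  obtain ⟨j, hj, ha, hb⟩ := exists_ne_of_lt (n := n + 4) (by lia) (Fin.last (n + 3)) a b
  obtain ⟨j, rfl⟩ := Fin.exists_castSucc_eq.mpr hj
  exact ⟨j.castSucc, hasFace_sides i j, ha, hb⟩

end

section

variable {ι : Type} {A : ι → bispanNerve _⦋0⦌} {n : ℕ}
  {f : (∂Δ[n + 1] : SSet.{1}) ⟶ overFamily A} {P : FinSet} {ε : ι → Edge}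

variable (f P ε) in
/-- The last vertex of the boundary is a cone with vertex `P` and edges `ε`. -/
structure LastVertex : Prop where
  base : ((base f).simplex (vertexIdx f (Fin.last _))).x 0 = P
  sides : ∀ i, ((sides f i).simplex (vertexIdx f (Fin.last _))).edge 0 1 (Fin.zero_le _) = ε i

lemma LastVertex.x_eq (h : LastVertex f P ε) (k : (Matching.base f).ι)
    {a : Fin ((Matching.base f).m k + 1)}
    (ha : ((Matching.base f).f k).toOrderHom a = Fin.last (n + 1)) :
    ((Matching.base f).simplex k).x a = P :=
  (congrArg Edge.X ((Matching.base f).edge_eq (i := k) (j := vertexIdx f (Fin.last _)) (a' := 0)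
    (b' := 0) ha ha le_rfl le_rfl)).trans h.base

lemma LastVertex.Y_eq (h : LastVertex f P ε) (hc : (Matching.base f).CoversEdges)
    {e : ∀ a b : Fin (n + 2), a ≤ b → Edge} (he : (Matching.base f).ExtendsEdges e)
    (a : Fin (n + 2)) (ha) : (e a (Fin.last _) ha).Y = P := by
  obtain ⟨k, a', b', h1, rfl, hb⟩ := hc a _ ha
  have h2 := he k a' b' h1
  have h3 : e (((Matching.base f).f k).toOrderHom a') (Fin.last _) ha =
      ((Matching.base f).simplex k).edge a' b' h1 := by
    rw [h2]
    congr 1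
    exact hb.symm
  rw [h3]
  exact h.x_eq k hb

lemma LastVertex.edge_eq (h : LastVertex f P ε) {i : ι} {e : ∀ a b : Fin (n + 3), a ≤ b → Edge}
    (he : (Matching.sides f i).ExtendsEdges e) (h') :
    e (Fin.last (n + 1)).castSucc (Fin.last _) h' = ε i := by
  refine Eq.trans ?_ ((he (vertexIdx f (Fin.last _)) (Fin.castSucc (0 : Fin 1)) (Fin.last 1)
    (Fin.le_last _)).symm.trans (h.sides i))
  congr 1

end

section

variable {ι : Type} {A : ι → bispanNerve _⦋0⦌} {P : FinSet} {ε : ι → Edge}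

/-- Extension of cones in dimension `1`: a cone of bispans induces a bispan to the product. -/
lemma exists_extension_one [Finite ι] (hε : IsProjEdges P ε)
    {f : (∂Δ[0 + 1] : SSet.{1}) ⟶ overFamily A} (hf : LastVertex f P ε) :
    ∃ g : Δ[0 + 1] ⟶ overFamily A,
      (∂Δ[0 + 1] : (Δ[0 + 1] : SSet.{1}).Subcomplex).ι ≫ g = f := by
  let v0 := vertexIdx f 0
  let v1 := vertexIdx f (Fin.last 1)
  have h0 (i) : (((base f).simplex v0).edge 0 0 le_rfl).X = (((sides f i).simplex v0).edge 0 1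
      (Fin.zero_le _)).X := (congrArg Edge.X (sides_edge i v0 0 0 le_rfl)).symm
  have h1 (i) : ((sides f i).simplex v0).edge 1 1 le_rfl =
      ((sides f i).simplex v1).edge 1 1 le_rfl :=
    (sides f i).edge_eq (i := v0) (j := v1) rfl rfl le_rfl le_rfl
  obtain ⟨e, heX, heY, hT⟩ := hε.exists_tri
    (E := fun i => ((sides f i).simplex v0).edge 0 1 (Fin.zero_le _)) (fun i => (h0 i).symm)
    (fun i => (congrArg Edge.X (h1 i)).trans (congrArg Edge.Y (hf.sides i)))
  choose T hT2 hT1 hT0 using hT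
  let x : Fin 2 → FinSet := ![((base f).simplex v0).x 0, P]
  have hlt : ∀ a b : Fin 2, a < b → a = 0 ∧ b = 1 := by decide
  have hlt' : ∀ a b c : Fin 2, a < b → ¬ b < c := by decide
  have h01 : ∀ a : Fin 2, a = 0 ∨ a = 1 := by decide
  have hk : ∀ (k : (base f).ι) a b, ((base f).f k).toOrderHom a = ((base f).f k).toOrderHom b := by
    intro k a b
    obtain ⟨j, hj⟩ := base_ne k
    have h1 := hj a
    have h2 := hj b
    generalize ((base f).f k).toOrderHom a = a, ((base f).f k).toOrderHom b = b at h1 h2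
    clear hj
    revert a b j
    decide
  have hx : ∀ k a, ((base f).simplex k).x a = x (((base f).f k).toOrderHom a) := by
    intro k a
    rcases h01 (((base f).f k).toOrderHom a) with h | h
    · refine Eq.trans (congrArg Edge.X ((base f).edge_eq (i := k) (j := v0) (a := a) (b := a)
        (a' := 0) (b' := 0) h h le_rfl le_rfl)) ?_
      rw [h]
      rfl
    · refine (hf.x_eq k h).trans ?_
      rw [h]
      rfl
  obtain ⟨ν, hν, hνe, -⟩ := (base f).exists_isFiller_of_edges x
    (fun a b _ => if a = b then Edge.id (x a) else e) (fun _ _ _ _ _ => e.deg0)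
    (fun a => if_pos rfl)
    (fun a b h => by
      rcases h.eq_or_lt with rfl | h
      · rw [if_pos rfl]
        rfl
      · obtain ⟨rfl, rfl⟩ := hlt a b h
        exact heX)
    (fun a b h => by
      rcases h.eq_or_lt with rfl | h
      · rw [if_pos rfl]
        rfl
      · obtain ⟨rfl, rfl⟩ := hlt a b h
        exact heY)
    (fun k a b h => by
      rw [if_pos (hk k a b), ← hx]
      exact (base f).edge_eq_id (hk k a b) h)
    (fun k a b c hab hbc => absurd hbc (hlt' _ _ _ hab))
    (fun a b c hab hbc => absurd hbc (hlt' _ _ _ hab))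
    (fun a b c hab hbc => absurd hbc (hlt' _ _ _ hab))
    (fun a b c hab hbc => absurd hbc (hlt' _ _ _ hab))
    (fun a b c d hab hbc => absurd hbc (hlt' _ _ _ hab))
  refine exists_extension hν fun i => ?_
  have hc : (legs hν i).CoversEdges := coversEdges_of_hasFace fun a b => by
    obtain ⟨j, hj⟩ := exists_ne_of_card_lt (n := 3) {a, b}
      (Finset.card_le_two.trans_lt (by lia))
    have : j ≠ a ∧ j ≠ b := by simpa using hj
    exact ⟨j, hasFace_legs hν i j, this⟩
  obtain ⟨e', he'⟩ := (legs hν i).exists_extendsEdges hc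
  have h012 : ∀ a b c : Fin 3, a < b → b < c → a = 0 ∧ b = 1 ∧ c = 2 := by decide
  obtain ⟨l, hl, -⟩ := (legs hν i).exists_isFiller hc he' (fun _ _ _ _ _ => T i)
    (fun k a b c hab hbc => by
      obtain ⟨ha, hb, hc⟩ := h012 _ _ _ hab hbc
      rcases k with _ | k
      · exact absurd hc (Fin.castSucc_ne_last _)
      · have h1 : ∀ a, ((sides f i).f k).toOrderHom a ≠ Fin.last 2 →
            ∃ a' : Fin ((base f).m k + 1), a = a'.castSucc := fun a ha =>
          ⟨a.castPred fun h => ha (h ▸ sides_last i k), (Fin.castSucc_castPred _ _).symm⟩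
        obtain ⟨a, rfl⟩ := h1 a (ne_of_eq_of_ne ha (by decide))
        obtain ⟨b, rfl⟩ := h1 b (ne_of_eq_of_ne hb (by decide))
        refine absurd (hk k a b) fun h => ?_
        have h2 := (sides_castSucc i k a).symm.trans ha
        have h3 := (sides_castSucc i k b).symm.trans hb
        rw [h] at h2
        exact absurd (h2.symm.trans h3) (by decide))
    (fun a b c hab hbc => by
      obtain ⟨rfl, rfl, rfl⟩ := h012 a b c hab hbc
      refine ⟨(hT2 i).trans (Eq.trans ?_ (he' none (0 : Fin 2) (1 : Fin 2) (Fin.zero_le _))),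
        (hT1 i).trans (he' (some v0) (0 : Fin 2) (1 : Fin 2) (Fin.zero_le _)),
        (hT0 i).trans ((hf.sides i).symm.trans
          (he' (some v1) (0 : Fin 2) (1 : Fin 2) (Fin.zero_le _)))⟩
      exact (hνe 0 1 (by decide)).symm)
    (fun a b c d hab hbc hcd => by
      have := h012 a b c hab hbc
      have := h012 b c d hbc hcd
      simp_all)
  exact ⟨l, hl⟩

/-- Extension of cones in dimension `2`: the two-cell of the missing triangle exists because the
projections are jointly fully faithful. -/
lemma exists_extension_two (hε : IsProjEdges P ε)
    {f : (∂Δ[1 + 1] : SSet.{1}) ⟶ overFamily A} (hf : LastVertex f P ε) :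
    ∃ g : Δ[1 + 1] ⟶ overFamily A,
      (∂Δ[1 + 1] : (Δ[1 + 1] : SSet.{1}).Subcomplex).ι ≫ g = f := by
  have hc := coversEdges_base (f := f)
  obtain ⟨e, he⟩ := (base f).exists_extendsEdges hc
  have hY := hf.Y_eq hc he
  have hn : ¬ (base f).CoversTri 0 1 2 := by
    rintro ⟨k, a, b, c, -, -, ha, hb, hc⟩
    obtain ⟨j, hj⟩ := base_ne k
    have : ∀ j : Fin 3, j = 0 ∨ j = 1 ∨ j = 2 := by decide
    rcases this j with rfl | rfl | rfl
    exacts [hj _ ha, hj _ hb, hj _ hc]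
  choose e' he' using fun i => (sides f i).exists_extendsEdges (coversEdges_sides i)
  have hes := fun i => he.sides_eq hc (he' i)
  choose t ht _ using fun i => (sides f i).exists_extends (e 0 0 le_rfl).deg0
  have hci (i : ι) (j : Fin 3) (a b c : Fin 4) (h : a < b ∧ b < c ∧ j.castSucc ≠ a ∧
      j.castSucc ≠ b ∧ j.castSucc ≠ c) : (sides f i).CoversTri a b c :=
    (hasFace_sides i j).coversTri h.1.le h.2.1.le h.2.2.1 h.2.2.2.1 h.2.2.2.2
  have c123 := fun i => hci i 0 1 2 3 (by decide)
  have c023 := fun i => hci i 1 0 2 3 (by decide)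
  have c013 := fun i => hci i 2 0 1 3 (by decide)
  have f123 := fun i => (ht i).fitsEdges (he' i) (c123 i) (by decide) (by decide)
  have f023 := fun i => (ht i).fitsEdges (he' i) (c023 i) (by decide) (by decide)
  have f013 := fun i => (ht i).fitsEdges (he' i) (c013 i) (by decide) (by decide)
  have hX : (e 0 2 (by decide)).X = (e 0 1 (by decide)).X :=
    (he.X_eq hc _ _ _).trans (he.X_eq hc _ _ _).symm
  have hXY : (e 0 1 (by decide)).Y = (e 1 2 (by decide)).X :=
    (he.Y_eq hc _ _ _).trans (he.X_eq hc _ _ _).symm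
  obtain ⟨T, hT2, hT1, hT0, hT⟩ := hε.exists_tetra hX hXY (hY 1 (by decide)) (hY 0 (by decide))
    (fun i => (f123 i).1.trans (hes i 1 2 _)) (fun i => (f123 i).2.2.trans (hf.edge_eq (he' i) _))
    (fun i => (f023 i).1.trans (hes i 0 2 _)) (fun i => (f023 i).2.2.trans (hf.edge_eq (he' i) _))
    (fun i => (f013 i).1.trans (hes i 0 1 _)) (fun i => (f013 i).2.2.trans (f123 i).2.1.symm)
    (fun i => (f013 i).2.1.trans (f023 i).2.1.symm)
  obtain ⟨t', ht', h0⟩ := (base f).exists_extends T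
  have h012 : ∀ a b c : Fin 3, a < b → b < c → a = 0 ∧ b = 1 ∧ c = 2 := by decide
  obtain ⟨ν, hν, hνt⟩ := (base f).exists_isFiller hc he t' ht'
    (fun a b c hab hbc => by
      obtain ⟨rfl, rfl, rfl⟩ := h012 a b c hab hbc
      rw [h0 _ _ _ _ _ hn]
      exact ⟨hT2, hT1, hT0⟩)
    (fun a b c d hab hbc hcd => by
      have := h012 a b c hab hbc
      have := h012 b c d hbc hcd
      simp_all)
  refine exists_extension hν fun i => exists_isFiller_legs hν i
    fun t'' ht'' a b c d hab hbc hcd _ => ?_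
  obtain ⟨rfl, rfl, rfl, rfl⟩ : a = 0 ∧ b = 1 ∧ c = 2 ∧ d = 3 := by
    lia
  have ht3 : (sides f i).Extends t'' := fun k => ht'' (some k)
  have e012 : t'' 0 1 2 hab hbc = T :=
    (ht'' none (0 : Fin 3) (1 : Fin 3) (2 : Fin 3) hab hbc hab.le hbc.le).trans
      ((hνt 0 1 2 (by decide) (by decide)).trans (h0 _ _ _ _ _ hn))
  rw [e012, ht3.eq (ht i) (c123 i), ht3.eq (ht i) (c023 i), ht3.eq (ht i) (c013 i)]
  exact hT i

/-- Extension of cones in dimension `3`: the triangles of the base are given, and they satisfy the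
cocycle condition because they do so after composition with the projections. -/
lemma exists_extension_three (hε : IsProjEdges P ε)
    {f : (∂Δ[2 + 1] : SSet.{1}) ⟶ overFamily A} (hf : LastVertex f P ε) :
    ∃ g : Δ[2 + 1] ⟶ overFamily A,
      (∂Δ[2 + 1] : (Δ[2 + 1] : SSet.{1}).Subcomplex).ι ≫ g = f := by
  have hc := coversEdges_base (f := f)
  obtain ⟨e, he⟩ := (base f).exists_extendsEdges hc
  have hY := hf.Y_eq hc he
  have hct : ∀ a b c : Fin 4, a < b → b < c → (base f).CoversTri a b c := by
    intro a b c hab hbc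
    obtain ⟨j, h1, h2, h3⟩ := exists_ne_of_lt (n := 4) (by lia) a b c
    exact (hasFace_base j).coversTri hab.le hbc.le h1 h2 h3
  choose e' he' using fun i => (sides f i).exists_extendsEdges (coversEdges_sides i)
  choose t ht _ using fun i => (sides f i).exists_extends (e 0 0 le_rfl).deg0
  obtain ⟨ν, hν⟩ := exists_isFiller_of_coversTri hc hct
    (fun t' ht' a b c d hab hbc hcd => .inr (by
      obtain ⟨rfl, rfl, rfl, rfl⟩ : a = 0 ∧ b = 1 ∧ c = 2 ∧ d = 3 := by
        lia
      have hs := fun i a b c hab hbc => ht'.sides_eq (ht i) hab hbc (hct a b c hab hbc)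
      have hci (i : ι) (j : Fin 4) (a b c d : Fin 5) (h : a < b ∧ b < c ∧ c < d ∧
          j.castSucc ≠ a ∧ j.castSucc ≠ b ∧ j.castSucc ≠ c ∧ j.castSucc ≠ d) :=
        (ht i).tetra ((hasFace_sides i j).coversTetra h.1.le h.2.1.le h.2.2.1.le h.2.2.2.1
          h.2.2.2.2.1 h.2.2.2.2.2.1 h.2.2.2.2.2.2) h.1 h.2.1 h.2.2.1
      have f' := fun a b c hab hbc => ht'.fitsEdges he (hct a b c hab hbc) hab hbc
      refine hε.tetra_of_forall ((f' _ _ _ _ _).2.2.trans (f' _ _ _ _ _).1.symm)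
        ((f' _ _ _ _ _).1.trans (f' _ _ _ _ _).1.symm)
        ((f' _ _ _ _ _).2.1.trans (f' _ _ _ _ _).1.symm)
        ((f' _ _ _ _ _).2.1.trans (f' _ _ _ _ _).2.2.symm)
        ((f' _ _ _ _ _).2.2.trans (f' _ _ _ _ _).2.2.symm)
        ((f' _ _ _ _ _).2.1.trans (f' _ _ _ _ _).2.1.symm)
        ((congrArg Edge.Y (f' _ _ _ _ _).2.2).trans (hY _ _))
        (T234 := fun i => t i 2 3 4 (by decide) (by decide))
        (T134 := fun i => t i 1 3 4 (by decide) (by decide))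
        (T034 := fun i => t i 0 3 4 (by decide) (by decide))
        (T124 := fun i => t i 1 2 4 (by decide) (by decide))
        (T024 := fun i => t i 0 2 4 (by decide) (by decide))
        (T014 := fun i => t i 0 1 4 (by decide) (by decide)) (fun i => ?_) (fun i => ?_)
        (fun i => ?_) (fun i => ?_) (fun i => ?_)
      · exact ((ht i).fitsEdges (he' i) ((hasFace_sides i 0).coversTri (by decide) (by decide)
          (by decide) (by decide) (by decide)) (by decide) (by decide)).2.2.trans
          (hf.edge_eq (he' i) _)
      · rw [← hs i 1 2 3]
        exact hci i 0 1 2 3 4 (by decide)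
      · rw [← hs i 0 2 3]
        exact hci i 1 0 2 3 4 (by decide)
      · rw [← hs i 0 1 3]
        exact hci i 2 0 1 3 4 (by decide)
      · rw [← hs i 0 1 2]
        exact hci i 3 0 1 2 4 (by decide)))
  exact exists_extension hν fun i => exists_isFiller_legs hν i fun _ _ _ _ _ _ _ _ _ h =>
    absurd h (by decide)

end

end Matching

/-- A cone in the nerve is a product cone if its edges are product projections. -/
theorem isProductCone_of_isProjEdges {ι : Type} [Finite ι] {A : ι → bispanNerve _⦋0⦌}
    (c : OverSimplex A ⦋0⦌) (hc : IsProjEdges (NSimplex.x (n := 0) c.base 0)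
      fun i => NSimplex.edge (n := 1) (c.leg i) 0 1 (by decide)) :
    IsProductCone A c := by
  intro n f hf
  have hv : Matching.boundaryFace f (Matching.vertexIdx f (Fin.last _)) = c := hf _ rfl
  have hl : Matching.LastVertex f (NSimplex.x (n := 0) c.base 0)
      fun i => NSimplex.edge (n := 1) (c.leg i) 0 1 (by decide) :=
    ⟨congrArg (fun c : OverSimplex A ⦋0⦌ => NSimplex.x (n := 0) c.base 0) hv, fun i =>
      congrArg (fun c : OverSimplex A ⦋0⦌ => NSimplex.edge (n := 1) (c.leg i) 0 1 (by decide)) hv⟩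
  rcases n with _ | _ | _ | n
  · exact Matching.exists_extension_one hc hl
  · exact Matching.exists_extension_two hc hl
  · exact Matching.exists_extension_three hc hl
  · obtain ⟨ν, hν⟩ := Matching.exists_isFiller_of_coversTri (F := Matching.base f)
      Matching.coversEdges_base (fun a b c hab hbc => by
        obtain ⟨j, h1, h2, h3⟩ := exists_ne_of_lt (n := n + 5) (by lia) a b c
        exact (Matching.hasFace_base j).coversTri hab.le hbc.le h1 h2 h3)
      fun t ht a b c d hab hbc hcd => .inl (by
        obtain ⟨j, h1, h2, h3, h4⟩ := exists_ne_of_lt' (n := n + 5) (by lia) a b c d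
        exact (Matching.hasFace_base j).coversTetra hab.le hbc.le hcd.le h1 h2 h3 h4)
    exact Matching.exists_extension hν fun i => Matching.exists_isFiller_legs hν i
      fun _ _ _ _ _ _ _ _ _ h => absurd h (by lia)

/-! ### Pullbacks and cromulent diagrams of finite sets in terms of elements -/

lemma existsUnique_of_isPullback {W X Y Z : FinSet} {f : W ⟶ X} {g : W ⟶ Y} {h : X ⟶ Z}
    {k : Y ⟶ Z} (H : IsPullback f g h k) (x : X) (y : Y) (hxy : h x = k y) :
    ∃! w : W, f w = x ∧ g w = y := by
  let pt : FinSet := FintypeCat.of PUnit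
  let x' : pt ⟶ X := FintypeCat.homMk fun _ => x
  let y' : pt ⟶ Y := FintypeCat.homMk fun _ => y
  have hc : x' ≫ h = y' ≫ k := by
    ext
    exact hxy
  refine ⟨H.lift x' y' hc PUnit.unit, ⟨ConcreteCategory.congr_hom (H.lift_fst x' y' hc) PUnit.unit,
    ConcreteCategory.congr_hom (H.lift_snd x' y' hc) PUnit.unit⟩, ?_⟩
  rintro w ⟨h1, h2⟩
  have : (FintypeCat.homMk fun _ => w : pt ⟶ W) = H.lift x' y' hc := by
    apply H.hom_ext
    · rw [H.lift_fst]
      ext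
      exact h1
    · rw [H.lift_snd]
      ext
      exact h2
  exact ConcreteCategory.congr_hom this PUnit.unit

section

variable {A B B' X Y Z : FinSet} {a : A ⟶ X} {f : Y ⟶ X} {g : Y ⟶ Z} {t : B ⟶ A} {u : B ⟶ B'}
  {b : B ⟶ Y} {c : B' ⟶ Z}

/-- A diagram is cromulent if its right-hand square is a pullback and `B'` is the dependent product
of `A` along `Y → Z`: an element of `B'` over `z` is a section of `A` over the fibre of `z`. -/
lemma isCromulent_of_forall (h : t ≫ a = b ≫ f) (h' : u ≫ c = b ≫ g)
    (pull : ∀ (y : Y) (β : B'), g y = c β → ∃! e : B, b e = y ∧ u e = β)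
    (sect : ∀ (z : Z) (k : ∀ y : Y, g y = z → A), (∀ y hy, a (k y hy) = f y) →
      ∃! β : B', c β = z ∧ ∀ (e : B) y hy, u e = β → b e = y → t e = k y hy) :
    IsCromulent a f g t u b c where
  comm := h
  isPullback := isPullback_of_existsUnique _ _ _ _ h' fun β y e => by
    obtain ⟨e, ⟨h1, h2⟩, h3⟩ := pull y β e.symm
    exact ⟨e, ⟨h2, h1⟩, fun e' he => h3 e' ⟨he.2, he.1⟩⟩
  terminal {P P'} t' u' b' c' hP := by
    have hc : ∀ p, a (t' p) = f (b' p) := ConcreteCategory.congr_hom hP.comm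
    have hw : ∀ p, c' (u' p) = g (b' p) := ConcreteCategory.congr_hom hP.isPullback.w
    have hp : ∀ (p' : P') (y : Y), g y = c' p' → ∃! p : P, u' p = p' ∧ b' p = y := fun p' y e =>
      existsUnique_of_isPullback hP.isPullback p' y e.symm
    choose p hp1 hp2 using hp
    have hk : ∀ p' y hy, a (t' (p p' y hy)) = f y := fun p' y hy => by
      rw [hc, (hp1 p' y hy).2]
    choose r hr1 hr2 using fun p' => sect (c' p') (fun y hy => t' (p p' y hy)) (hk p')
    choose q hq1 hq2 using fun x : P => pull (b' x) (r (u' x)) (by rw [(hr1 _).1, hw])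
    have hqt : ∀ x, t (q x) = t' x := fun x => by
      rw [(hr1 (u' x)).2 (q x) (b' x) (hw x).symm (hq1 x).2 (hq1 x).1]
      exact congrArg t' (hp2 _ _ _ _ ⟨rfl, rfl⟩).symm
    refine ⟨(FintypeCat.homMk q, FintypeCat.homMk r), ⟨?_, ?_, ?_, ?_⟩, ?_⟩
    · ext x
      exact hqt x
    · ext x
      exact (hq1 x).2
    · ext x
      exact (hq1 x).1
    · ext x
      exact (hr1 x).1
    · rintro ⟨q', r'⟩ ⟨h1, h2, h3, h4⟩
      have h1' : ∀ x, t (q' x) = t' x := ConcreteCategory.congr_hom h1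
      have h2' : ∀ x, u (q' x) = r' (u' x) := ConcreteCategory.congr_hom h2
      have h3' : ∀ x, b (q' x) = b' x := ConcreteCategory.congr_hom h3
      have h4' : ∀ x, c (r' x) = c' x := ConcreteCategory.congr_hom h4
      have hr : ∀ x, r' x = r x := fun x => hr2 x (r' x) ⟨h4' x, fun e y hy he he' => by
        have : e = q' (p x y hy) := by
          have h5 := hp1 x y hy
          exact (pull y (r' x) (hy.trans (h4' x).symm)).unique ⟨he', he⟩
            ⟨by rw [h3', h5.2], by rw [h2', h5.1]⟩
        rw [this, h1']⟩
      have hq : ∀ x, q' x = q x := fun x => hq2 x (q' x) ⟨h3' x, by rw [h2', hr]⟩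
      refine Prod.ext ?_ ?_
      · ext x
        exact hq x
      · ext x
        exact hr x

lemma IsCromulent.pull (H : IsCromulent a f g t u b c) (y : Y) (β : B') (e : g y = c β) :
    ∃! e : B, b e = y ∧ u e = β := by
  obtain ⟨x, ⟨h1, h2⟩, h3⟩ := existsUnique_of_isPullback H.isPullback β y e.symm
  exact ⟨x, ⟨h2, h1⟩, fun e' he => h3 e' ⟨he.2, he.1⟩⟩

/-- The dependent product in a cromulent diagram: a section over the fibre of `z` is a precromulent
diagram whose `B'` is a point. -/
lemma IsCromulent.sect (H : IsCromulent a f g t u b c) (z : Z) (k : ∀ y : Y, g y = z → A)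
    (hk : ∀ y hy, a (k y hy) = f y) :
    ∃! β : B', c β = z ∧ ∀ (e : B) y hy, u e = β → b e = y → t e = k y hy := by
  have hcu : ∀ x, c (u x) = g (b x) := ConcreteCategory.congr_hom H.isPullback.w
  let P : FinSet := FintypeCat.of { y : Y // g y = z }
  let P' : FinSet := FintypeCat.of PUnit
  let t' : P ⟶ A := FintypeCat.homMk fun y => k y.1 y.2
  let u' : P ⟶ P' := FintypeCat.homMk fun _ => PUnit.unit
  let b' : P ⟶ Y := FintypeCat.homMk fun y => y.1
  let c' : P' ⟶ Z := FintypeCat.homMk fun _ => z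
  have hP : IsPrecromulent a f g t' u' b' c' := by
    refine ⟨?_, isPullback_of_existsUnique _ _ _ _ ?_ fun x y e =>
      ⟨⟨y, e.symm⟩, ⟨rfl, rfl⟩, fun w hw => Subtype.ext hw.2⟩⟩
    · ext y
      exact hk y.1 y.2
    · ext y
      exact y.2.symm
  obtain ⟨⟨r, r'⟩, ⟨h1, h2, h3, h4⟩, hr⟩ := H.terminal t' u' b' c' hP
  have h1' : ∀ y : P, t (r y) = k y.1 y.2 := ConcreteCategory.congr_hom h1
  have h2' : ∀ y : P, u (r y) = r' PUnit.unit := ConcreteCategory.congr_hom h2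
  have h3' : ∀ y : P, b (r y) = y.1 := ConcreteCategory.congr_hom h3
  have h4' : c (r' PUnit.unit) = z := ConcreteCategory.congr_hom h4 PUnit.unit
  refine ⟨r' PUnit.unit, ⟨h4', fun e y hy he he' => ?_⟩, fun β hβ => ?_⟩
  · have : e = r ⟨y, hy⟩ := (H.pull y (r' PUnit.unit) (hy.trans h4'.symm)).unique ⟨he', he⟩
      ⟨h3' _, h2' _⟩
    rw [this, h1']
  · choose q hq _ using fun y : P => H.pull y.1 β (y.2.trans hβ.1.symm)
    have := hr (FintypeCat.homMk q, FintypeCat.homMk fun _ => β) ⟨?_, ?_, ?_, ?_⟩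
    · exact ConcreteCategory.congr_hom (congrArg Prod.snd this) PUnit.unit
    · ext y
      exact hβ.2 (q y) y.1 y.2 (hq y).2 (hq y).1
    · ext y
      exact (hq y).2
    · ext y
      exact (hq y).1
    · ext y
      exact hβ.1

end

/-! ### Simplices of `RSpan` as maps from the distributahedron -/

/-- For a simplex `c = a₀ ⋯ a_q | b₀ ⋯ b_p`, the map of posets `([i, j], k) ↦ (a_k, [b_i, b_j])`. -/
def DistCell.idx {n p q : ℕ} (c : DistCell.{u} n p q) : Grid p q →o DistIdx n where
  toFun x := ⟨c.a x.lev, c.b x.int.lo, c.b x.int.hi, c.le' _ _, c.b.monotone x.int.le⟩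
  monotone' _ _ h := ⟨c.a.monotone h.2, c.b.monotone h.1.1, c.b.monotone h.1.2⟩

/-- The functors which correspond to the simplices of `RSpan`: their restriction to each cell of
the distributahedron is a simplex of `timesPlus`. -/
def IsRFunctor {n : ℕ} (W : DistIdx n ⥤ FinSet) : Prop :=
  ∀ (p q : ℕ) (c : DistCell.{1} n p q), IsDistDiagram (c.idx.monotone.functor ⋙ W)

/-- The underlying functor. -/
def RSimplex.functor {n : ℕ} (R : RSimplex n) : DistIdx n ⥤ FinSet where
  obj := R.obj
  map f := FintypeCat.homMk fun x => R.m _ x (leOfHom f)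
  map_id s := by
    ext x
    exact R.m_refl s x
  map_comp f g := by
    ext x
    exact (R.m_comp (leOfHom f) (leOfHom g) x).symm

lemma RSimplex.isRFunctor {n : ℕ} (R : RSimplex n) : IsRFunctor R.functor := by
  intro p q c
  refine ⟨fun k i k' j l hik hkj hjl => ?_, fun i j hij k l hkl => ?_⟩
  · refine isPullback_of_existsUnique _ _ _ _ ?_ fun x y e =>
      R.row _ _ _ _ _ (c.le' k i) (c.b.monotone hik) (c.b.monotone hkj) (c.b.monotone hjl) x y e
    ext x
    exact (R.m_comp _ _ x).trans (R.m_comp _ _ x).symm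
  · refine isCromulent_of_forall ?_ ?_
      (fun y β e => R.pull _ _ _ _ (c.a.monotone hkl) (c.le' l i) (c.b.monotone hij) y β e)
      (fun z k' hk' => R.sect _ _ _ _ (c.a.monotone hkl) (c.le' l i) (c.b.monotone hij) z k' hk')
    · ext x
      exact (R.m_comp _ _ x).trans (R.m_comp _ _ x).symm
    · ext x
      exact (R.m_comp _ _ x).trans (R.m_comp _ _ x).symm

/-- The ordered map with the given values. -/
def ordMap2 {n : ℕ} (a b : Fin (n + 1)) (h : a ≤ b) : Fin 2 →o Fin (n + 1) where
  toFun := ![a, b]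
  monotone' := by
    intro i j hij
    fin_cases i <;> fin_cases j <;> simp_all

/-- The ordered map with the given values. -/
def ordMap4 {n : ℕ} (a b c d : Fin (n + 1)) (hab : a ≤ b) (hbc : b ≤ c) (hcd : c ≤ d) :
    Fin 4 →o Fin (n + 1) where
  toFun := ![a, b, c, d]
  monotone' := by
    have := hab.trans hbc
    have := hbc.trans hcd
    have := hab.trans this
    intro i j hij
    fin_cases i <;> fin_cases j <;> simp_all

/-- The simplex of `RSpan` corresponding to a functor. -/
def RSimplex.ofFunctor {n : ℕ} (W : DistIdx n ⥤ FinSet) (h : IsRFunctor W) : RSimplex n where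
  obj := W.obj
  m t x h := W.map (homOfLE h) x
  m_refl s x := by
    change W.map (𝟙 s) x = x
    rw [W.map_id]
    rfl
  m_comp h h' x := by
    rw [← homOfLE_comp h h', W.map_comp]
    rfl
  row a i k j l hai hik hkj hjl x y e := by
    have H := (h 3 0 ⟨⟨fun _ => a, fun _ _ _ => le_rfl⟩,
      ordMap4 i k j l hik hkj hjl, hai⟩).row 0 0 1 2 3 (by decide) (by decide) (by decide)
    exact existsUnique_of_isPullback H x y e
  pull a a' b c haa hab hbc y β e :=
    ((h 1 1 ⟨ordMap2 a a' haa, ordMap2 b c hbc, hab⟩).cromulent 0 1 (by decide) 0 1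
      (by decide)).pull y β e
  sect a a' b c haa hab hbc z k hk :=
    ((h 1 1 ⟨ordMap2 a a' haa, ordMap2 b c hbc, hab⟩).cromulent 0 1 (by decide) 0 1
      (by decide)).sect z k hk

lemma RSimplex.functor_injective {n : ℕ} {R R' : RSimplex n} (h : R.functor = R'.functor) :
    R = R' := by
  have h' : ∀ R : RSimplex n, R = RSimplex.ofFunctor R.functor R.isRFunctor := fun _ => rfl
  rw [h' R, h' R']
  congr 1

/-- The comparison map to `RSpan`, which restricts a functor on triples to the cells of the
distributahedron. It is an isomorphism, because these cells cover all triples. -/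
def toRSpan : ringSpans ⟶ RSpan where
  app _ := ↾fun (R : RSimplex _) =>
    { app := fun _ => ↾fun c => ⟨c.idx.monotone.functor ⋙ R.functor, R.isRFunctor _ _ c⟩
      naturality := fun _ _ _ => rfl }
  naturality _ _ _ := rfl

/-- A map of finite sets together with its source and its target. -/
structure FinMap : Type 1 where
  X : FinSet
  Y : FinSet
  f : X ⟶ Y

section

variable {n : ℕ} (Φ : distributahedron.{1}.obj ⦋n⦌ ⟶ timesPlus)

/-- The value of a map from the distributahedron at a cell. -/
def cellFunctor {p q : ℕ} (c : DistCell.{1} n p q) : Grid p q ⥤ FinSet :=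
  (Φ.app (op (⦋p⦌, ⦋q⦌)) c).1

/-- The restriction of a cell. -/
def DistCell.comp {p q p' q' : ℕ} (c : DistCell.{1} n p q) (f : Fin (p' + 1) →o Fin (p + 1))
    (g : Fin (q' + 1) →o Fin (q + 1)) : DistCell.{1} n p' q' :=
  ⟨c.a.comp g, c.b.comp f, c.le' _ _⟩

lemma cellFunctor_comp {p q p' q' : ℕ} (c : DistCell.{1} n p q)
    (f : Fin (p' + 1) →o Fin (p + 1)) (g : Fin (q' + 1) →o Fin (q + 1)) :
    cellFunctor Φ (c.comp f g) = (Grid.map f g).monotone.functor ⋙ cellFunctor Φ c := by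
  have := NatTrans.naturality_apply Φ (X := op (⦋p⦌, ⦋q⦌)) (Y := op (⦋p'⦌, ⦋q'⦌))
    (Prod.mkHom (SimplexCategory.Hom.mk f) (SimplexCategory.Hom.mk g)).op c
  exact congrArg Subtype.val this

/-- The map in the diagram `cellFunctor Φ c` between two elements of the grid. -/
def cellMap {p q : ℕ} (c : DistCell.{1} n p q) {x y : Grid p q} (h : x ≤ y) : FinMap :=
  ⟨_, _, (cellFunctor Φ c).map (homOfLE h)⟩

variable {Φ} in
/-- The maps in the diagrams at two cells agree if they have the same indices. -/
lemma cellMap_eq {p q p' q' : ℕ} {c : DistCell.{1} n p q} {c' : DistCell.{1} n p' q'}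
    {x y : Grid p q} (h : x ≤ y) {x' y' : Grid p' q'} (h' : x' ≤ y')
    (hx : c.idx x = c'.idx x') (hy : c.idx y = c'.idx y') : cellMap Φ c h = cellMap Φ c' h' := by
  have key : ∀ {p q : ℕ} (c : DistCell.{1} n p q) {x y : Grid p q} (h : x ≤ y),
      cellMap Φ c h = cellMap Φ (c.comp (ordMap4 x.int.lo y.int.lo y.int.hi x.int.hi h.1.1 y.int.le
        h.1.2) (ordMap2 x.lev y.lev h.2)) (x := ⟨⟨0, 3, by decide⟩, 0⟩)
        (y := ⟨⟨1, 2, by decide⟩, 1⟩) ⟨⟨by decide, by decide⟩, by decide⟩ := by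
    intro p q c x y h
    rw [cellMap, cellMap, cellFunctor_comp]
    rfl
  rw [key c h, key c' h']
  have h1 := congrArg DistIdx.a hx
  have h2 := congrArg DistIdx.b hx
  have h3 := congrArg DistIdx.c hx
  have h4 := congrArg DistIdx.a hy
  have h5 := congrArg DistIdx.b hy
  have h6 := congrArg DistIdx.c hy
  congr 1
  refine DistCell.ext (OrderHom.ext _ _ (funext fun i => ?_))
    (OrderHom.ext _ _ (funext fun i => ?_))
  · fin_cases i
    exacts [h1, h4]
  · fin_cases i
    exacts [h2, h5, h6, h3]

/-- A cell which contains all the indices `(a, [b, c])` with `a ≤ e ≤ b`. -/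
def pivotCell (e : Fin (n + 1)) : DistCell.{1} n n n where
  a := ⟨fun i => min i e, fun _ _ h => min_le_min_right e h⟩
  b := ⟨fun i => max i e, fun _ _ h => max_le_max_right e h⟩
  le := (min_le_right _ _).trans (le_max_right _ _)

/-- The index `s` as an element of the grid of a pivot cell. -/
def DistIdx.toGrid (s : DistIdx n) : Grid n n := ⟨⟨s.b, s.c, s.hbc⟩, s.a⟩

lemma idx_pivotCell (e : Fin (n + 1)) (s : DistIdx n) (h : s.a ≤ e) (h' : e ≤ s.b) :
    (pivotCell e).idx s.toGrid = s :=
  DistIdx.ext (min_eq_left h) (max_eq_left h') (max_eq_left (h'.trans s.hbc))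

/-- The map attached to two indices which lie in a common cell. -/
def idxMap (s t : DistIdx n) (h : s ≤ t) : FinMap :=
  cellMap Φ (pivotCell t.a) (x := s.toGrid) (y := t.toGrid) ⟨h.2, h.1⟩

variable {Φ} in
lemma cellMap_eq_idxMap {p q : ℕ} (c : DistCell.{1} n p q) {x y : Grid p q} (h : x ≤ y) :
    cellMap Φ c h = idxMap Φ (c.idx x) (c.idx y) (c.idx.monotone h) :=
  cellMap_eq _ _ (idx_pivotCell _ (c.idx x) (c.a.monotone h.2) (c.le' _ _)).symm
    (idx_pivotCell _ (c.idx y) le_rfl (c.le' _ _)).symm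

lemma FinMap.comp_congr {X Y Z X' Y' Z' : FinSet} {f : X ⟶ Y} {g : Y ⟶ Z} {f' : X' ⟶ Y'}
    {g' : Y' ⟶ Z'} (h : FinMap.mk _ _ f = ⟨_, _, f'⟩) (h' : FinMap.mk _ _ g = ⟨_, _, g'⟩) :
    FinMap.mk _ _ (f ≫ g) = ⟨_, _, f' ≫ g'⟩ := by
  cases h
  cases h'
  rfl

lemma FinMap.eq_of_mk_eq {X Y : FinSet} {f g : X ⟶ Y} (h : FinMap.mk _ _ f = ⟨_, _, g⟩) :
    f = g := by
  cases h
  rfl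

/-- The diagrams at the cells glue to a functor on triples. A map `s ⟶ t` with `t.a ≤ s.b` is
contained in a cell; a general one is the composite of two such maps through the index
`(s.a, [t.b, t.c])`. -/
lemma exists_functor : ∃ W : DistIdx n ⥤ FinSet, ∀ (p q : ℕ) (c : DistCell.{1} n p q),
    cellFunctor Φ c = c.idx.monotone.functor ⋙ W := by
  have hp : ∀ (s t : DistIdx n) (h : s ≤ t) (e : Fin (n + 1)), t.a ≤ e → e ≤ s.b →
      cellMap Φ (pivotCell e) (x := s.toGrid) (y := t.toGrid) ⟨h.2, h.1⟩ = idxMap Φ s t h :=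
    fun s t h e h1 h2 => cellMap_eq _ _
      ((idx_pivotCell e s (h.1.trans h1) h2).trans (idx_pivotCell t.a s h.1 (h1.trans h2)).symm)
      ((idx_pivotCell e t h1 (h2.trans h.2.1)).trans (idx_pivotCell t.a t le_rfl t.hab).symm)
  let obj : DistIdx n → FinSet := fun s => (idxMap Φ s s le_rfl).X
  have hm : ∀ (s t : DistIdx n) (h : s ≤ t), t.a ≤ s.b →
      ∃ m : obj s ⟶ obj t, idxMap Φ s t h = ⟨_, _, m⟩ := by
    intro s t h h'
    have h1 : (idxMap Φ s t h).X = obj s := by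
      have h1 := congrArg FinMap.X (hp s s le_rfl t.a h.1 h')
      exact h1
    have h2 : (idxMap Φ s t h).Y = obj t := rfl
    generalize idxMap Φ s t h = F at h1 h2
    obtain ⟨X, Y, F⟩ := F
    cases h1
    cases h2
    exact ⟨F, rfl⟩
  choose m hm using hm
  have m_id : ∀ s, m s s le_rfl s.hab = 𝟙 _ := by
    intro s
    refine FinMap.eq_of_mk_eq ((hm s s le_rfl s.hab).symm.trans ?_)
    exact congrArg (FinMap.mk _ _) (CategoryTheory.Functor.map_id _ _)
  have m_comp : ∀ (s t u : DistIdx n) (h : s ≤ t) (h' : t ≤ u) (h1 : u.a ≤ s.b),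
      m s t h (h'.1.trans h1) ≫ m t u h' (h1.trans h.2.1) = m s u (h.trans h') h1 := by
    intro s t u h h' h1
    refine FinMap.eq_of_mk_eq (Eq.trans ?_ ((hp s u (h.trans h') u.a le_rfl h1).trans
      (hm s u (h.trans h') h1)))
    refine (FinMap.comp_congr
      ((hp s t h u.a h'.1 h1).trans (hm s t h (h'.1.trans h1)))
      ((hp t u h' u.a le_rfl (h1.trans h.2.1)).trans (hm t u h' (h1.trans h.2.1)))).symm.trans ?_
    exact congrArg (FinMap.mk _ _) (CategoryTheory.Functor.map_comp _ _ _).symm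
  let mid : ∀ (s t : DistIdx n), s ≤ t → DistIdx n := fun s t h =>
    ⟨s.a, t.b, t.c, h.1.trans t.hab, t.hbc⟩
  have hmid1 : ∀ s t h, s ≤ mid s t h := fun s t h => ⟨le_rfl, h.2⟩
  have hmid2 : ∀ s t h, mid s t h ≤ t := fun s t h => ⟨h.1, le_rfl, le_rfl⟩
  let w : ∀ (s t : DistIdx n), s ≤ t → (obj s ⟶ obj t) := fun s t h =>
    m s (mid s t h) (hmid1 s t h) s.hab ≫ m (mid s t h) t (hmid2 s t h) t.hab
  have w_comp : ∀ (s t u : DistIdx n) (h : s ≤ t) (h' : t ≤ u),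
      w s u (h.trans h') = w s t h ≫ w t u h' := by
    intro s t u h h'
    have h1 : mid s t h ≤ mid s u (h.trans h') := ⟨le_rfl, h'.2⟩
    have h2 : mid s u (h.trans h') ≤ mid t u h' := ⟨h.1, le_rfl, le_rfl⟩
    have e1 := m_comp s (mid s t h) (mid s u (h.trans h')) (hmid1 s t h) h1 s.hab
    have e2 := m_comp (mid s u (h.trans h')) (mid t u h') u h2 (hmid2 t u h') u.hab
    have e3 := m_comp (mid s t h) t (mid t u h') (hmid2 s t h) (hmid1 t u h') t.hab
    have e4 := m_comp (mid s t h) (mid s u (h.trans h')) (mid t u h') h1 h2 t.hab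
    dsimp only [w]
    rw [← e1, ← e2, Category.assoc, Category.assoc, reassoc_of% e3, ← reassoc_of% e4]
  let W : DistIdx n ⥤ FinSet :=
    { obj := obj
      map := fun {s t} f => w s t (leOfHom f)
      map_id := fun s => (m_comp s s s le_rfl le_rfl s.hab).trans (m_id s)
      map_comp := fun {s t u} f g => w_comp s t u (leOfHom f) (leOfHom g) }
  refine ⟨W, fun p q c => ?_⟩
  refine CategoryTheory.Functor.hext (fun x => ?_) fun x y f => ?_
  · exact congrArg FinMap.X ((cellMap_eq_idxMap c (le_refl x)).trans (hm _ _ le_rfl (c.le' _ _)))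
  · have h := leOfHom f
    have h1 := (cellMap_eq_idxMap c h).trans (hm _ _ (c.idx.monotone h) (c.le' _ _))
    have h2 := h1.trans (congrArg (FinMap.mk _ _) (m_comp _ (mid _ _ (c.idx.monotone h)) _
      (hmid1 _ _ (c.idx.monotone h)) (hmid2 _ _ (c.idx.monotone h)) (c.le' _ _)).symm)
    exact (FinMap.mk.inj h2).2.2

end

lemma toRSpan_injective {n : ℕ} {R R' : RSimplex n}
    (h : toRSpan.app (op ⦋n⦌) R = toRSpan.app (op ⦋n⦌) R') : R = R' := by
  have hc : ∀ e, (pivotCell e).idx.monotone.functor ⋙ R.functor =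
      (pivotCell e).idx.monotone.functor ⋙ R'.functor := fun e =>
    congrArg (fun Φ : distributahedron.{1}.obj ⦋n⦌ ⟶ timesPlus => cellFunctor Φ (pivotCell e)) h
  have hm : ∀ (s t : DistIdx n) (hst : s ≤ t), t.a ≤ s.b →
      FinMap.mk _ _ (R.functor.map (homOfLE hst)) = ⟨_, _, R'.functor.map (homOfLE hst)⟩ := by
    intro s t hst h'
    have h1 := congrArg (fun F : Grid n n ⥤ FinSet => FinMap.mk _ _
      (F.map (homOfLE (show s.toGrid ≤ t.toGrid from ⟨hst.2, hst.1⟩)))) (hc t.a)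
    have hs := idx_pivotCell t.a s hst.1 h'
    have ht := idx_pivotCell t.a t le_rfl t.hab
    have key : ∀ (F : DistIdx n ⥤ FinSet) (s' t' : DistIdx n) (h' : s' ≤ t'), s' = s → t' = t →
        FinMap.mk _ _ (F.map (homOfLE h')) = ⟨_, _, F.map (homOfLE hst)⟩ := by
      rintro F _ _ _ rfl rfl
      rfl
    exact (key R.functor _ _ ((pivotCell t.a).idx.monotone ⟨hst.2, hst.1⟩) hs ht).symm.trans
      (h1.trans (key R'.functor _ _ ((pivotCell t.a).idx.monotone ⟨hst.2, hst.1⟩) hs ht))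
  refine RSimplex.functor_injective (CategoryTheory.Functor.hext (fun s => ?_) fun s t f => ?_)
  · exact congrArg FinMap.X (hm s s le_rfl s.hab)
  · have h := leOfHom f
    have h1 : s ≤ ⟨s.a, t.b, t.c, h.1.trans t.hab, t.hbc⟩ := ⟨le_rfl, h.2⟩
    have h2 : (⟨s.a, t.b, t.c, h.1.trans t.hab, t.hbc⟩ : DistIdx n) ≤ t := ⟨h.1, le_rfl, le_rfl⟩
    have h3 := FinMap.comp_congr (hm _ _ h1 s.hab) (hm _ _ h2 t.hab)
    rw [← CategoryTheory.Functor.map_comp, ← CategoryTheory.Functor.map_comp] at h3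
    exact (FinMap.mk.inj h3).2.2

lemma toRSpan_surjective {n : ℕ} (Φ : RSpan _⦋n⦌) :
    ∃ R : RSimplex n, toRSpan.app (op ⦋n⦌) R = Φ := by
  change distributahedron.{1}.obj ⦋n⦌ ⟶ timesPlus at Φ
  obtain ⟨W, hW⟩ := exists_functor Φ
  have h : IsRFunctor W := fun p q c => by
    rw [← hW]
    exact (Φ.app (op (⦋p⦌, ⦋q⦌)) c).2
  refine ⟨RSimplex.ofFunctor W h, ?_⟩
  refine NatTrans.ext (funext fun x => ConcreteCategory.hom_ext _ _ fun c => ?_)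
  exact Subtype.ext (hW _ _ c).symm

instance : IsIso toRSpan := by
  have (n : SimplexCategoryᵒᵖ) : IsIso (toRSpan.app n) := by
    rw [isIso_iff_bijective]
    exact ⟨fun _ _ h => toRSpan_injective h, toRSpan_surjective⟩
  exact NatIso.isIso_of_isIso_app _

/-- The projection of `RSpan` to the nerve of the bicategory of bispans. -/
noncomputable def rspanToNerve : RSpan ⟶ bispanNerve := inv toRSpan ≫ ringSpansToNerve

lemma rspanToNerve_toRSpan {n : ℕ} (R : RSimplex n) :
    rspanToNerve.app (op ⦋n⦌) (toRSpan.app (op ⦋n⦌) R) = R.toNerve := by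
  have : toRSpan ≫ rspanToNerve = ringSpansToNerve := IsIso.hom_inv_id_assoc _ _
  exact ConcreteCategory.congr_hom (NatTrans.congr_app this (op ⦋n⦌)) R

lemma hasMatchingLift_rspanToNerve : HasMatchingLift rspanToNerve := by
  intro n F y hy
  obtain ⟨R, h1, h2⟩ := hasMatchingLift_ringSpansToNerve n (F.map (inv toRSpan)) y hy
  refine ⟨toRSpan.app _ R, (rspanToNerve_toRSpan R).trans h1, fun i => ?_⟩
  refine (NatTrans.naturality_apply toRSpan _ _).symm.trans
    ((congrArg (toRSpan.app _) (h2 i)).trans ?_)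
  exact ConcreteCategory.congr_hom (NatTrans.congr_app (IsIso.inv_hom_id toRSpan) _) (F.σ i)

/-! ### Product cones coming from spans -/

/-- The map of posets `(a, [b, c]) ↦ [b, c]`. -/
def DistIdx.mult (n : ℕ) : DistIdx n →o Subinterval n where
  toFun s := ⟨s.b, s.c, s.hbc⟩
  monotone' _ _ h := h.2

/-- The map of posets `(a, [b, c]) ↦ [a, c]`. -/
def DistIdx.add (n : ℕ) : DistIdx n →o Subinterval n where
  toFun s := ⟨s.a, s.c, s.hab.trans s.hbc⟩
  monotone' _ _ h := ⟨h.1, h.2.2⟩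

/-- The simplex of `RSpan` which corresponds to `inclMult.app _ G`. -/
def multSimplex {n : ℕ} (G : Span _⦋n⦌) : RSimplex n :=
  RSimplex.ofFunctor ((DistIdx.mult n).monotone.functor ⋙ G.1)
    fun _ _ c => isDistDiagram_mult c G.1 G.2

/-- The simplex of `RSpan` which corresponds to `inclAdd.app _ G`. -/
def addSimplex {n : ℕ} (G : Span _⦋n⦌) : RSimplex n :=
  RSimplex.ofFunctor ((DistIdx.add n).monotone.functor ⋙ G.1)
    fun _ _ c => isDistDiagram_add c G.1 G.2

lemma toRSpan_multSimplex {n : ℕ} (G : Span _⦋n⦌) :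
    toRSpan.app (op ⦋n⦌) (multSimplex G) = inclMult.app (op ⦋n⦌) G :=
  rfl

lemma toRSpan_addSimplex {n : ℕ} (G : Span _⦋n⦌) :
    toRSpan.app (op ⦋n⦌) (addSimplex G) = inclAdd.app (op ⦋n⦌) G :=
  rfl

/-- A span of finite sets together with its source and its target. -/
structure FinSpan : Type 1 where
  X : FinSet
  U : FinSet
  Y : FinSet
  f : U → X
  g : U → Y

/-- The span given by an edge of `Span`. -/
def spanEdge (G : Span _⦋1⦌) : FinSpan where
  X := G.1.obj (⟨0, 0, le_rfl⟩ : Subinterval 1)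
  U := G.1.obj (⟨0, 1, by decide⟩ : Subinterval 1)
  Y := G.1.obj (⟨1, 1, le_rfl⟩ : Subinterval 1)
  f := G.1.map (homOfLE (show (⟨0, 1, by decide⟩ : Subinterval 1) ≤ ⟨0, 0, le_rfl⟩ from
    ⟨le_rfl, by decide⟩))
  g := G.1.map (homOfLE (show (⟨0, 1, by decide⟩ : Subinterval 1) ≤ ⟨1, 1, le_rfl⟩ from
    ⟨by decide, le_rfl⟩))

/-- The finite set given by a vertex of `Span`. -/
def spanVertex (G : Span _⦋0⦌) : FinSet :=
  G.1.obj (⟨0, 0, le_rfl⟩ : Subinterval 0)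

/-- The spans `e i` exhibit `P` as the disjoint union of their targets. -/
def IsSpanProj {ι : Type} (P : FinSet) (e : ι → FinSpan) : Prop :=
  ∃ (U Y : ι → FinSet) (f : ∀ i, U i → P) (g : ∀ i, U i → Y i),
    (∀ i, Function.Bijective (g i)) ∧
    Function.Bijective (fun x : Σ i, U i => f x.1 x.2) ∧ ∀ i, e i = ⟨P, U i, Y i, f i, g i⟩

lemma edge_multSimplex (G : Span _⦋1⦌) :
    (multSimplex G).toNerve.edge 0 1 (by decide) =
      ⟨(spanEdge G).X, (spanEdge G).Y, ⟨(spanEdge G).U, (spanEdge G).Y, (spanEdge G).f,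
        (spanEdge G).g, id⟩⟩ := by
  refine congrArg (fun q => (⟨(spanEdge G).X, (spanEdge G).Y, ⟨(spanEdge G).U, (spanEdge G).Y,
    (spanEdge G).f, (spanEdge G).g, q⟩⟩ : Edge)) (funext fun x => ?_)
  exact ConcreteCategory.congr_hom (G.1.map_id _) x

lemma edge_addSimplex (G : Span _⦋1⦌) :
    (addSimplex G).toNerve.edge 0 1 (by decide) =
      ⟨(spanEdge G).X, (spanEdge G).Y, ⟨(spanEdge G).U, (spanEdge G).U, (spanEdge G).f,
        id, (spanEdge G).g⟩⟩ := by
  refine congrArg (fun r => (⟨(spanEdge G).X, (spanEdge G).Y, ⟨(spanEdge G).U, (spanEdge G).U,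
    (spanEdge G).f, r, (spanEdge G).g⟩⟩ : Edge)) (funext fun x => ?_)
  exact ConcreteCategory.congr_hom (G.1.map_id _) x

lemma IsProjEdges.congr {ι : Type} {P P' : FinSet} {ε ε' : ι → Edge} (h : IsProjEdges P ε)
    (hP : P' = P) (hε : ∀ i, ε' i = ε i) : IsProjEdges P' ε' := by
  obtain rfl : ε' = ε := funext hε
  subst hP
  exact h

/-- Cones of spans which exhibit a finite set as a disjoint union are sent to product cones. -/
lemma isProductCone_of_isSpanProj {J : Span ⟶ RSpan} (hJ : J = inclMult ∨ J = inclAdd)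
    {ι : Type} [Finite ι] {A : ι → Span _⦋0⦌} (c : OverSimplex A ⦋0⦌)
    (hc : IsSpanProj (spanVertex c.base) fun i => spanEdge (c.leg i)) :
    IsProductCone _ ((overFamilyMap J A).app (op ⦋0⦌) c) := by
  refine hasMatchingLift_rspanToNerve.isProductCone (isProductCone_of_isProjEdges _ ?_)
  obtain ⟨U, Y, f, g, hg, hf, h⟩ := hc
  rcases hJ with rfl | rfl
  · refine IsProjEdges.congr (P := spanVertex c.base)
      (ε := fun i => ⟨_, _, ⟨U i, Y i, f i, g i, id⟩⟩)
      ⟨Y, _, ⟨hg, fun _ => Function.bijective_id, hf⟩, fun i => rfl⟩ ?_ fun i => ?_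
    · exact congrArg (fun ν : NSimplex 0 => ν.x 0) (rspanToNerve_toRSpan (multSimplex c.base))
    · have h1 := edge_multSimplex (c.leg i)
      rw [show spanEdge (c.leg i) = _ from h i] at h1
      have h2 := congrArg (fun ν : NSimplex 1 => ν.edge 0 1 (by decide))
        (rspanToNerve_toRSpan (multSimplex (c.leg i)))
      exact h2.trans h1
  · refine IsProjEdges.congr (P := spanVertex c.base)
      (ε := fun i => ⟨_, _, ⟨U i, U i, f i, id, g i⟩⟩)
      ⟨Y, _, ⟨fun _ => Function.bijective_id, hg, hf⟩, fun i => rfl⟩ ?_ fun i => ?_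
    · exact congrArg (fun ν : NSimplex 0 => ν.x 0) (rspanToNerve_toRSpan (addSimplex c.base))
    · have h1 := edge_addSimplex (c.leg i)
      rw [show spanEdge (c.leg i) = _ from h i] at h1
      have h2 := congrArg (fun ν : NSimplex 1 => ν.edge 0 1 (by decide))
        (rspanToNerve_toRSpan (addSimplex (c.leg i)))
      exact h2.trans h1

/-! ### Terminal vertices and maps out of boundaries -/

lemma boundary_exists_factor {n : ℕ} {m : SimplexCategory}
    (z : (∂Δ[n + 1] : (Δ[n + 1] : SSet.{u}).Subcomplex).obj (op m)) :
    ∃ (j : Fin (n + 2)) (g : m ⟶ ⦋n⦌),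
      SSet.stdSimplex.objEquiv z.1 = g ≫ SimplexCategory.δ j := by
  obtain ⟨z, hz⟩ := z
  induction m using SimplexCategory.rec with | _ m
  rw [SSet.mem_boundary_iff_notMem_range] at hz
  obtain ⟨j, hj⟩ := hz
  obtain ⟨g, hg⟩ := SimplexCategory.eq_comp_δ_of_not_surjective' (SSet.stdSimplex.objEquiv z) j
    fun a ha => hj ⟨a, ha⟩
  exact ⟨j, g, hg⟩

/-- A compatible family of `n`-simplices gives a map from the boundary of the standard
`(n + 1)`-simplex. -/
lemma exists_boundary_desc {Y : SSet.{u}} {n : ℕ} (s : Fin (n + 2) → Y _⦋n⦌)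
    (compat : ∀ (j k : Fin (n + 2)) (m : SimplexCategory) (g h : m ⟶ ⦋n⦌),
      g ≫ SimplexCategory.δ j = h ≫ SimplexCategory.δ k → Y.map g.op (s j) = Y.map h.op (s k)) :
    ∃ f : (∂Δ[n + 1] : SSet.{u}) ⟶ Y,
      ∀ (m : SimplexCategory) (z : (∂Δ[n + 1] : (Δ[n + 1] : SSet.{u}).Subcomplex).obj (op m))
        (j : Fin (n + 2)) (g : m ⟶ ⦋n⦌), SSet.stdSimplex.objEquiv z.1 = g ≫ SimplexCategory.δ j →
          f.app (op m) z = Y.map g.op (s j) := by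
  choose j g hg using @boundary_exists_factor.{u} n
  refine ⟨{ app := fun m => ↾fun z => Y.map (g z).op (s (j z)), naturality := ?_ },
    fun m z j' g' h => compat _ _ _ _ _ ((hg z).symm.trans h)⟩
  intro m m' f
  refine ConcreteCategory.hom_ext _ _ fun z => ?_
  refine Eq.trans ?_ (map_comp_op Y f.unop (g z) (s (j z)))
  refine compat _ _ _ _ _ ((hg _).symm.trans ?_)
  rw [Category.assoc, ← hg z]
  rfl

lemma IsTerminalVertex.exists_simplex {Y : SSet.{u}} {P : Y _⦋0⦌} (hP : IsTerminalVertex Y P)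
    {n : ℕ} (s : Fin (n + 2) → Y _⦋n⦌)
    (compat : ∀ (j k : Fin (n + 2)) (m : SimplexCategory) (g h : m ⟶ ⦋n⦌),
      g ≫ SimplexCategory.δ j = h ≫ SimplexCategory.δ k → Y.map g.op (s j) = Y.map h.op (s k))
    (hs : ∀ (j : Fin (n + 2)) (a : Fin (n + 1)), j.succAbove a = Fin.last (n + 1) →
      vertex (s j) a = P) :
    ∃ x : Y _⦋n + 1⦌, ∀ j, Y.map (SimplexCategory.δ j).op x = s j := by
  obtain ⟨f, hf⟩ := exists_boundary_desc s compat
  obtain ⟨t, ht⟩ := hP n f fun z hz => by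
    obtain ⟨j, g, hg⟩ := boundary_exists_factor z
    rw [hf _ z j g hg]
    refine Eq.trans ?_ (hs j (g.toOrderHom 0) ?_)
    · refine congrArg (fun h : ⦋0⦌ ⟶ ⦋n⦌ => Y.map h.op (s j)) ?_
      ext x
      obtain rfl : x = 0 := Subsingleton.elim (α := Fin 1) _ _
      rfl
    · refine Eq.trans ?_ hz
      exact (congrArg (fun h : ⦋0⦌ ⟶ ⦋n + 1⦌ => h.toOrderHom 0) hg).symm
  refine ⟨SSet.yonedaEquiv t, fun j => ?_⟩
  have hj : SSet.stdSimplex.objEquiv.symm (SimplexCategory.δ j) ∈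
      (∂Δ[n + 1] : (Δ[n + 1] : SSet.{u}).Subcomplex).obj (op ⦋n⦌) := by
    rw [SSet.mem_boundary_iff_notMem_range]
    exact ⟨j, fun ⟨a, ha⟩ => Fin.succAbove_ne j a ha⟩
  have h1 := hf ⦋n⦌ ⟨_, hj⟩ j (𝟙 _) (Category.id_comp _).symm
  have h2 := ConcreteCategory.congr_hom (NatTrans.congr_app ht (op ⦋n⦌)) ⟨_, hj⟩
  have h3 : Y.map (𝟙 ⦋n⦌).op (s j) = s j := Functor.map_id_apply Y _ (s j)
  refine Eq.trans ?_ (h2.trans (h1.trans h3))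
  refine (NatTrans.naturality_apply t _ _).symm.trans ?_
  rfl

/-- The lifting property of a terminal vertex against the boundary of an edge. -/
lemma IsTerminalVertex.exists_edge {Y : SSet.{u}} {P : Y _⦋0⦌} (hP : IsTerminalVertex Y P)
    (Q : Y _⦋0⦌) : ∃ x : Y _⦋1⦌, Y.map (SimplexCategory.δ 1).op x = Q ∧
      Y.map (SimplexCategory.δ 0).op x = P := by
  obtain ⟨x, hx⟩ := hP.exists_simplex (n := 0) ![P, Q] (fun j k m g h e => by
    have h1 := congrArg (fun f : m ⟶ ⦋1⦌ => f.toOrderHom 0) e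
    have h2 : ∀ (j k : Fin 2) (a b : Fin 1), j.succAbove a = k.succAbove b → j = k := by decide
    obtain rfl := h2 j k _ _ h1
    obtain rfl : g = h := by
      ext x
      exact congrArg Fin.val (Subsingleton.elim (α := Fin 1) _ _)
    rfl) (fun j a h => by
    have h2 : ∀ (j : Fin 2) (a : Fin 1), j.succAbove a = Fin.last 1 → j = 0 := by decide
    obtain rfl := h2 j a h
    obtain rfl : a = 0 := Subsingleton.elim (α := Fin 1) _ _
    refine Eq.trans ?_ (Functor.map_id_apply Y _ P)
    refine congrArg (fun h : ⦋0⦌ ⟶ ⦋0⦌ => Y.map h.op P) ?_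
    ext x
    exact congrArg Fin.val (Subsingleton.elim (α := Fin 1) _ _))
  exact ⟨x, hx 1, hx 0⟩

/-- The lifting property of a terminal vertex against the boundary of a triangle. -/
lemma IsTerminalVertex.exists_triangle {Y : SSet.{u}} {P : Y _⦋0⦌} (hP : IsTerminalVertex Y P)
    (s : Fin 3 → Y _⦋1⦌) (w : Fin 3 → Y _⦋0⦌)
    (hs : ∀ (j : Fin 3) (a : Fin 2), vertex (s j) a = w (j.succAbove a)) (hw : w 2 = P) :
    ∃ x : Y _⦋2⦌, ∀ j, Y.map (SimplexCategory.δ j).op x = s j := by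
  refine hP.exists_simplex (n := 1) s (fun j k m g h e => ?_) fun j a ha =>
    (hs j a).trans ((congrArg w ha).trans hw)
  have h1 : ∀ x, j.succAbove (g.toOrderHom x) = k.succAbove (h.toOrderHom x) := fun x =>
    congrArg (fun f : m ⟶ ⦋2⦌ => f.toOrderHom x) e
  by_cases hjk : j = k
  · subst hjk
    obtain rfl : g = h := by
      ext x
      exact congrArg Fin.val (Fin.succAbove_right_injective (h1 x))
    rfl
  · have h2 : ∀ j k : Fin 3, j ≠ k → ∀ a b a' b' : Fin 2, j.succAbove a = k.succAbove b →
        j.succAbove a' = k.succAbove b' → a = a' ∧ b = b' := by decide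
    have hc : ∀ (f : m ⟶ ⦋1⦌) (x : Y _⦋1⦌), (∀ y, f.toOrderHom 0 = f.toOrderHom y) →
        Y.map f.op x = Y.map (SimplexCategory.const m ⦋0⦌ 0).op (vertex x (f.toOrderHom 0)) := by
      intro f x hf
      refine Eq.trans ?_ (map_comp_op Y _ _ _)
      refine congrArg (fun f : m ⟶ ⦋1⦌ => Y.map f.op x) ?_
      ext y
      exact congrArg Fin.val (hf y).symm
    rw [hc g _ fun y => (h2 j k hjk _ _ _ _ (h1 0) (h1 y)).1,
      hc h _ fun y => (h2 j k hjk _ _ _ _ (h1 0) (h1 y)).2, hs, hs]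
    exact congrArg (fun a => Y.map _ (w a)) (h1 0)

/-! ### Product cones in the nerve of a category -/

section

variable {D : Type u} [Category.{v} D] {ι : Type} {A : ι → (nerve D) _⦋0⦌}

lemma OverSimplex.exists_eq_mk (c : OverSimplex A ⦋0⦌) :
    ∃ (Q : D) (B : ι → D) (p : ∀ i, Q ⟶ B i), c.base = ComposableArrows.mk₀ Q ∧
      (∀ i, c.leg i = ComposableArrows.mk₁ (p i)) ∧ ∀ i, A i = ComposableArrows.mk₀ (B i) := by
  obtain ⟨Q, hQ⟩ := ComposableArrows.mk₀_surjective c.base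
  have : ∀ i, ∃ (B : D) (p : Q ⟶ B), c.leg i = ComposableArrows.mk₁ p ∧
      A i = ComposableArrows.mk₀ B := by
    intro i
    obtain ⟨X, Y, f, hf⟩ := ComposableArrows.mk₁_surjective (c.leg i)
    have h1 := (c.restrict i).trans hQ
    have h2 := c.last i
    rw [hf] at h1 h2
    have h3 : X = Q := congrArg (fun F : ComposableArrows D 0 => F.obj 0) h1
    subst h3
    refine ⟨Y, f, hf, h2.symm.trans (ComposableArrows.ext₀ rfl)⟩
  choose B p h1 h2 using this
  exact ⟨Q, B, p, hQ, h1, h2⟩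

variable {B : ι → D} (hA : ∀ i, A i = ComposableArrows.mk₀ (B i))

/-- The cone in the nerve given by a cone in the category. -/
def nerveCone {P : D} (g : ∀ i, P ⟶ B i) : OverSimplex A ⦋0⦌ where
  base := ComposableArrows.mk₀ P
  leg i := ComposableArrows.mk₁ (g i)
  restrict _ := ComposableArrows.ext₀ rfl
  last i := (ComposableArrows.ext₀ rfl).trans (hA i).symm

/-- The edge between cones given by a map into the vertex of a cone. -/
def nerveConeHom {P Q : D} (φ : P ⟶ Q) (p : ∀ i, Q ⟶ B i) : OverSimplex A ⦋1⦌ where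
  base := ComposableArrows.mk₁ φ
  leg i := ComposableArrows.mk₂ φ (p i)
  restrict _ := ComposableArrows.ext₁ rfl rfl (by
    refine Eq.trans ?_ ((Category.id_comp _).trans (Category.comp_id _)).symm
    rfl)
  last i := (ComposableArrows.ext₀ rfl).trans (hA i).symm

lemma vertex_nerveConeHom_zero {P Q : D} (φ : P ⟶ Q) (p : ∀ i, Q ⟶ B i) :
    vertex (X := overFamily A) (n := ⦋1⦌) (nerveConeHom hA φ p) 0 =
      nerveCone hA fun i => φ ≫ p i :=
  OverSimplex.ext (ComposableArrows.ext₀ rfl) (funext fun i => ComposableArrows.ext₁ rfl rfl (by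
    refine Eq.trans ?_ ((Category.id_comp _).trans (Category.comp_id _)).symm
    rfl))

lemma vertex_nerveConeHom_one {P Q : D} (φ : P ⟶ Q) (p : ∀ i, Q ⟶ B i) :
    vertex (X := overFamily A) (n := ⦋1⦌) (nerveConeHom hA φ p) 1 = nerveCone hA p :=
  OverSimplex.ext (ComposableArrows.ext₀ rfl) (funext fun i => ComposableArrows.ext₁ rfl rfl (by
    refine Eq.trans ?_ ((Category.id_comp _).trans (Category.comp_id _)).symm
    rfl))

lemma joinPoint_map_δ (j : Fin 2) :
    joinPoint.map (SimplexCategory.δ j : ⦋0⦌ ⟶ ⦋1⦌) =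
      (SimplexCategory.δ j.castSucc : ⦋1⦌ ⟶ ⦋2⦌) := by
  ext x
  refine congrArg Fin.val ?_
  change Fin 2 at x
  fin_cases x
  · refine (joinPointMap_castSucc (SimplexCategory.δ j : ⦋0⦌ ⟶ ⦋1⦌).toOrderHom 0).trans ?_
    fin_cases j <;> rfl
  · refine (joinPointMap_last (SimplexCategory.δ j : ⦋0⦌ ⟶ ⦋1⦌).toOrderHom).trans ?_
    fin_cases j <;> rfl

/-- Terminality in dimension `1` gives the existence of maps to a product. -/
lemma IsProductCone.exists_hom {Q : D} {p : ∀ i, Q ⟶ B i}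
    (hc : IsProductCone A (nerveCone hA p)) {P : D} (g : ∀ i, P ⟶ B i) :
    ∃ φ : P ⟶ Q, ∀ i, φ ≫ p i = g i := by
  obtain ⟨x, h1, h0⟩ := IsTerminalVertex.exists_edge hc (nerveCone hA g)
  change OverSimplex A ⦋1⦌ at x
  obtain ⟨X, Y, φ, hφ⟩ := ComposableArrows.mk₁_surjective x.base
  have b1 := congrArg OverSimplex.base h1
  have b0 := congrArg OverSimplex.base h0
  change (nerve D).map (SimplexCategory.δ 1).op x.base = _ at b1
  change (nerve D).map (SimplexCategory.δ 0).op x.base = _ at b0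
  rw [hφ] at b1 b0
  have b1' : X = P := congrArg (fun F : ComposableArrows D 0 => F.obj 0) b1
  have b0' : Y = Q := congrArg (fun F : ComposableArrows D 0 => F.obj 0) b0
  subst b1' b0'
  refine ⟨φ, fun i => ?_⟩
  have l1 := congrArg (fun y : OverSimplex A ⦋0⦌ => y.leg i) h1
  have l0 := congrArg (fun y : OverSimplex A ⦋0⦌ => y.leg i) h0
  have r := (x.restrict i).trans hφ
  change (nerve D).map (joinPoint.map (SimplexCategory.δ 1)).op (x.leg i) = _ at l1
  change (nerve D).map (joinPoint.map (SimplexCategory.δ 0)).op (x.leg i) = _ at l0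
  rw [joinPoint_map_δ] at l1 l0
  generalize x.leg i = y at l1 l0 r
  change ComposableArrows D 2 at y
  have l1' : Arrow.mk (y.map' 0 2) = Arrow.mk (g i) :=
    congrArg (fun F : ComposableArrows D 1 => Arrow.mk (F.map' 0 1)) l1
  have l0' : Arrow.mk (y.map' 1 2) = Arrow.mk (p i) :=
    congrArg (fun F : ComposableArrows D 1 => Arrow.mk (F.map' 0 1)) l0
  have r' : Arrow.mk (y.map' 0 1) = Arrow.mk φ :=
    congrArg (fun F : ComposableArrows D 1 => Arrow.mk (F.map' 0 1)) r
  have hy : y = ComposableArrows.mk₂ φ (p i) := ComposableArrows.ext₂_of_arrow r' l0'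
  subst hy
  exact (Arrow.mk_inj _ _).mp l1'

/-- Terminality in dimension `2` gives the uniqueness of maps to a product: the cones over `φ`, `ψ`
and the identity form the boundary of a triangle. -/
lemma IsProductCone.hom_ext {Q : D} {p : ∀ i, Q ⟶ B i}
    (hc : IsProductCone A (nerveCone hA p)) {P : D} {φ ψ : P ⟶ Q}
    (h : ∀ i, φ ≫ p i = ψ ≫ p i) : φ = ψ := by
  obtain ⟨x, hx⟩ := IsTerminalVertex.exists_triangle hc
    ![nerveConeHom hA (𝟙 Q) p, nerveConeHom hA ψ p, nerveConeHom hA φ p]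
    ![nerveCone hA fun i => φ ≫ p i, nerveCone hA p, nerveCone hA p] (fun j a => by
      have h' := funext h
      fin_cases j <;> fin_cases a
      · refine (vertex_nerveConeHom_zero hA _ p).trans ?_
        exact congrArg (nerveCone hA) (funext fun i => Category.id_comp _)
      · exact vertex_nerveConeHom_one hA _ p
      · refine (vertex_nerveConeHom_zero hA _ p).trans ?_
        exact congrArg (nerveCone hA) h'.symm
      · exact vertex_nerveConeHom_one hA _ p
      · exact vertex_nerveConeHom_zero hA _ p
      · exact vertex_nerveConeHom_one hA _ p) rfl
  change OverSimplex A ⦋2⦌ at x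
  have h0 := congrArg OverSimplex.base (hx 0)
  have h1 := congrArg OverSimplex.base (hx 1)
  have h2 := congrArg OverSimplex.base (hx 2)
  change (nerve D).map (SimplexCategory.δ 0).op x.base = ComposableArrows.mk₁ (𝟙 Q) at h0
  change (nerve D).map (SimplexCategory.δ 1).op x.base = ComposableArrows.mk₁ ψ at h1
  change (nerve D).map (SimplexCategory.δ 2).op x.base = ComposableArrows.mk₁ φ at h2
  generalize x.base = y at h0 h1 h2
  change ComposableArrows D 2 at y
  have l1 : Arrow.mk (y.map' 0 2) = Arrow.mk ψ :=
    congrArg (fun F : ComposableArrows D 1 => Arrow.mk (F.map' 0 1)) h1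
  have l0 : Arrow.mk (y.map' 1 2) = Arrow.mk (𝟙 Q) :=
    congrArg (fun F : ComposableArrows D 1 => Arrow.mk (F.map' 0 1)) h0
  have l2 : Arrow.mk (y.map' 0 1) = Arrow.mk φ :=
    congrArg (fun F : ComposableArrows D 1 => Arrow.mk (F.map' 0 1)) h2
  have hy : y = ComposableArrows.mk₂ φ (𝟙 Q) := ComposableArrows.ext₂_of_arrow l2 l0
  subst hy
  have h3 : φ ≫ 𝟙 Q = ψ := (Arrow.mk_inj _ _).mp l1
  exact (Category.comp_id φ).symm.trans h3

/-- A product cone in the nerve of a category is given by a product diagram. -/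
lemma IsProductCone.exists_isLimit {c : OverSimplex A ⦋0⦌} (hc : IsProductCone A c) :
    ∃ (Q : D) (B : ι → D) (p : ∀ i, Q ⟶ B i), c.base = ComposableArrows.mk₀ Q ∧
      (∀ i, c.leg i = ComposableArrows.mk₁ (p i)) ∧
      (∀ (P : D) (g : ∀ i, P ⟶ B i), ∃ φ : P ⟶ Q, ∀ i, φ ≫ p i = g i) ∧
      ∀ (P : D) (φ ψ : P ⟶ Q), (∀ i, φ ≫ p i = ψ ≫ p i) → φ = ψ := by
  obtain ⟨Q, B, p, hQ, hp, hA⟩ := c.exists_eq_mk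
  obtain rfl : c = nerveCone hA p := OverSimplex.ext hQ (funext hp)
  exact ⟨Q, B, p, rfl, fun _ => rfl, fun P g => IsProductCone.exists_hom hA hc g,
    fun P φ ψ h => IsProductCone.hom_ext hA hc h⟩

end

/-! ### Product cones of pointed finite sets and of finite sets -/

/-- The underlying map of a morphism of pointed finite sets. -/
def ptMap {P Q : FinSetPointed} (f : P ⟶ Q) : P.obj.X → Q.obj.X := f.hom.toFun

lemma ptMap_point {P Q : FinSetPointed} (f : P ⟶ Q) : ptMap f P.obj.point = Q.obj.point :=
  f.hom.map_point

/-- The pointed maps `f i : B i → Q` exhibit `Q` as a wedge sum. -/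
structure IsWedge {ι : Type} {Q : FinSetPointed} {B : ι → FinSetPointed} (f : ∀ i, B i ⟶ Q) :
    Prop where
  eq_point : ∀ i x, ptMap (f i) x = Q.obj.point → x = (B i).obj.point
  injective : ∀ i j x y, ptMap (f i) x = ptMap (f j) y → ptMap (f i) x ≠ Q.obj.point →
    (⟨i, x⟩ : Σ i, (B i).obj.X) = ⟨j, y⟩
  surjective : ∀ z, z ≠ Q.obj.point → ∃ i x, ptMap (f i) x = z

section

variable {J : Span ⟶ RSpan} (hJ : J = inclMult ∨ J = inclAdd) {ι : Type}

include hJ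

/-- Wedge sums are sent to product cones. -/
lemma IsWedge.isProductCone [Finite ι] {A : ι → (nerve FinSetPointedᵒᵖ) _⦋0⦌}
    (c : OverSimplex A ⦋0⦌) {Q : FinSetPointed} {B : ι → FinSetPointed} {f : ∀ i, B i ⟶ Q}
    (hf : IsWedge f) (hb : c.base = ComposableArrows.mk₀ (op Q))
    (hl : ∀ i, c.leg i = ComposableArrows.mk₁ (f i).op) :
    IsProductCone _ ((overFamilyMap (fromPointed ≫ J) A).app (op ⦋0⦌) c) := by
  have key : IsSpanProj (spanVertex (fromPointed.app (op ⦋0⦌) (ComposableArrows.mk₀ (op Q))))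
      fun i => spanEdge (fromPointed.app (op ⦋1⦌) (ComposableArrows.mk₁ (f i).op)) := by
    refine ⟨_, _, fun i => (spanEdge (fromPointed.app (op ⦋1⦌)
      (ComposableArrows.mk₁ (f i).op))).f, fun i => (spanEdge (fromPointed.app (op ⦋1⦌)
      (ComposableArrows.mk₁ (f i).op))).g, fun i => ⟨?_, ?_⟩, ⟨?_, ?_⟩, fun i => rfl⟩
    · intro x y h
      have h' := congrArg (Subtype.val (p := _)) h
      exact Subtype.ext h'
    · rintro ⟨x, hx⟩
      exact ⟨⟨x, fun h => hx (hf.eq_point i x h)⟩, rfl⟩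
    · rintro ⟨i, x, hx⟩ ⟨j, y, hy⟩ h
      have := hf.injective i j x y (congrArg Subtype.val h) hx
      cases this
      rfl
    · rintro ⟨z, hz⟩
      obtain ⟨i, x, hx⟩ := hf.surjective z hz
      exact ⟨⟨i, x, fun h => hz (hx.symm.trans h)⟩, Subtype.ext hx⟩
  refine isProductCone_of_isSpanProj hJ ((overFamilyMap fromPointed A).app (op ⦋0⦌) c) ?_
  have h1 : (fun i => spanEdge (fromPointed.app (op ⦋1⦌) (c.leg i))) =
      fun i => spanEdge (fromPointed.app (op ⦋1⦌) (ComposableArrows.mk₁ (f i).op)) :=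
    funext fun i => by rw [hl]
  rw [← h1, ← hb] at key
  exact key

omit hJ in
/-- Coproducts of pointed finite sets are wedge sums. -/
lemma isWedge_of_exists_of_eq [Finite ι] {Q : FinSetPointed} {B : ι → FinSetPointed}
    {f : ∀ i, B i ⟶ Q}
    (h1 : ∀ (R : FinSetPointed) (g : ∀ i, B i ⟶ R), ∃ φ : Q ⟶ R, ∀ i, f i ≫ φ = g i)
    (h2 : ∀ (R : FinSetPointed) (φ ψ : Q ⟶ R), (∀ i, f i ≫ φ = f i ≫ ψ) → φ = ψ) :
    IsWedge f := by
  classical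
  have (i : ι) : Finite (B i).obj.X := (B i).property
  -- Maps to the wedge sum show that the given maps are jointly injective.
  let R : FinSetPointed := ⟨⟨Option (Σ i, (B i).obj.X), none⟩, inferInstanceAs (Finite (Option _))⟩
  obtain ⟨φ, hφ⟩ := h1 R fun i => ⟨⟨fun x => if x = (B i).obj.point then none else some ⟨i, x⟩,
    if_pos rfl⟩⟩
  have hφ' : ∀ i x, ptMap φ (ptMap (f i) x) =
      if x = (B i).obj.point then none else some ⟨i, x⟩ := fun i x =>
    congrArg (fun g : B i ⟶ R => ptMap g x) (hφ i)
  have h3 : ∀ i x, ptMap (f i) x = Q.obj.point → x = (B i).obj.point := by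
    intro i x hx
    by_contra h
    have := hφ' i x
    rw [hx, ptMap_point, if_neg h] at this
    exact Option.some_ne_none _ this.symm
  refine ⟨h3, fun i j x y h h' => ?_, fun z hz => ?_⟩
  · have e := hφ' i x
    have hx : x ≠ (B i).obj.point := by
      rintro rfl
      exact h' (ptMap_point _)
    have hy : y ≠ (B j).obj.point := by
      rintro rfl
      exact h' (h.trans (ptMap_point _))
    rw [h, hφ' j y, if_neg hx, if_neg hy] at e
    exact (Option.some.inj e).symm
  · by_contra! hn
    -- An element which is not in the image is not detected by the given maps.
    let S : FinSetPointed := ⟨⟨Bool, false⟩, inferInstanceAs (Finite Bool)⟩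
    let χ : Q ⟶ S := ⟨⟨fun w => decide (w = z), decide_eq_false hz.symm⟩⟩
    let χ' : Q ⟶ S := ⟨⟨fun _ => false, rfl⟩⟩
    have := h2 S χ χ' fun i => by
      refine ObjectProperty.hom_ext _ (Pointed.Hom.ext (funext fun x => ?_))
      exact decide_eq_false (hn i x)
    have h4 : decide (z = z) = false := congrArg (fun g : Q ⟶ S => ptMap g z) this
    simp at h4

/-- The functor from pointed finite sets preserves finite products. -/
lemma preservesFiniteProducts_fromPointed : PreservesFiniteProducts (fromPointed ≫ J) := by
  intro ι _ A c hc
  obtain ⟨Q, B, p, hQ, hp, h1, h2⟩ := IsProductCone.exists_isLimit hc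
  refine IsWedge.isProductCone hJ c (f := fun i => (p i).unop)
    (isWedge_of_exists_of_eq (fun R g => ?_) fun R φ ψ h => ?_) hQ hp
  · obtain ⟨φ, hφ⟩ := h1 (op R) fun i => (g i).op
    exact ⟨φ.unop, fun i => Quiver.Hom.op_inj (hφ i)⟩
  · exact Quiver.Hom.op_inj (h2 (op R) φ.op ψ.op fun i => Quiver.Hom.unop_inj (h i))

/-- The functor from finite sets preserves finite products. -/
lemma preservesFiniteProducts_addPoint :
    PreservesFiniteProducts (nerveMap addPoint.op ≫ fromPointed ≫ J) := by
  classical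
  intro ι _ A c hc
  obtain ⟨Q, B, p, hQ, hp, h1, h2⟩ := IsProductCone.exists_isLimit hc
  have h1' : ∀ (R : FinSet) (g : ∀ i, (B i).unop ⟶ R), ∃ φ : Q.unop ⟶ R,
      ∀ i x, φ ((p i).unop x) = g i x := by
    intro R g
    obtain ⟨φ, hφ⟩ := h1 (op R) fun i => (g i).op
    exact ⟨φ.unop, fun i x => congrArg (fun f : op R ⟶ B i => f.unop x) (hφ i)⟩
  have h2' : ∀ (R : FinSet) (φ ψ : Q.unop ⟶ R),
      (∀ i x, φ ((p i).unop x) = ψ ((p i).unop x)) → φ = ψ := fun R φ ψ h =>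
    Quiver.Hom.op_inj (h2 (op R) φ.op ψ.op fun i => Quiver.Hom.unop_inj
      (ConcreteCategory.hom_ext _ _ (h i)))
  have hf : IsWedge fun i => addPoint.map (p i).unop := by
    refine ⟨fun i x => ?_, fun i j x y h h' => ?_, fun z hz => ?_⟩
    · cases x with
      | none => exact fun _ => rfl
      | some x => exact fun h => absurd h (Option.some_ne_none _)
    · cases x with
      | none => exact absurd rfl h'
      | some x =>
      cases y with
      | none => exact absurd h (Option.some_ne_none _)
      | some y =>
      obtain ⟨φ, hφ⟩ := h1' (FintypeCat.of (Σ i, (B i).unop.obj)) fun i =>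
        FintypeCat.homMk fun x => ⟨i, x⟩
      have h3 : (p i).unop x = (p j).unop y := Option.some.inj h
      have h4 : (⟨i, x⟩ : Σ i, (B i).unop.obj) = ⟨j, y⟩ :=
        (hφ i x).symm.trans ((congrArg φ h3).trans (hφ j y))
      cases h4
      rfl
    · cases z with
      | none => exact absurd rfl hz
      | some z =>
      by_contra! hn
      have h3 := h2' (FintypeCat.of Bool) (FintypeCat.homMk fun w => decide (w = z))
        (FintypeCat.homMk fun _ => false) fun i x =>
          decide_eq_false fun h => hn i (some x) (congrArg some h)
      have h4 : decide (z = z) = false := ConcreteCategory.congr_hom h3 z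
      simp at h4
  refine IsWedge.isProductCone hJ ((overFamilyMap (nerveMap addPoint.op) A).app (op ⦋0⦌) c) hf
    ?_ fun i => ?_
  · refine (congrArg ((nerveMap addPoint.op).app (op ⦋0⦌)) hQ).trans ?_
    exact ComposableArrows.ext₀ rfl
  · refine (congrArg ((nerveMap addPoint.op).app (op ⦋1⦌)) (hp i)).trans ?_
    exact ComposableArrows.ext₁ rfl rfl ((Category.id_comp _).trans (Category.comp_id _)).symm

end

/-! ### Vertices of `RSpan` and disjoint unions -/

instance : Subsingleton (DistIdx 0) :=
  ⟨fun _ _ => DistIdx.ext (Subsingleton.elim (α := Fin 1) _ _) (Subsingleton.elim (α := Fin 1) _ _)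
    (Subsingleton.elim (α := Fin 1) _ _)⟩

lemma functor_ext_of_subsingleton {S : Type} [PartialOrder S] [Subsingleton S] {F G : S ⥤ FinSet}
    (s : S) (h : F.obj s = G.obj s) : F = G := by
  refine CategoryTheory.Functor.hext (fun t => ?_) fun t t' f => ?_
  · rwa [Subsingleton.elim t s]
  · obtain rfl := Subsingleton.elim s t
    obtain rfl := Subsingleton.elim s t'
    obtain rfl := Subsingleton.elim (𝟙 s) f
    rw [F.map_id, G.map_id, h]

/-- The only index of a vertex. -/
def DistIdx.zero : DistIdx 0 := ⟨0, 0, 0, le_rfl, le_rfl⟩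

lemma toRSpan_eq_rspanObj (R : RSimplex 0) :
    toRSpan.app (op ⦋0⦌) R = rspanObj (R.obj DistIdx.zero) := by
  have : R = multSimplex (fromFinSet.app (op ⦋0⦌)
      (ComposableArrows.mk₀ (op (R.obj DistIdx.zero)))) :=
    RSimplex.functor_injective (functor_ext_of_subsingleton DistIdx.zero rfl)
  exact (congrArg (toRSpan.app (op ⦋0⦌)) this).trans (toRSpan_multSimplex _)

lemma exists_eq_rspanObj (y : RSpan _⦋0⦌) : ∃ X, y = rspanObj X := by
  obtain ⟨R, rfl⟩ := toRSpan_surjective y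
  exact ⟨_, toRSpan_eq_rspanObj R⟩

lemma app_eq_rspanObj {J : Span ⟶ RSpan} (hJ : J = inclMult ∨ J = inclAdd) (G : Span _⦋0⦌) :
    J.app (op ⦋0⦌) G = rspanObj (spanVertex G) := by
  rcases hJ with rfl | rfl
  · exact (toRSpan_multSimplex G).symm.trans (toRSpan_eq_rspanObj _)
  · exact (toRSpan_addSimplex G).symm.trans (toRSpan_eq_rspanObj _)

/-- The disjoint union is a product in `RSpan`. -/
lemma isProductCone_disjointUnionCone {ι : Type} [Finite ι] (X : ι → FinSet) :
    IsProductCone (fun i => rspanObj (X i)) (disjointUnionCone X) := by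
  let c : OverSimplex (fun i => fromFinSet.app (op ⦋0⦌) (ComposableArrows.mk₀ (op (X i)))) ⦋0⦌ :=
    { base := fromFinSet.app (op ⦋0⦌) (ComposableArrows.mk₀ (op (FintypeCat.of (Σ i, (X i).obj))))
      leg := fun i => fromFinSet.app (op ⦋1⦌) (ComposableArrows.mk₁
        (FintypeCat.homMk fun x => ⟨i, x⟩ : X i ⟶ FintypeCat.of (Σ i, (X i).obj)).op)
      restrict := fun i => (NatTrans.naturality_apply fromFinSet _ _).symm.trans
        (congrArg (fromFinSet.app (op ⦋0⦌)) (ComposableArrows.ext₀ rfl))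
      last := fun i => (NatTrans.naturality_apply fromFinSet _ _).symm.trans
        (congrArg (fromFinSet.app (op ⦋0⦌)) (ComposableArrows.ext₀ rfl)) }
  refine isProductCone_of_isSpanProj (.inl rfl) c ⟨X, X, fun i x => ⟨i, x⟩, fun i => id,
    fun i => Function.bijective_id, Function.bijective_id, fun i => rfl⟩

lemma hasFiniteProducts_rspan : HasFiniteProducts RSpan := by
  intro ι _ A
  choose X hX using fun i => exists_eq_rspanObj (A i)
  obtain rfl : A = fun i => rspanObj (X i) := funext hX
  exact ⟨_, isProductCone_disjointUnionCone X⟩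

lemma nonempty_invStruct_edgeMk {D : Type u} [Category.{v} D] {x y : D} (α : x ≅ y) :
    Nonempty (nerve.edgeMk α.hom).InvStruct := by
  obtain ⟨h⟩ := (nerve.nonempty_compStruct_iff α.hom α.inv (𝟙 x)).mpr α.hom_inv_id
  obtain ⟨h'⟩ := (nerve.nonempty_compStruct_iff α.inv α.hom (𝟙 y)).mpr α.inv_hom_id
  rw [nerve.edgeMk_id] at h h'
  exact ⟨⟨_, h, h'⟩⟩

/-- Isomorphic finite sets are equivalent vertices. -/
lemma exists_edge_rspanObj {X Y : FinSet} (α : X ≅ Y) :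
    ∃ e : SSet.Edge (rspanObj X) (rspanObj Y), Nonempty e.InvStruct := by
  obtain ⟨h⟩ := nonempty_invStruct_edgeMk α.symm.op
  exact ⟨_, ⟨h.map (fromFinSet ≫ inclMult)⟩⟩

section

variable {J : Span ⟶ RSpan} (hJ : J = inclMult ∨ J = inclAdd)

include hJ

lemma exists_edge_of_iso (X : FinSet) : ∃ e : SSet.Edge
    (J.app (op ⦋0⦌) (fromPointed.app (op ⦋0⦌) (ComposableArrows.mk₀ (op (addPoint.obj X)))))
      (rspanObj X), Nonempty e.InvStruct := by
  rw [app_eq_rspanObj hJ]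
  refine exists_edge_rspanObj (FintypeCat.equivEquivIso ?_)
  exact
    { toFun := fun x => x.1.get (Option.ne_none_iff_isSome.mp x.2)
      invFun := fun x => ⟨some x, Option.some_ne_none x⟩
      left_inv := fun x => Subtype.ext (Option.some_get _)
      right_inv := fun x => rfl }

lemma isEssentiallySurjective_fromPointed : IsEssentiallySurjective (fromPointed ≫ J) := by
  intro y
  obtain ⟨X, rfl⟩ := exists_eq_rspanObj y
  exact ⟨_, exists_edge_of_iso hJ X⟩

lemma isEssentiallySurjective_addPoint :
    IsEssentiallySurjective (nerveMap addPoint.op ≫ fromPointed ≫ J) := by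
  intro y
  obtain ⟨X, rfl⟩ := exists_eq_rspanObj y
  have h := exists_edge_of_iso hJ X
  have e : (nerveMap addPoint.op).app (op ⦋0⦌) (ComposableArrows.mk₀ (op X)) =
    ComposableArrows.mk₀ (op (addPoint.obj X)) := ComposableArrows.ext₀ rfl
  rw [← e] at h
  exact ⟨ComposableArrows.mk₀ (op X), h⟩

end

lemma quasicategory_rspan : SSet.Quasicategory RSpan :=
  have := isTwoOneCategory_bispanNerve.1
  hasMatchingLift_rspanToNerve.quasicategory

end RingSpans

theorem mainTheorem6 :
    -- `RSpan` is a quasicategory, equivalent to a `(2,1)`-category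
    SSet.Quasicategory RingSpans.RSpan ∧
    (∃ (C : SSet.{1}) (p : RingSpans.RSpan ⟶ C),
      RingSpans.IsTwoOneCategory C ∧ RingSpans.IsAcyclicKan p) ∧
    -- it has finite products, given by disjoint unions
    RingSpans.HasFiniteProducts RingSpans.RSpan ∧
    (∀ (ι : Type) [Finite ι] (X : ι → RingSpans.FinSet),
      RingSpans.IsProductCone (fun i => RingSpans.rspanObj (X i))
        (RingSpans.disjointUnionCone X)) ∧
    -- both maps from the opposite of the category of pointed finite sets make it into a theory
    (∀ J : RingSpans.Span ⟶ RingSpans.RSpan, J = RingSpans.inclMult ∨ J = RingSpans.inclAdd →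
      RingSpans.PreservesFiniteProducts (RingSpans.fromPointed ≫ J) ∧
      RingSpans.IsEssentiallySurjective (RingSpans.fromPointed ≫ J) ∧
      RingSpans.IsAlgebraicTheory
        (nerveMap RingSpans.addPoint.op ≫ RingSpans.fromPointed ≫ J)) :=
  ⟨RingSpans.quasicategory_rspan,
    ⟨RingSpans.bispanNerve, RingSpans.rspanToNerve, RingSpans.isTwoOneCategory_bispanNerve,
      RingSpans.hasMatchingLift_rspanToNerve.isAcyclicKan⟩,
    RingSpans.hasFiniteProducts_rspan,
    fun _ _ X => RingSpans.isProductCone_disjointUnionCone X,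
    fun _ hJ => ⟨RingSpans.preservesFiniteProducts_fromPointed hJ,
      RingSpans.isEssentiallySurjective_fromPointed hJ,
      RingSpans.quasicategory_rspan,
      RingSpans.preservesFiniteProducts_addPoint hJ,
      RingSpans.isEssentiallySurjective_addPoint hJ⟩⟩
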